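/- Let $B=\{x\in\mathbb R^3:|x|<1\}$, let $S^2\subset\mathbb R^3$ and $S^3\subset\mathbb C^2\cong\mathbb R^4$ be the unit spheres, and let $W^{1,3}(B,S^k)$ denote the maps in $W^{1,3}(B,\mathbb R^{k+1})$ with values in $S^k$ almost everywhere. Let $\omega$ be the volume form of $S^2$, so that for $u\in W^{1,3}(B,S^2)$, with weak differential $du$, the pullback is the two-form $(u^*\omega)_x(a,b)=\det\bigl(u(x),du_x(a),du_x(b)\bigr)$. Let $\mathfrak h:S^3\to S^2\subset\mathbb C\times\mathbb R$, $\mathfrak h(w_1,w_2)=(2w_1\overline{w_2},\,|w_1|^2-|w_2|^2)$, be the Hopf fibration. Let $u\in W^{1,3}(B,S^2)$ and let $\eta\in L^3$ be a one-form on $B$ such that $d\eta=u^*\omega$ in the sense of distributions on $B$. Then there exists $\check u\in W^{1,3}(B,S^3)$ such that $\mathfrak h\circ\check u=u$ almost everywhere in $B$ and $$|du|^2+|\eta|^2=4\,|d\check u|^2\qquad\text{almost everywhere in }B,$$ where $|du|^2=\sum_{i=1}^3|\partial_{x_i}u|^2$, $|d\check u|^2=\sum_{i=1}^3|\partial_{x_i}\check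 u|^2$ and $|\eta|^2=\sum_{i=1}^3|\eta(\partial_{x_i})|^2$. -/

import Mathlib

open MeasureTheory
open scoped ContDiff ENNReal

noncomputable section

/-- Euclidean three-space. -/
abbrev E3 : Type := EuclideanSpace ℝ (Fin 3)

/-- Two-dimensional complex Hermitian space, with its Euclidean norm. -/
abbrev C2 : Type := EuclideanSpace ℂ (Fin 2)

/-- The open unit ball of three-space. -/
def unitBall3 : Set E3 := Metric.ball 0 1

/-- The unit two-sphere in three-space. -/
def sphere2 : Set E3 := Metric.sphere 0 1

/-- The unit three-sphere in `ℂ²`. -/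
def sphere3 : Set C2 := Metric.sphere 0 1

/-- A smooth real test function with compact support inside `Ω`. -/
structure IsTestFunction (Ω : Set E3) (φ : E3 → ℝ) : Prop where
  smooth : ContDiff ℝ ∞ φ
  compact : HasCompactSupport φ
  support : tsupport φ ⊆ Ω

/-- `Df` is the weak (distributional) differential of `f` on the open set `Ω`. -/
structure HasWeakDifferential {F : Type*} [NormedAddCommGroup F] [NormedSpace ℝ F]
    (Ω : Set E3) (f : E3 → F) (Df : E3 → E3 →L[ℝ] F) : Prop where
  locInt : LocallyIntegrableOn f Ω volume
  locInt_diff : LocallyIntegrableOn Df Ω volume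
  integral_eq : ∀ φ : E3 → ℝ, IsTestFunction Ω φ → ∀ v : E3,
    ∫ x, (fderiv ℝ φ x v) • f x = - ∫ x, φ x • Df x v

/-- `f` belongs to the Sobolev space `W^{1,p}(Ω, S)` of maps on the open set `Ω` with values
(almost everywhere) in the subset `S` of `F`, and `Df` is its weak differential. -/
structure IsSobolevMap {F : Type*} [NormedAddCommGroup F] [NormedSpace ℝ F]
    (Ω : Set E3) (p : ℝ≥0∞) (S : Set F) (f : E3 → F) (Df : E3 → E3 →L[ℝ] F) : Prop where
  memLp : MemLp f p (volume.restrict Ω)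
  memLp_diff : MemLp Df p (volume.restrict Ω)
  weakDiff : HasWeakDifferential Ω f Df
  mem_target : ∀ᵐ x ∂(volume.restrict Ω), f x ∈ S

/-- The squared Euclidean (Hilbert-Schmidt) norm `∑ᵢ |∂ᵢ f|²` of a differential. -/
def hsNormSq {F : Type*} [NormedAddCommGroup F] [NormedSpace ℝ F] (L : E3 →L[ℝ] F) : ℝ :=
  ∑ i : Fin 3, ‖L (EuclideanSpace.single i 1)‖ ^ 2

/-- The two-form `β` is the weak (distributional) exterior derivative of the one-form `η` on the
open set `Ω`; for smooth `η` this says that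
`β(a, b) = ∂ₐ (η b) - ∂_b (η a)` for all constant vectors `a`, `b`. -/
structure HasWeakExtDeriv (Ω : Set E3) (η : E3 → E3 →L[ℝ] ℝ) (β : E3 → E3 → E3 → ℝ) : Prop where
  locInt : LocallyIntegrableOn η Ω volume
  locInt_deriv : ∀ a b : E3, LocallyIntegrableOn (fun x => β x a b) Ω volume
  integral_eq : ∀ φ : E3 → ℝ, IsTestFunction Ω φ → ∀ a b : E3,
    ∫ x, (fderiv ℝ φ x a * η x b - fderiv ℝ φ x b * η x a) = - ∫ x, φ x * β x a b

/-- The volume form of the unit two-sphere (outward orientation) at the point `y`: on vectors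
`a`, `b` tangent to the sphere at `y` it is `det (y, a, b) = y · (a × b)`. -/
def sphereVolumeForm (y a b : E3) : ℝ :=
  Matrix.det !![y 0, y 1, y 2; a 0, a 1, a 2; b 0, b 1, b 2]

/-- The pullback of the volume form of the two-sphere by a map `u` with differential `Du`. -/
def pullbackSphereVolumeForm (u : E3 → E3) (Du : E3 → E3 →L[ℝ] E3) (x a b : E3) : ℝ :=
  sphereVolumeForm (u x) (Du x a) (Du x b)

/-- The Hopf map `(w₁, w₂) ↦ (2 w₁ w̄₂, |w₁|² - |w₂|²) ∈ ℂ × ℝ = ℝ³`. -/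
def hopfMap (w : C2) : E3 :=
  !₂[(2 * w 0 * (starRingEnd ℂ) (w 1)).re, (2 * w 0 * (starRingEnd ℂ) (w 1)).im,
    ‖w 0‖ ^ 2 - ‖w 1‖ ^ 2]

end

open Set Filter Topology
open scoped Quaternion

/-! Identify three-space with the imaginary quaternions and the three-sphere with the unit
quaternions, so that the Hopf map becomes q ↦ q k q̄. Write U for the imaginary unit quaternion
field given by u. A lift w satisfies dw = A w with A imaginary, and then dU = [A, U]. This fixes the
part of A orthogonal to U and leaves the part along U free; η is used to prescribe the latter: A =
¼[U, dU] − ½ηU.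

Since |U| = 1, U anticommutes with dU, so A = ½U(dU − η). As dU is imaginary and η real, 4|A|² =
|dU|² + |η|², and |dw| = |A|: this is the energy identity (`sq_norm_connVal`). The curvature dA −
A∧A reduces on two vectors c, b to ¼[∂_cU, ∂_bU] − ½dη(c, b)U, and the commutator equals 2u^*ω(c,
b)U (`imQ_comm`), so A is flat precisely because dη = u^*ω (`curvVal_eq_zero`). For a solution w of
dw = A w, the field w̄Uw has derivative zero, hence is a constant imaginary unit c. With p a unit
quaternion such that cp = pk, the lift is wp.

The difficulty is to integrate a flat connection with mere Lebesgue regularity. Mollify U and η.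
Second derivatives cancel in the curvature (`curvature_connForm`), which is quadratic in first-order
data, so on smaller balls the curvature of the mollified connection tends to zero in L¹. Radial
transport from a base point solves dV = A V up to line integrals of the curvature
(`exists_radial_gauge`). Averaging over the base point bounds that error in L¹ by the L¹ norm of the
curvature (`exists_lintegral_segmentIntegral_le`).

The resulting approximate gauges are unique up to almost constant right factors, by a Poincaré
inequality (`ApproxGauge.exists_close`). Once normalised, they converge almost everywhere to a weak
solution w (`exists_gauge_of_approxGauge`). -/

/-! ### Unit quaternions and the transport equation w' = a w. -/

/-- A quaternion is purely imaginary iff it is skew-adjoint. -/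
lemma star_eq_neg_of_re_eq_zero {a : ℍ} (h : a.re = 0) : star a = -a :=
  Quaternion.star_eq_neg.mpr h

lemma star_mul_self_of_norm_one {w : ℍ} (h : ‖w‖ = 1) : star w * w = 1 := by
  rw [Quaternion.star_mul_self, Quaternion.normSq_eq_norm_mul_self, h]; simp

lemma self_mul_star_of_norm_one {w : ℍ} (h : ‖w‖ = 1) : w * star w = 1 := by
  rw [Quaternion.self_mul_star, Quaternion.normSq_eq_norm_mul_self, h]; simp

/-- Left multiplication by an imaginary quaternion is skew-symmetric, which is why transport
preserves the norm. -/
lemma inner_mul_self_eq_zero {a : ℍ} (h : a.re = 0) (w : ℍ) : inner ℝ w (a * w) = 0 := by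
  rw [Quaternion.inner_def, star_mul, star_eq_neg_of_re_eq_zero h, ← mul_assoc,
    Quaternion.self_mul_star, Quaternion.coe_mul_eq_smul, smul_neg]
  simp [h]

/-- Linear equations with purely imaginary coefficient have unit quaternion solutions. -/
lemma exists_unit_solution {a : ℝ → ℍ} (ha : Continuous a) (him : ∀ t, (a t).re = 0) :
    ∃ w : ℝ → ℍ, w 0 = 1 ∧ ∀ t ∈ Icc (0 : ℝ) 1, ‖w t‖ = 1 ∧ HasDerivAt w (a t * w t) t := by
  -- The time interval is larger than [0, 1], so that two-sided derivatives exist at both endpoints.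
  obtain ⟨M, hM⟩ := isCompact_Icc.exists_bound_of_continuousOn (s := Icc (-2 : ℝ) 2)
    ha.continuousOn
  have hM0 : 0 ≤ M := (norm_nonneg _).trans (hM 0 (by norm_num))
  lift M to NNReal using hM0
  -- `P` is smooth, bounded by 1 and equal to the identity on the unit sphere. Replacing x by `P x`
  -- makes the right-hand side bounded, so a single Picard–Lindelöf ball of radius 2M covers the
  -- whole interval. The modified field is still tangent to spheres, so the solution stays on the
  -- unit sphere and solves the linear equation.
  let P : ℍ → ℍ := fun x => (2 / (1 + ‖x‖ ^ 2)) • x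
  have hPc : ContDiff ℝ 1 P := by
    refine ContDiff.smul (contDiff_const.div (contDiff_const.add (contDiff_norm_sq ℝ)) ?_)
      contDiff_id
    intro x; positivity
  have hPn : ∀ x, ‖P x‖ ≤ 1 := by
    intro x
    simp only [P, norm_smul, Real.norm_eq_abs]
    rw [abs_of_pos (by positivity), div_mul_eq_mul_div, div_le_one (by positivity)]
    nlinarith [sq_nonneg (‖x‖ - 1)]
  obtain ⟨K, hK⟩ : ∃ K : NNReal, LipschitzOnWith K P (Metric.closedBall 1 (2 * M)) := by
    obtain ⟨K, hK⟩ := (isCompact_closedBall (1 : ℍ) (2 * M)).exists_bound_of_continuousOn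
      (hPc.continuous_fderiv one_ne_zero).continuousOn
    refine ⟨K.toNNReal, (convex_closedBall _ _).lipschitzOnWith_of_nnnorm_fderiv_le (𝕜 := ℝ)
      (fun x _ => hPc.differentiable one_ne_zero x) fun x hx => ?_⟩
    exact NNReal.le_toNNReal_of_coe_le (hK x hx)
  have hpl : IsPicardLindelof (fun t x => a t * P x) (tmin := -2) (tmax := 2)
      ⟨0, by norm_num⟩ (1 : ℍ) (2 * M) 0 M (M * K) := by
    refine ⟨fun t ht => ?_, fun x _ => (ha.mul continuous_const).continuousOn, fun t ht x _ => ?_,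
      ?_⟩
    · refine LipschitzOnWith.of_dist_le_mul fun x hx z hz => ?_
      rw [dist_eq_norm, ← mul_sub, norm_mul, ← dist_eq_norm, NNReal.coe_mul, mul_assoc]
      exact mul_le_mul (hM t ht) (hK.dist_le_mul x (by simpa using hx) z (by simpa using hz))
        dist_nonneg M.2
    · rw [norm_mul]
      exact mul_le_of_le_one_right (norm_nonneg _) (hPn x) |>.trans (hM t ht)
    · simp [mul_comm]
  obtain ⟨w, hw0, hw⟩ := hpl.exists_eq_forall_mem_Icc_hasDerivWithinAt₀
  have hd : ∀ t ∈ Ioo (-2 : ℝ) 2, HasDerivAt w (a t * P (w t)) t := fun t ht =>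
    (hw t (Ioo_subset_Icc_self ht)).hasDerivAt (Icc_mem_nhds ht.1 ht.2)
  have hn : ∀ t ∈ Ioo (-2 : ℝ) 2, HasDerivAt (fun s => ‖w s‖ ^ 2) 0 t := by
    intro t ht
    convert (hd t ht).norm_sq using 1
    simp only [P, mul_smul_comm]
    rw [inner_smul_right, inner_mul_self_eq_zero (him t)]; simp
  have hone : ∀ t ∈ Ioo (-2 : ℝ) 2, ‖w t‖ = 1 := by
    intro t ht
    have := isOpen_Ioo.is_const_of_deriv_eq_zero isPreconnected_Ioo
      (fun s hs => (hn s hs).differentiableAt.differentiableWithinAt)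
      (fun s hs => (hn s hs).deriv) ht (show (0 : ℝ) ∈ Ioo (-2 : ℝ) 2 by norm_num)
    have h0 : w 0 = 1 := hw0
    rw [h0, norm_one, one_pow] at this
    exact (pow_eq_one_iff_of_nonneg (norm_nonneg _) two_ne_zero).mp this
  refine ⟨w, hw0, fun t ht => ?_⟩
  have ht' : t ∈ Ioo (-2 : ℝ) 2 := ⟨by linarith [ht.1], by linarith [ht.2]⟩
  refine ⟨hone t ht', ?_⟩
  convert hd t ht' using 2
  simp only [P, hone t ht']
  norm_num

/-! ### Radial parallel transport and curvature. -/

section RadialGauge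

variable {E : Type*} [NormedAddCommGroup E] [NormedSpace ℝ E]

lemma HasDerivAt.quaternion_star {f : ℝ → ℍ} {f' : ℍ} {t : ℝ} (h : HasDerivAt f f' t) :
    HasDerivAt (fun t => star (f t)) (star f') t := by
  let S : ℍ →L[ℝ] ℍ := LinearMap.toContinuousLinearMap
    { toFun := star
      map_add' := star_add
      map_smul' := fun r a => by
        ext <;> simp }
  exact (S.hasFDerivAt.comp_hasDerivAt t h)

/-- The curvature of the connection `d - A`. -/
noncomputable def curvature (A : E → E →L[ℝ] ℍ) (x c b : E) : ℍ :=
  fderiv ℝ A x c b - fderiv ℝ A x b c - (A x c * A x b - A x b * A x c)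

/-- The coefficient of the radial transport equation from `y` to `x`. -/
noncomputable def radialCoeff (A : E → E →L[ℝ] ℍ) (y x : E) (t : ℝ) : ℍ := A (y + t • (x - y)) (x - y)

lemma contDiff_radialCoeff {A : E → E →L[ℝ] ℍ} (hA : ContDiff ℝ 1 A) (y : E) :
    ContDiff ℝ 1 (fun p : E × ℝ => radialCoeff A y p.1 p.2) := by
  unfold radialCoeff
  exact (hA.comp (by fun_prop)).clm_apply (by fun_prop)

lemma hasFDerivAt_radialCoeff {A : E → E →L[ℝ] ℍ} (hA : ContDiff ℝ 1 A) (y x : E) (t : ℝ) :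
    HasFDerivAt (fun x => radialCoeff A y x t)
      (t • (fderiv ℝ A (y + t • (x - y))).flip (x - y) + A (y + t • (x - y))) x := by
  have h1 : HasFDerivAt (fun x : E => y + t • (x - y)) (t • ContinuousLinearMap.id ℝ E) x :=
    (((hasFDerivAt_id x).sub_const y).const_smul t).const_add y
  have h2 := ((hA.differentiable one_ne_zero (y + t • (x - y))).hasFDerivAt.comp x h1).clm_apply
    ((hasFDerivAt_id x).sub_const y)
  exact h2.congr_fderiv (ContinuousLinearMap.ext fun b => by simp [add_comm])

lemma hasDerivAt_comp_segment {F : Type*} [NormedAddCommGroup F] [NormedSpace ℝ F]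
    {f : E → F} {f' : E →L[ℝ] F} (y c : E) (t : ℝ) (hf : HasFDerivAt f f' (y + t • c)) :
    HasDerivAt (fun t : ℝ => f (y + t • c)) (f' c) t := by
  have h1 : HasDerivAt (fun t : ℝ => y + t • c) ((1 : ℝ) • c) t :=
    ((hasDerivAt_id t).smul_const c).const_add y
  exact (hf.comp_hasDerivAt t h1).congr_deriv (by simp)

/-- Comparison of the transports along two segments. -/
lemma star_mul_sub_one_eq_integral {a₁ a₂ w₁ w₂ : ℝ → ℍ} (h1 : Continuous a₁) (h2 : Continuous a₂)
    (him : ∀ t, (a₁ t).re = 0) (h01 : w₁ 0 = 1) (h02 : w₂ 0 = 1)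
    (hw₁ : ∀ t ∈ Icc (0 : ℝ) 1, HasDerivAt w₁ (a₁ t * w₁ t) t)
    (hw₂ : ∀ t ∈ Icc (0 : ℝ) 1, HasDerivAt w₂ (a₂ t * w₂ t) t) {s : ℝ} (hs : s ∈ Icc (0 : ℝ) 1) :
    star (w₁ s) * w₂ s - 1 = ∫ t in (0 : ℝ)..s, star (w₁ t) * (a₂ t - a₁ t) * w₂ t := by
  have hsub : uIcc 0 s ⊆ Icc (0 : ℝ) 1 := by
    rw [uIcc_of_le hs.1]; exact Icc_subset_Icc_right hs.2
  have c1 : ContinuousOn w₁ (uIcc 0 s) := fun t ht =>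
    (hw₁ t (hsub ht)).continuousAt.continuousWithinAt
  have c2 : ContinuousOn w₂ (uIcc 0 s) := fun t ht =>
    (hw₂ t (hsub ht)).continuousAt.continuousWithinAt
  -- Duhamel's formula: since a₁ is imaginary, w̄₁' = −w̄₁a₁, and only the difference of
  -- coefficients survives in (w̄₁w₂)'.
  rw [intervalIntegral.integral_eq_sub_of_hasDerivAt (f := fun t => star (w₁ t) * w₂ t)]
  · simp [h01, h02]
  · intro t ht
    refine ((hw₁ t (hsub ht)).quaternion_star.mul (hw₂ t (hsub ht))).congr_deriv ?_
    rw [star_mul, star_eq_neg_of_re_eq_zero (him t)]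
    noncomm_ring
  · exact ((c1.star.mul (h2.sub h1).continuousOn).mul c2).intervalIntegrable

/-- Radial parallel transport from `y` solves `dV = A V` up to the curvature of `A`. -/
theorem exists_radial_gauge [FiniteDimensional ℝ E] {A : E → E →L[ℝ] ℍ} (hA : ContDiff ℝ 1 A)
    (him : ∀ x b, (A x b).re = 0) {K : E → ℝ} (hK : Continuous K)
    (hAK : ∀ x c b, ‖curvature A x c b‖ ≤ K x * ‖c‖ * ‖b‖) (y : E) :
    ∃ (V : E → ℍ) (DV : E → E →L[ℝ] ℍ), (∀ x, ‖V x‖ = 1) ∧ (∀ x, HasFDerivAt V (DV x) x) ∧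
      ∀ x b, ‖DV x b - A x b * V x‖ ≤ (∫ t in (0 : ℝ)..1, K (y + t • (x - y))) * ‖x - y‖ * ‖b‖ := by
  have hcd := contDiff_radialCoeff hA y
  have hac : ∀ x, Continuous (radialCoeff A y x) := fun x =>
    hcd.continuous.comp (by fun_prop : Continuous fun t : ℝ => (x, t))
  have hai : ∀ x t, (radialCoeff A y x t).re = 0 := fun x t => him _ _
  choose W hW0 hW using fun x => exists_unit_solution (hac x) (hai x)
  have hWc : ∀ x, ContinuousOn (W x) (Icc 0 1) := fun x t ht =>
    ((hW x t ht).2).continuousAt.continuousWithinAt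
  have h01 : uIcc (0 : ℝ) 1 = Icc 0 1 := uIcc_of_le zero_le_one
  have hcmp := fun x x' s (hs : s ∈ Icc (0 : ℝ) 1) => star_mul_sub_one_eq_integral (hac x) (hac x')
    (hai x) (hW0 x) (hW0 x') (fun t ht => (hW x t ht).2) (fun t ht => (hW x' t ht).2) hs
  let G : E → ℝ → E →L[ℝ] ℍ := fun x t =>
    t • (fderiv ℝ A (y + t • (x - y))).flip (x - y) + A (y + t • (x - y))
  have hGcc : Continuous fun p : E × ℝ => G p.1 p.2 := by
    have h1 : Continuous fun p : E × ℝ => y + p.2 • (p.1 - y) := by fun_prop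
    have h2 := (hA.continuous_fderiv one_ne_zero).comp h1
    exact (continuous_snd.smul (((ContinuousLinearMap.flipₗᵢ ℝ E E ℍ).continuous.comp h2).clm_apply
      (continuous_fst.sub continuous_const))).add (hA.continuous.comp h1)
  have hGc : ∀ x, Continuous (G x) := fun x =>
    hGcc.comp (by fun_prop : Continuous fun t : ℝ => (x, t))
  have hG : ∀ x t, HasFDerivAt (fun x => radialCoeff A y x t) (G x t) x := fun x t =>
    hasFDerivAt_radialCoeff hA y x t
  -- Differentiability of the endpoint in x comes from Duhamel's formula rather than from a general
  -- theorem on dependence on parameters: W x' 1 equals W x 1 times 1 plus an integral containing W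
  -- x'. Replacing W x' by W x in it gives the explicitly differentiable part `F`.
  have hderiv : ∀ x, ∃ D : E →L[ℝ] ℍ, HasFDerivAt (fun x => W x 1) D x ∧
      ∀ b, D b = W x 1 * ∫ t in (0 : ℝ)..1, star (W x t) * G x t b * W x t := by
    intro x
    let F : E → ℝ → ℍ := fun x' t =>
      star (W x t) * (radialCoeff A y x' t - radialCoeff A y x t) * W x t
    obtain ⟨C, hC⟩ := ((isCompact_closedBall x 1).prod (isCompact_Icc (a := (0 : ℝ)) (b := 1))
      ).exists_bound_of_continuousOn (f := fun p : E × ℝ => G p.1 p.2) hGcc.continuousOn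
    have hGC : ∀ t ∈ Icc (0 : ℝ) 1, ∀ x' ∈ Metric.closedBall x 1, ‖G x' t‖ ≤ C :=
      fun t ht x' hx' => hC (x', t) ⟨hx', ht⟩
    have hC0 : 0 ≤ C := (norm_nonneg (G x 0)).trans
      (hGC 0 (by simp) x (Metric.mem_closedBall_self zero_le_one))
    have hLip : ∀ t ∈ Icc (0 : ℝ) 1, ∀ x' ∈ Metric.closedBall x 1,
        ‖radialCoeff A y x' t - radialCoeff A y x t‖ ≤ C * ‖x' - x‖ := fun t ht x' hx' =>
      (convex_closedBall x 1).norm_image_sub_le_of_norm_hasFDerivWithin_le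
        (fun z _ => (hG z t).hasFDerivWithinAt) (hGC t ht) (Metric.mem_closedBall_self zero_le_one) hx'
    have hWLip : ∀ t ∈ Icc (0 : ℝ) 1, ∀ x' ∈ Metric.closedBall x 1,
        ‖W x' t - W x t‖ ≤ C * ‖x' - x‖ := by
      intro t ht x' hx'
      have h1 : W x' t - W x t = W x t * (star (W x t) * W x' t - 1) := by
        rw [mul_sub, ← mul_assoc, self_mul_star_of_norm_one (hW x t ht).1, one_mul, mul_one]
      rw [h1, norm_mul, (hW x t ht).1, one_mul, hcmp x x' t ht]
      refine (intervalIntegral.norm_integral_le_of_norm_le_const (C := C * ‖x' - x‖)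
        fun s hs => ?_).trans ?_
      · rw [uIoc_of_le ht.1] at hs
        have hs' : s ∈ Icc (0 : ℝ) 1 := ⟨hs.1.le, hs.2.trans ht.2⟩
        rw [norm_mul, norm_mul, Quaternion.norm_star, (hW x s hs').1, (hW x' s hs').1, one_mul,
          mul_one]
        exact hLip s hs' x' hx'
      · rw [sub_zero, abs_of_nonneg ht.1]
        exact mul_le_of_le_one_right (by positivity) ht.2
    have hFc : ∀ x', ContinuousOn (F x') (Icc 0 1) := fun x' =>
      ((hWc x).star.mul ((hac x').sub (hac x)).continuousOn).mul (hWc x)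
    have hIoc : uIoc (0 : ℝ) 1 ⊆ Icc 0 1 := by
      rw [uIoc_of_le zero_le_one]; exact Ioc_subset_Icc_self
    have hLc : ContinuousOn (fun t =>
        (ContinuousLinearMap.mulLeftRight ℝ ℍ (star (W x t)) (W x t)) ∘L G x t) (Icc 0 1) := by
      refine ContinuousOn.clm_comp ?_ (hGc x).continuousOn
      exact ((ContinuousLinearMap.mulLeftRight ℝ ℍ).continuous.comp_continuousOn
        (hWc x).star).clm_apply (hWc x)
    have hF : HasFDerivAt (fun x' => ∫ t in (0 : ℝ)..1, F x' t)
        (∫ t in (0 : ℝ)..1,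
          (ContinuousLinearMap.mulLeftRight ℝ ℍ (star (W x t)) (W x t)) ∘L G x t) x := by
      refine intervalIntegral.hasFDerivAt_integral_of_dominated_of_fderiv_le
        (F' := fun x' t => (ContinuousLinearMap.mulLeftRight ℝ ℍ (star (W x t)) (W x t)) ∘L G x' t)
        (bound := fun _ => C) (Metric.closedBall_mem_nhds x one_pos)
        (Eventually.of_forall fun x' => ?_) ?_ ?_ (ae_of_all _ fun t ht x' hx' => ?_) (by simp)
        (ae_of_all _ fun t ht x' hx' => ?_)
      · exact ((hFc x').mono hIoc).aestronglyMeasurable measurableSet_uIoc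
      · exact (h01 ▸ hFc x).intervalIntegrable
      · exact (hLc.mono hIoc).aestronglyMeasurable measurableSet_uIoc
      · refine ContinuousLinearMap.opNorm_le_bound _ hC0 fun b => ?_
        simp only [ContinuousLinearMap.comp_apply, ContinuousLinearMap.mulLeftRight_apply]
        rw [norm_mul, norm_mul, Quaternion.norm_star, (hW x t (hIoc ht)).1, one_mul, mul_one]
        exact (G x' t).le_of_opNorm_le (hGC t (hIoc ht) x' hx') b
      · exact ((ContinuousLinearMap.mulLeftRight ℝ ℍ (star (W x t)) (W x t)).hasFDerivAt.comp x'
          ((hG x' t).sub_const _))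
    -- The remainder is a product of two Lipschitz increments, hence of order |x' − x|².
    have hrest : HasFDerivAt (fun x' => ∫ t in (0 : ℝ)..1,
        star (W x t) * (radialCoeff A y x' t - radialCoeff A y x t) * (W x' t - W x t))
        (0 : E →L[ℝ] ℍ) x := by
      refine Asymptotics.IsBigO.hasFDerivAt (n := 2) ?_ one_lt_two
      refine Asymptotics.IsBigO.of_bound (C * C) ?_
      filter_upwards [Metric.closedBall_mem_nhds x one_pos] with x' hx'
      refine (intervalIntegral.norm_integral_le_of_norm_le_const
        (C := C * C * ‖x' - x‖ ^ 2) fun s hs => ?_).trans (by simp)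
      rw [norm_mul, norm_mul, Quaternion.norm_star, (hW x s (hIoc hs)).1, one_mul]
      refine (mul_le_mul (hLip s (hIoc hs) x' hx') (hWLip s (hIoc hs) x' hx') (norm_nonneg _)
        (by positivity)).trans (le_of_eq (by ring))
    refine ⟨(ContinuousLinearMap.mul ℝ ℍ (W x 1)) ∘L (∫ t in (0 : ℝ)..1,
        (ContinuousLinearMap.mulLeftRight ℝ ℍ (star (W x t)) (W x t)) ∘L G x t), ?_, fun b => ?_⟩
    · have h1 : (fun x' => W x' 1) = fun x' => W x 1 * (1 + ((∫ t in (0 : ℝ)..1, F x' t) +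
          ∫ t in (0 : ℝ)..1, star (W x t) * (radialCoeff A y x' t - radialCoeff A y x t) *
            (W x' t - W x t))) := by
        ext1 x'
        rw [← intervalIntegral.integral_add (h01 ▸ hFc x').intervalIntegrable]
        · have h2 := hcmp x x' 1 (by simp)
          have h3 : ∀ t, F x' t + star (W x t) * (radialCoeff A y x' t - radialCoeff A y x t) *
              (W x' t - W x t) =
              star (W x t) * (radialCoeff A y x' t - radialCoeff A y x t) * W x' t := by
            intro t; simp only [F]; noncomm_ring
          simp only [h3]
          rw [← h2, add_sub_cancel, ← mul_assoc, self_mul_star_of_norm_one (hW x 1 (by simp)).1,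
            one_mul]
        · exact ContinuousOn.intervalIntegrable (h01 ▸
            ((hWc x).star.mul ((hac x').sub (hac x)).continuousOn).mul ((hWc x').sub (hWc x)))
      rw [h1]
      exact ((ContinuousLinearMap.mul ℝ ℍ (W x 1)).hasFDerivAt.comp x
        ((hF.add hrest).const_add 1)).congr_fderiv (by rw [add_zero])
    · rw [ContinuousLinearMap.comp_apply, ContinuousLinearMap.mul_apply',
        ContinuousLinearMap.intervalIntegral_apply (h01 ▸ hLc).intervalIntegrable]
      simp
  choose D hD hDb using hderiv
  refine ⟨fun x => W x 1, D, fun x => (hW x 1 (by simp)).1, hD, fun x b => ?_⟩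
  -- Integration by parts along the segment: differentiating t·W̄A(b)W produces W̄G(b)W, the
  -- integrand of the derivative of the endpoint, plus t times the conjugated curvature. The
  -- boundary term at 1 is the desired A(b) in the gauge; the one at 0 vanishes because of the
  -- factor t.
  have key : ∫ t in (0 : ℝ)..1, star (W x t) * G x t b * W x t =
      star (W x 1) * A x b * W x 1 - ∫ t in (0 : ℝ)..1,
        t • (star (W x t) * curvature A (y + t • (x - y)) (x - y) b * W x t) := by
    have h1 : ∀ t ∈ uIcc (0 : ℝ) 1, HasDerivAt
        (fun t : ℝ => t • (star (W x t) * A (y + t • (x - y)) b * W x t))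
        (star (W x t) * G x t b * W x t +
          t • (star (W x t) * curvature A (y + t • (x - y)) (x - y) b * W x t)) t := by
      intro t ht
      rw [h01] at ht
      have hw := (hW x t ht).2
      have hAd := hasDerivAt_comp_segment y (x - y) t
        (((hA.differentiable one_ne_zero) (y + t • (x - y))).hasFDerivAt.clm_apply
          (hasFDerivAt_const b _))
      refine ((hasDerivAt_id t).smul ((hw.quaternion_star.mul hAd).mul hw)).congr_deriv ?_
      simp only [G, radialCoeff, curvature, id, star_mul, star_eq_neg_of_re_eq_zero (him _ _)]
      simp [mul_add, add_mul, mul_sub, sub_mul, mul_assoc, smul_sub, smul_add]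
      abel
    have hcG : ContinuousOn (fun t => star (W x t) * G x t b * W x t) (uIcc 0 1) := by
      rw [h01]
      exact ((hWc x).star.mul ((hGc x).clm_apply continuous_const).continuousOn).mul (hWc x)
    have hcC : ContinuousOn (fun t =>
        t • (star (W x t) * curvature A (y + t • (x - y)) (x - y) b * W x t)) (uIcc 0 1) := by
      rw [h01]
      have h1 : Continuous fun t : ℝ => y + t • (x - y) := by fun_prop
      have h2 := (hA.continuous_fderiv one_ne_zero).comp h1
      have h3 := hA.continuous.comp h1
      have h4 : Continuous fun t : ℝ => curvature A (y + t • (x - y)) (x - y) b := by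
        unfold curvature
        refine (((h2.clm_apply continuous_const).clm_apply continuous_const).sub
          ((h2.clm_apply continuous_const).clm_apply continuous_const)).sub ?_
        exact ((h3.clm_apply continuous_const).mul (h3.clm_apply continuous_const)).sub
          ((h3.clm_apply continuous_const).mul (h3.clm_apply continuous_const))
      exact continuousOn_id.smul (((hWc x).star.mul h4.continuousOn).mul (hWc x))
    have h2 := intervalIntegral.integral_eq_sub_of_hasDerivAt h1
      (hcG.add hcC).intervalIntegrable
    rw [intervalIntegral.integral_add hcG.intervalIntegrable hcC.intervalIntegrable] at h2
    rw [eq_sub_iff_add_eq, h2]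
    simp
  rw [hDb, key, mul_sub, ← mul_assoc, ← mul_assoc,
    self_mul_star_of_norm_one (hW x 1 (by simp)).1, one_mul, sub_sub_cancel_left, norm_neg, norm_mul,
    (hW x 1 (by simp)).1, one_mul]
  -- The weight t of the curvature term is simply bounded by 1.
  rw [mul_assoc, ← intervalIntegral.integral_mul_const]
  refine intervalIntegral.norm_integral_le_of_norm_le zero_le_one (ae_of_all _ fun t ht => ?_) ?_
  · have ht' : t ∈ Icc (0 : ℝ) 1 := Ioc_subset_Icc_self ht
    rw [norm_smul, norm_mul, norm_mul, Quaternion.norm_star, (hW x t ht').1, one_mul, mul_one,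
      Real.norm_eq_abs, abs_of_nonneg ht'.1, ← mul_assoc]
    exact mul_le_of_le_one_left (norm_nonneg _) ht'.2 |>.trans (hAK _ _ _)
  · exact ((hK.comp (by fun_prop)).mul continuous_const).intervalIntegrable _ _

end RadialGauge

/-! ### Averages over segments and a Poincaré inequality in L¹. -/

/-- A homothety of ratio at least one half and mapping a ball into itself increases integrals over
this ball at most by the factor `8`. -/
lemma lintegral_ball_comp_homothety_le {f : E3 → ℝ≥0∞} (hf : Measurable f) {r t : ℝ}
    (ht : 1 / 2 ≤ t) (c : E3)
    (hc : ∀ x ∈ Metric.ball (0 : E3) r, c + t • x ∈ Metric.ball (0 : E3) r) :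
    ∫⁻ x in Metric.ball (0 : E3) r, f (c + t • x) ≤ 8 * ∫⁻ x in Metric.ball (0 : E3) r, f x := by
  have ht0 : t ≠ 0 := by linarith
  have hm : Measurable ((Metric.ball (0 : E3) r).indicator f) := hf.indicator measurableSet_ball
  calc ∫⁻ x in Metric.ball (0 : E3) r, f (c + t • x)
      = ∫⁻ x in Metric.ball (0 : E3) r, (Metric.ball (0 : E3) r).indicator f (c + t • x) :=
        setLIntegral_congr_fun measurableSet_ball fun x hx => by
          rw [indicator_of_mem (hc x hx)]
    _ ≤ ∫⁻ x, (Metric.ball (0 : E3) r).indicator f (c + t • x) := setLIntegral_le_lintegral _ _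
    _ = ∫⁻ z, (Metric.ball (0 : E3) r).indicator f (c + z) ∂(Measure.map (t • ·) volume) :=
        (lintegral_map (hm.comp (measurable_const_add c)) (measurable_const_smul t)).symm
    -- The Jacobian of the homothety; as t ≥ 1/2 its inverse is at most 8.
    _ = ENNReal.ofReal |(t ^ 3)⁻¹| * ∫⁻ x, (Metric.ball (0 : E3) r).indicator f x := by
        rw [Measure.map_addHaar_smul _ ht0, lintegral_smul_measure,
          lintegral_add_left_eq_self (μ := volume) ((Metric.ball (0 : E3) r).indicator f) c]
        simp
    _ ≤ 8 * ∫⁻ x in Metric.ball (0 : E3) r, f x := by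
        rw [lintegral_indicator measurableSet_ball]
        gcongr
        rw [abs_of_pos (by positivity), ← ENNReal.ofReal_ofNat]
        apply ENNReal.ofReal_le_ofReal
        rw [inv_le_comm₀ (by positivity) (by norm_num)]
        calc (8 : ℝ)⁻¹ = (1 / 2) ^ 3 := by norm_num
          _ ≤ t ^ 3 := by gcongr

/-- The integral of a nonnegative function over all segments joining two points of a ball. -/
lemma lintegral_segments_le {f : E3 → ℝ≥0∞} (hf : Measurable f) (r : ℝ) :
    ∫⁻ y in Metric.ball (0 : E3) r, ∫⁻ x in Metric.ball (0 : E3) r,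
      ∫⁻ t in Ioc (0 : ℝ) 1, f (y + t • (x - y)) ≤
    8 * volume (Metric.ball (0 : E3) r) * ∫⁻ x in Metric.ball (0 : E3) r, f x := by
  set B := Metric.ball (0 : E3) r
  have hm3 : Measurable fun p : (E3 × E3) × ℝ => f (p.1.1 + p.2 • (p.1.2 - p.1.1)) :=
    hf.comp (by fun_prop)
  have key : ∀ t ∈ Ioc (0 : ℝ) 1, ∫⁻ y in B, ∫⁻ x in B, f (y + t • (x - y)) ≤
      8 * volume B * ∫⁻ x in B, f x := by
    intro t ht
    have hconv : ∀ x ∈ B, ∀ y ∈ B, y + t • (x - y) ∈ B := fun x hx y hy =>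
      (convex_ball (0 : E3) r).add_smul_sub_mem hy hx ⟨ht.1.le, ht.2⟩
    have hm2 : Measurable fun p : E3 × E3 => f (p.1 + t • (p.2 - p.1)) :=
      hf.comp (by fun_prop)
    have hconst : ∫⁻ _ in B, 8 * ∫⁻ x in B, f x = 8 * volume B * ∫⁻ x in B, f x := by
      rw [setLIntegral_const]; ring
    -- In (1 − t)y + tx at least one coefficient is ≥ 1/2. Integrating first in that variable keeps
    -- the Jacobian under control and avoids any singular kernel.
    rcases le_total (1 / 2) t with h | h
    · refine (setLIntegral_mono' measurableSet_ball fun y hy => ?_).trans hconst.le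
      have : ∀ x, y + t • (x - y) = (1 - t) • y + t • x := fun x => by module
      simp only [this]
      exact lintegral_ball_comp_homothety_le hf h _ fun x hx => this x ▸ hconv x hx y hy
    · rw [lintegral_lintegral_swap hm2.aemeasurable]
      refine (setLIntegral_mono' measurableSet_ball fun x hx => ?_).trans hconst.le
      have : ∀ y, y + t • (x - y) = t • x + (1 - t) • y := fun x => by module
      simp only [this]
      exact lintegral_ball_comp_homothety_le hf (by linarith) _
        fun y hy => this y ▸ hconv x hx y hy
  calc ∫⁻ y in B, ∫⁻ x in B, ∫⁻ t in Ioc (0 : ℝ) 1, f (y + t • (x - y))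
      = ∫⁻ y in B, ∫⁻ t in Ioc (0 : ℝ) 1, ∫⁻ x in B, f (y + t • (x - y)) := by
        refine lintegral_congr fun y => lintegral_lintegral_swap ?_
        exact (hm3.comp (by fun_prop : Measurable fun p : E3 × ℝ => ((y, p.1), p.2))).aemeasurable
    _ = ∫⁻ t in Ioc (0 : ℝ) 1, ∫⁻ y in B, ∫⁻ x in B, f (y + t • (x - y)) := by
        refine lintegral_lintegral_swap (Measurable.aemeasurable ?_)
        exact Measurable.lintegral_prod_right (f := fun (q : E3 × ℝ) (x : E3) => f (q.1 + q.2 • (x - q.1)))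
          (hm3.comp (by fun_prop :
            Measurable fun p : (E3 × ℝ) × E3 => ((p.1.1, p.2), p.1.2)))
    _ ≤ ∫⁻ _ in Ioc (0 : ℝ) 1, 8 * volume B * ∫⁻ x in B, f x :=
        setLIntegral_mono' measurableSet_Ioc key
    _ = _ := by simp

/-- The integral of `K` over the segment from `y` to `x` with respect to arc length. -/
noncomputable def segmentIntegral (K : E3 → ℝ) (y x : E3) : ℝ :=
  (∫ t in (0 : ℝ)..1, K (y + t • (x - y))) * ‖x - y‖

lemma continuous_segmentIntegral {K : E3 → ℝ} (hK : Continuous K) :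
    Continuous fun p : E3 × E3 => segmentIntegral K p.1 p.2 := by
  unfold segmentIntegral
  refine Continuous.mul ?_ (by fun_prop)
  apply intervalIntegral.continuous_parametric_intervalIntegral_of_continuous'
  exact hK.comp (by fun_prop)

lemma segmentIntegral_nonneg {K : E3 → ℝ} (h0 : ∀ x, 0 ≤ K x) (y x : E3) :
    0 ≤ segmentIntegral K y x :=
  mul_nonneg (intervalIntegral.integral_nonneg zero_le_one fun _ _ => h0 _) (norm_nonneg _)

/-- Segments in a ball of radius at most 1 have length at most 2, whence 16 = 2 · 8. -/
lemma lintegral_segmentIntegral_le {K : E3 → ℝ} (hK : Continuous K) (h0 : ∀ x, 0 ≤ K x) {r : ℝ}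
    (hr : r ≤ 1) :
    ∫⁻ y in Metric.ball (0 : E3) r, ∫⁻ x in Metric.ball (0 : E3) r,
      ENNReal.ofReal (segmentIntegral K y x) ≤
    16 * volume (Metric.ball (0 : E3) r) *
      ∫⁻ x in Metric.ball (0 : E3) r, ENNReal.ofReal (K x) := by
  have hm : Measurable fun x => ENNReal.ofReal (K x) := hK.measurable.ennreal_ofReal
  calc _ ≤ ∫⁻ y in Metric.ball (0 : E3) r, ∫⁻ x in Metric.ball (0 : E3) r,
        2 * ∫⁻ t in Ioc (0 : ℝ) 1, ENNReal.ofReal (K (y + t • (x - y))) := by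
        refine setLIntegral_mono' measurableSet_ball fun y hy =>
          setLIntegral_mono' measurableSet_ball fun x hx => ?_
        have hc : Continuous fun t : ℝ => K (y + t • (x - y)) := hK.comp (by fun_prop)
        rw [segmentIntegral, ENNReal.ofReal_mul' (norm_nonneg _), mul_comm,
          intervalIntegral.integral_of_le zero_le_one, ofReal_integral_eq_lintegral_ofReal
            (hc.integrableOn_Icc.mono_set Ioc_subset_Icc_self) (ae_of_all _ fun _ => h0 _)]
        gcongr
        refine (ENNReal.ofReal_le_ofReal (q := 2) ((norm_sub_le _ _).trans ?_)).trans (by simp)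
        have := mem_ball_zero_iff.mp hx
        have := mem_ball_zero_iff.mp hy
        linarith
    _ = 2 * ∫⁻ y in Metric.ball (0 : E3) r, ∫⁻ x in Metric.ball (0 : E3) r,
        ∫⁻ t in Ioc (0 : ℝ) 1, ENNReal.ofReal (K (y + t • (x - y))) := by
        simp_rw [lintegral_const_mul' 2 _ ENNReal.ofNat_ne_top]
    _ ≤ 2 * (8 * volume (Metric.ball (0 : E3) r) *
          ∫⁻ x in Metric.ball (0 : E3) r, ENNReal.ofReal (K x)) := by
        gcongr; exact lintegral_segments_le hm r
    _ = _ := by ring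

/-- Some point of the ball has a small average segment integral. -/
lemma exists_lintegral_segmentIntegral_le {K : E3 → ℝ} (hK : Continuous K) (h0 : ∀ x, 0 ≤ K x)
    {r : ℝ} (hr0 : 0 < r) (hr : r ≤ 1) :
    ∃ y ∈ Metric.ball (0 : E3) r, ∫⁻ x in Metric.ball (0 : E3) r,
      ENNReal.ofReal (segmentIntegral K y x) ≤
      16 * ∫⁻ x in Metric.ball (0 : E3) r, ENNReal.ofReal (K x) := by
  have hv0 : volume (Metric.ball (0 : E3) r) ≠ 0 := (Metric.measure_ball_pos _ _ hr0).ne'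
  have hv : volume (Metric.ball (0 : E3) r) ≠ ⊤ := measure_ball_lt_top.ne
  have hm : Measurable fun y => ∫⁻ x in Metric.ball (0 : E3) r,
      ENNReal.ofReal (segmentIntegral K y x) :=
    Measurable.lintegral_prod_right (f := fun y x => ENNReal.ofReal (segmentIntegral K y x))
      (continuous_segmentIntegral hK).measurable.ennreal_ofReal
  -- Some base point does no worse than the average over all base points.
  obtain ⟨y, hy, h⟩ := exists_le_setLAverage hv0 hv hm.aemeasurable
  refine ⟨y, hy, h.trans ?_⟩
  rw [setLAverage_eq]
  refine ENNReal.div_le_of_le_mul ((lintegral_segmentIntegral_le hK h0 hr).trans (le_of_eq ?_))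
  ring

/-- A mean value inequality with variable bound. The differential need not be continuous; only its
majorant is integrated. -/
lemma norm_sub_le_segmentIntegral {F : Type*} [NormedAddCommGroup F] [NormedSpace ℝ F]
    {g : E3 → F} {Dg : E3 → E3 →L[ℝ] F} (hg : ∀ x, HasFDerivAt g (Dg x) x) {K : E3 → ℝ}
    (hK : Continuous K) (hDK : ∀ x, ‖Dg x‖ ≤ K x) (x y : E3) :
    ‖g x - g y‖ ≤ segmentIntegral K y x := by
  have hc : Continuous fun t : ℝ => K (y + t • (x - y)) := hK.comp (by fun_prop)
  have h := image_norm_le_of_norm_deriv_right_le_deriv_boundary (a := 0) (b := 1)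
    (f := fun t : ℝ => g (y + t • (x - y)) - g y) (f' := fun t => Dg (y + t • (x - y)) (x - y))
    (B := fun t => (∫ s in (0 : ℝ)..t, K (y + s • (x - y))) * ‖x - y‖)
    (B' := fun t => K (y + t • (x - y)) * ‖x - y‖) ?_ ?_ (by simp) ?_ ?_
    (right_mem_Icc.mpr zero_le_one)
  · simpa [segmentIntegral] using h
  · exact fun t _ => ((hasDerivAt_comp_segment y (x - y) t (hg _)).sub_const
      _).continuousAt.continuousWithinAt
  · exact fun t _ => ((hasDerivAt_comp_segment y (x - y) t (hg _)).sub_const _).hasDerivWithinAt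
  · exact fun t => (hc.integral_hasStrictDerivAt 0 t).hasDerivAt.mul_const _
  · exact fun t _ => (Dg _).le_of_opNorm_le (hDK _) _

/-! ### Approximate gauges and their rigidity. -/

/-- The normed space of continuous linear maps, with the structure induced by the norms. -/
abbrev NormedCLM (E F : Type*) [NormedAddCommGroup E] [NormedSpace ℝ E] [NormedAddCommGroup F]
    [NormedSpace ℝ F] : Type _ := E →L[ℝ] F

/-- Quaternion valued linear forms on three-space. -/
abbrev QForm : Type := NormedCLM E3 ℍ

/-- A unit quaternion valued solution of `dV = A V`, `dU = [A, U]`, up to an error which is at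
most `δ` in `L¹` of the ball of radius `r`. -/
structure ApproxGauge (A : E3 → QForm) (U : E3 → ℍ) (r : ℝ) (δ : ℝ≥0∞) where
  conn : E3 → QForm
  sect : E3 → ℍ
  sectDeriv : E3 → QForm
  gauge : E3 → ℍ
  gaugeDeriv : E3 → QForm
  err : E3 → ℝ
  continuous_conn : Continuous conn
  conn_re : ∀ x b, (conn x b).re = 0
  norm_sect_le : ∀ x, ‖sect x‖ ≤ 1
  hasFDerivAt_sect : ∀ x, HasFDerivAt sect (sectDeriv x) x
  norm_gauge : ∀ x, ‖gauge x‖ = 1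
  hasFDerivAt_gauge : ∀ x, HasFDerivAt gauge (gaugeDeriv x) x
  continuous_err : Continuous err
  err_nonneg : ∀ x, 0 ≤ err x
  norm_gaugeDeriv_sub_le : ∀ x b, ‖gaugeDeriv x b - conn x b * gauge x‖ ≤ err x * ‖b‖
  norm_sectDeriv_sub_le : ∀ x b,
    ‖sectDeriv x b - (conn x b * sect x - sect x * conn x b)‖ ≤ err x * ‖b‖
  lintegral_err_le : ∫⁻ x in Metric.ball 0 r, ENNReal.ofReal (err x) ≤ δ
  lintegral_conn_le : ∫⁻ x in Metric.ball 0 r, ‖conn x - A x‖ₑ ≤ δ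
  lintegral_sect_le : ∫⁻ x in Metric.ball 0 r, ‖sect x - U x‖ₑ ≤ δ

lemma enorm_sub_le_of_common {F : Type*} [SeminormedAddCommGroup F] (a b c : F) :
    ‖b - a‖ₑ ≤ ‖a - c‖ₑ + ‖b - c‖ₑ := by
  rw [← edist_eq_enorm_sub, ← edist_eq_enorm_sub, ← edist_eq_enorm_sub, add_comm, edist_comm a c]
  exact edist_triangle _ _ _

/-- Conjugation as a continuous linear map. -/
noncomputable def starQ : ℍ →L[ℝ] ℍ :=
  LinearMap.toContinuousLinearMap
    { toFun := star
      map_add' := star_add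
      map_smul' := fun r a => by ext <;> simp }

@[simp] lemma starQ_apply (a : ℍ) : starQ a = star a := rfl

lemma HasFDerivAt.mulQ {f g : E3 → ℍ} {f' g' : QForm} {x : E3} (hf : HasFDerivAt f f' x)
    (hg : HasFDerivAt g g' x) :
    ∃ D : QForm, HasFDerivAt (fun x => f x * g x) D x ∧
      ∀ b, D b = f' b * g x + f x * g' b := by
  refine ⟨_, hf.mul' hg, fun b => ?_⟩
  simp [add_comm]

namespace ApproxGauge

variable {A : E3 → QForm} {U : E3 → ℍ} {r s : ℝ} {δ ε : ℝ≥0∞}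

lemma continuous_gauge (G : ApproxGauge A U r δ) : Continuous G.gauge :=
  continuous_iff_continuousAt.mpr fun x => (G.hasFDerivAt_gauge x).continuousAt

lemma continuous_sect (G : ApproxGauge A U r δ) : Continuous G.sect :=
  continuous_iff_continuousAt.mpr fun x => (G.hasFDerivAt_sect x).continuousAt

/-- Right multiplication by a constant. -/
noncomputable def mulRight (G : ApproxGauge A U r δ) (q : ℍ) (hq : ‖q‖ = 1) :
    ApproxGauge A U r δ :=
  { G with
    gauge := fun x => G.gauge x * q
    gaugeDeriv := fun x => ((ContinuousLinearMap.mul ℝ ℍ).flip q) ∘L G.gaugeDeriv x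
    norm_gauge := fun x => by rw [norm_mul, G.norm_gauge, hq, one_mul]
    hasFDerivAt_gauge := fun x =>
      ((ContinuousLinearMap.mul ℝ ℍ).flip q).hasFDerivAt.comp x (G.hasFDerivAt_gauge x)
    norm_gaugeDeriv_sub_le := fun x b => by
      have : G.gaugeDeriv x b * q - G.conn x b * (G.gauge x * q) =
        (G.gaugeDeriv x b - G.conn x b * G.gauge x) * q := by noncomm_ring
      simp only [ContinuousLinearMap.comp_apply, ContinuousLinearMap.flip_apply,
        ContinuousLinearMap.mul_apply', this, norm_mul, hq, mul_one]
      exact G.norm_gaugeDeriv_sub_le x b }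

/-- The quotient of two approximate gauges is almost constant. -/
lemma exists_hasFDerivAt_quotient (G : ApproxGauge A U r δ) (H : ApproxGauge A U s ε) (x : E3) :
    ∃ D : QForm, HasFDerivAt (fun x => star (G.gauge x) * H.gauge x) D x ∧
      ‖D‖ ≤ G.err x + H.err x + ‖H.conn x - G.conn x‖ := by
  obtain ⟨D, hD, hDb⟩ := (starQ.hasFDerivAt.comp x (G.hasFDerivAt_gauge x)).mulQ
    (H.hasFDerivAt_gauge x)
  refine ⟨D, hD, D.opNorm_le_bound (by have := G.err_nonneg x; have := H.err_nonneg x; positivity)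
    fun b => ?_⟩
  -- The terms in the connections cancel because the form is imaginary; what remains is the two
  -- gauge errors and the difference of the connections.
  have h1 : D b = star (G.gaugeDeriv x b - G.conn x b * G.gauge x) * H.gauge x +
      star (G.gauge x) * (H.gaugeDeriv x b - H.conn x b * H.gauge x) +
      star (G.gauge x) * (H.conn x b - G.conn x b) * H.gauge x := by
    rw [hDb, star_sub, star_mul, star_eq_neg_of_re_eq_zero (G.conn_re x b)]
    simp only [Function.comp, ContinuousLinearMap.comp_apply, starQ_apply]
    noncomm_ring
  rw [h1]
  refine (norm_add₃_le).trans ?_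
  simp only [norm_mul, Quaternion.norm_star, G.norm_gauge, H.norm_gauge, one_mul, mul_one, add_mul]
  gcongr
  · exact G.norm_gaugeDeriv_sub_le x b
  · exact H.norm_gaugeDeriv_sub_le x b
  · exact (H.conn x - G.conn x).le_opNorm b

/-- The section is almost constant in an approximate gauge. -/
lemma exists_hasFDerivAt_conj (G : ApproxGauge A U r δ) (x : E3) :
    ∃ D : QForm,
      HasFDerivAt (fun x => star (G.gauge x) * G.sect x * G.gauge x) D x ∧
      ‖D‖ ≤ 3 * G.err x := by
  obtain ⟨D₁, hD₁, hDb₁⟩ := (starQ.hasFDerivAt.comp x (G.hasFDerivAt_gauge x)).mulQ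
    (G.hasFDerivAt_sect x)
  obtain ⟨D, hD, hDb⟩ := hD₁.mulQ (G.hasFDerivAt_gauge x)
  refine ⟨D, hD, D.opNorm_le_bound (by have := G.err_nonneg x; positivity) fun b => ?_⟩
  -- For an exact gauge and a parallel section all terms cancel. The gauge error enters twice and
  -- the section error once, giving the factor 3.
  have h1 : D b = star (G.gaugeDeriv x b - G.conn x b * G.gauge x) * G.sect x * G.gauge x +
      star (G.gauge x) * (G.sectDeriv x b - (G.conn x b * G.sect x - G.sect x * G.conn x b)) *
        G.gauge x +
      star (G.gauge x) * G.sect x * (G.gaugeDeriv x b - G.conn x b * G.gauge x) := by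
    rw [hDb, hDb₁, star_sub, star_mul, star_eq_neg_of_re_eq_zero (G.conn_re x b)]
    simp only [Function.comp, ContinuousLinearMap.comp_apply, starQ_apply]
    noncomm_ring
  rw [h1]
  refine (norm_add₃_le).trans ?_
  simp only [norm_mul, Quaternion.norm_star, G.norm_gauge, one_mul, mul_one]
  have h2 := mul_le_of_le_one_right (norm_nonneg (G.gaugeDeriv x b - G.conn x b * G.gauge x))
    (G.norm_sect_le x)
  have h3 := mul_le_of_le_one_left (norm_nonneg (G.gaugeDeriv x b - G.conn x b * G.gauge x))
    (G.norm_sect_le x)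
  linarith [G.norm_gaugeDeriv_sub_le x b, G.norm_sectDeriv_sub_le x b]

end ApproxGauge

/-- Poincaré inequality with a point value in place of the mean value. -/
lemma exists_lintegral_enorm_sub_le {F : Type*} [NormedAddCommGroup F] [NormedSpace ℝ F]
    {g : E3 → F} {K : E3 → ℝ} (hK : Continuous K) (h0 : ∀ x, 0 ≤ K x)
    (hg : ∀ x, ∃ D : E3 →L[ℝ] F, HasFDerivAt g D x ∧ ‖D‖ ≤ K x) {r : ℝ} (hr0 : 0 < r)
    (hr : r ≤ 1) :
    ∃ y, ∫⁻ x in Metric.ball (0 : E3) r, ‖g x - g y‖ₑ ≤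
      16 * ∫⁻ x in Metric.ball (0 : E3) r, ENNReal.ofReal (K x) := by
  choose D hD hDK using hg
  obtain ⟨y, -, hy⟩ := exists_lintegral_segmentIntegral_le hK h0 hr0 hr
  refine ⟨y, (lintegral_mono fun x => ?_).trans hy⟩
  rw [← ofReal_norm]
  exact ENNReal.ofReal_le_ofReal (norm_sub_le_segmentIntegral hD hK hDK x y)

namespace ApproxGauge

variable {A : E3 → QForm} {U : E3 → ℍ} {r s : ℝ} {δ ε : ℝ≥0∞}

/-- This carries the constancy of w̄Uw to the limit. The constant is 48 = 16 · 3, from the Poincaré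
inequality and `exists_hasFDerivAt_conj`. -/
lemma exists_conj_close (G : ApproxGauge A U r δ) (hr0 : 0 < r) (hr : r ≤ 1) :
    ∃ c : ℍ, ∫⁻ x in Metric.ball (0 : E3) r,
      ‖star (G.gauge x) * G.sect x * G.gauge x - c‖ₑ ≤ 48 * δ := by
  obtain ⟨y, hy⟩ := exists_lintegral_enorm_sub_le (K := fun x => 3 * G.err x)
    (continuous_const.mul G.continuous_err)
    (fun x => by have := G.err_nonneg x; positivity) G.exists_hasFDerivAt_conj hr0 hr
  refine ⟨_, hy.trans ?_⟩
  simp_rw [ENNReal.ofReal_mul (zero_le_three (α := ℝ))]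
  rw [lintegral_const_mul' _ _ ENNReal.ofReal_ne_top, ← mul_assoc]
  have : (16 : ℝ≥0∞) * ENNReal.ofReal 3 = 48 := by
    rw [ENNReal.ofReal_ofNat]; norm_num
  rw [this]
  gcongr
  exact G.lintegral_err_le

/-- An approximate gauge may be normalised so as to be close to a given one. -/
lemma exists_close (hA : AEStronglyMeasurable A (volume.restrict (Metric.ball 0 1)))
    (G : ApproxGauge A U r δ) (H : ApproxGauge A U s ε) (hr0 : 0 < r) (hrs : r ≤ s)
    (hr : r ≤ 1) :
    ∃ H' : ApproxGauge A U s ε,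
      ∫⁻ x in Metric.ball (0 : E3) r, ‖H'.gauge x - G.gauge x‖ₑ ≤ 32 * (δ + ε) := by
  have hsub : Metric.ball (0 : E3) r ⊆ Metric.ball 0 s := Metric.ball_subset_ball hrs
  have hcn : Continuous fun x => ‖H.conn x - G.conn x‖ :=
    (H.continuous_conn.sub G.continuous_conn).norm
  obtain ⟨y, hy⟩ := exists_lintegral_enorm_sub_le
    (K := fun x => G.err x + H.err x + ‖H.conn x - G.conn x‖)
    ((G.continuous_err.add H.continuous_err).add hcn)
    (fun x => by have := G.err_nonneg x; have := H.err_nonneg x; positivity)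
    (G.exists_hasFDerivAt_quotient H) hr0 hr
  -- The quotient ḠH is close to its value at y, so multiplying H on the right by the inverse of
  -- this value brings it close to G.
  refine ⟨H.mulRight (star (star (G.gauge y) * H.gauge y)) ?_, ?_⟩
  · simp [G.norm_gauge, H.norm_gauge]
  have hn : ‖star (G.gauge y) * H.gauge y‖ = 1 := by
    simp [G.norm_gauge, H.norm_gauge]
  have h1 : ∀ x, ‖(H.mulRight (star (star (G.gauge y) * H.gauge y))
      (by rw [Quaternion.norm_star, hn])).gauge x - G.gauge x‖ₑ =
      ‖star (G.gauge x) * H.gauge x - star (G.gauge y) * H.gauge y‖ₑ := by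
    intro x
    have h2 : H.gauge x * star (star (G.gauge y) * H.gauge y) - G.gauge x =
        G.gauge x * (star (G.gauge x) * H.gauge x - star (G.gauge y) * H.gauge y) *
          star (star (G.gauge y) * H.gauge y) := by
      rw [mul_sub, ← mul_assoc, self_mul_star_of_norm_one (G.norm_gauge x), one_mul, sub_mul,
        mul_assoc (G.gauge x), self_mul_star_of_norm_one hn, mul_one]
    simp only [← ofReal_norm]
    congr 1
    change ‖H.gauge x * star (star (G.gauge y) * H.gauge y) - G.gauge x‖ = _
    rw [h2, norm_mul, norm_mul, G.norm_gauge, Quaternion.norm_star, hn, one_mul, mul_one]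
  simp_rw [h1]
  refine hy.trans ?_
  -- The errors contribute δ + ε, and the two connections, each close to A, contribute δ + ε once
  -- more; with the Poincaré factor 16 this gives 32.
  have h3 : ∫⁻ x in Metric.ball (0 : E3) r,
      ENNReal.ofReal (G.err x + H.err x + ‖H.conn x - G.conn x‖) ≤ 2 * (δ + ε) := by
    calc _ ≤ ∫⁻ x in Metric.ball (0 : E3) r, (ENNReal.ofReal (G.err x) + ENNReal.ofReal (H.err x) +
          (‖G.conn x - A x‖ₑ + ‖H.conn x - A x‖ₑ)) := by
          refine lintegral_mono fun x => ?_
          rw [ENNReal.ofReal_add (add_nonneg (G.err_nonneg x) (H.err_nonneg x)) (norm_nonneg _),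
            ENNReal.ofReal_add (G.err_nonneg x) (H.err_nonneg x), ofReal_norm]
          gcongr
          exact enorm_sub_le_of_common _ _ _
      _ = (∫⁻ x in Metric.ball (0 : E3) r, ENNReal.ofReal (G.err x)) +
          (∫⁻ x in Metric.ball (0 : E3) r, ENNReal.ofReal (H.err x)) +
          ((∫⁻ x in Metric.ball (0 : E3) r, ‖G.conn x - A x‖ₑ) +
            ∫⁻ x in Metric.ball (0 : E3) r, ‖H.conn x - A x‖ₑ) := by
          rw [lintegral_add_left
              (f := fun x => ENNReal.ofReal (G.err x) + ENNReal.ofReal (H.err x))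
              (G.continuous_err.measurable.ennreal_ofReal.add
                H.continuous_err.measurable.ennreal_ofReal),
            lintegral_add_left G.continuous_err.measurable.ennreal_ofReal, lintegral_add_left']
          exact (G.continuous_conn.aestronglyMeasurable.sub
            (hA.mono_set (Metric.ball_subset_ball hr))).enorm
      _ ≤ (δ + ε) + (δ + ε) := by
          gcongr
          · exact G.lintegral_err_le
          · exact (lintegral_mono_set hsub).trans H.lintegral_err_le
          · exact G.lintegral_conn_le
          · exact (lintegral_mono_set hsub).trans H.lintegral_conn_le
      _ = _ := (two_mul _).symm
  calc _ ≤ 16 * (2 * (δ + ε)) := by gcongr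
    _ = _ := by rw [← mul_assoc]; norm_num

end ApproxGauge

/-! ### Convergence of normalised approximate gauges. -/

/-- Radii increasing to one. -/
noncomputable def rad (k : ℕ) : ℝ := 1 - 1 / (k + 2)

lemma rad_pos (k : ℕ) : 0 < rad k := by
  unfold rad
  rw [sub_pos, div_lt_one (by positivity)]
  have : (0 : ℝ) ≤ k := k.cast_nonneg
  linarith

lemma rad_lt_one (k : ℕ) : rad k < 1 := by
  unfold rad
  have : (0 : ℝ) < 1 / (k + 2) := by positivity
  linarith

lemma rad_mono : Monotone rad := by
  intro j k h
  unfold rad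
  have : (j : ℝ) ≤ k := by exact_mod_cast h
  gcongr

lemma tendsto_rad : Tendsto rad atTop (𝓝 1) := by
  have h : Tendsto (fun k : ℕ => (1 : ℝ) / (k + 2)) atTop (𝓝 0) :=
    tendsto_const_nhds.div_atTop (tendsto_atTop_add_const_right _ _ tendsto_natCast_atTop_atTop)
  have h2 := h.const_sub (1 : ℝ)
  rwa [sub_zero] at h2

lemma exists_subset_ball_rad {S : Set E3} (hS : IsCompact S) (hSB : S ⊆ Metric.ball 0 1) :
    ∃ j, ∀ k ≥ j, S ⊆ Metric.ball 0 (rad k) := by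
  rcases S.eq_empty_or_nonempty with rfl | hne
  · exact ⟨0, fun _ _ => empty_subset _⟩
  obtain ⟨z, hz, hmax⟩ := hS.exists_isMaxOn hne continuous_norm.continuousOn
  obtain ⟨j, hj⟩ := eventually_atTop.mp
    (tendsto_rad.eventually (lt_mem_nhds (mem_ball_zero_iff.mp (hSB hz))))
  exact ⟨j, fun k hk x hx => mem_ball_zero_iff.mpr ((hmax hx).trans_lt (hj k hk))⟩

/-- Each function is controlled only on its own ball, and a given point lies in these balls from
some index on; hence only a tail of the series can be claimed to converge. -/
lemma ae_exists_tsum_ne_top {h : ℕ → E3 → ℝ≥0∞}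
    (hm : ∀ k, AEMeasurable (h k) (volume.restrict (Metric.ball 0 (rad k)))) {C : ℝ≥0∞}
    (hC : C ≠ ⊤) (hb : ∀ k, ∫⁻ x in Metric.ball 0 (rad k), h k x ≤ C * 2⁻¹ ^ k) :
    ∀ᵐ x ∂(volume.restrict (Metric.ball (0 : E3) 1)), ∃ j, ∑' k, h (k + j) x ≠ ⊤ := by
  have hi : ∀ k, AEMeasurable ((Metric.ball 0 (rad k)).indicator (h k)) volume := fun k =>
    (aemeasurable_indicator_iff measurableSet_ball).mpr (hm k)
  have h1 : ∫⁻ x, ∑' k, (Metric.ball 0 (rad k)).indicator (h k) x ≠ ⊤ := by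
    rw [lintegral_tsum hi]
    refine ne_top_of_le_ne_top (b := C * 2) (ENNReal.mul_ne_top hC ENNReal.ofNat_ne_top) ?_
    calc _ ≤ ∑' k, C * 2⁻¹ ^ k := ENNReal.tsum_le_tsum fun k => by
          rw [lintegral_indicator measurableSet_ball]; exact hb k
      _ = C * 2 := by rw [ENNReal.tsum_mul_left, ENNReal.tsum_geometric, ENNReal.one_sub_inv_two,
          inv_inv]
  filter_upwards [ae_restrict_of_ae (ae_lt_top' (AEMeasurable.tsum hi) h1),
    ae_restrict_mem measurableSet_ball] with x hx hxB
  obtain ⟨j, hj⟩ := exists_subset_ball_rad isCompact_singleton (singleton_subset_iff.mpr hxB)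
  refine ⟨j, ne_top_of_le_ne_top hx.ne ?_⟩
  calc ∑' k, h (k + j) x = ∑' k, (Metric.ball 0 (rad (k + j))).indicator (h (k + j)) x := by
        refine tsum_congr fun k => ?_
        rw [indicator_of_mem (hj (k + j) (Nat.le_add_left _ _) rfl)]
    _ ≤ _ := ENNReal.tsum_comp_le_tsum_of_injective (add_left_injective j)
        (fun k => (Metric.ball 0 (rad k)).indicator (h k) x)

lemma ae_tendsto_zero_of_lintegral_le {h : ℕ → E3 → ℝ≥0∞}
    (hm : ∀ k, AEMeasurable (h k) (volume.restrict (Metric.ball 0 (rad k)))) {C : ℝ≥0∞}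
    (hC : C ≠ ⊤) (hb : ∀ k, ∫⁻ x in Metric.ball 0 (rad k), h k x ≤ C * 2⁻¹ ^ k) :
    ∀ᵐ x ∂(volume.restrict (Metric.ball (0 : E3) 1)), Tendsto (fun k => h k x) atTop (𝓝 0) := by
  filter_upwards [ae_exists_tsum_ne_top hm hC hb] with x hx
  obtain ⟨j, hj⟩ := hx
  exact (tendsto_add_atTop_iff_nat j).mp (ENNReal.tendsto_atTop_zero_of_tsum_ne_top hj)

lemma tendsto_const_mul_inv_two_pow {C : ℝ≥0∞} (hC : C ≠ ⊤) :
    Tendsto (fun k : ℕ => C * 2⁻¹ ^ k) atTop (𝓝 0) := by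
  simpa using ENNReal.Tendsto.const_mul
    (ENNReal.tendsto_pow_atTop_nhds_zero_of_lt_one (by simp)) (Or.inr hC)

/-- The differential of the gauge is not known to be continuous. It is measurable as a derivative,
and bounded by the continuous function |conn| + err, which suffices to integrate by parts. -/
lemma ApproxGauge.integral_fderiv_smul {A : E3 → QForm} {U : E3 → ℍ} {r : ℝ} {δ : ℝ≥0∞}
    (G : ApproxGauge A U r δ) {φ : E3 → ℝ} (hφ : ContDiff ℝ ∞ φ) (hc : HasCompactSupport φ)
    (b : E3) :
    Integrable (fun x => φ x • G.gaugeDeriv x b) ∧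
    ∫ x, (fderiv ℝ φ x b) • G.gauge x = - ∫ x, φ x • G.gaugeDeriv x b := by
  borelize ℍ
  have hfd : ∀ x, fderiv ℝ G.gauge x = G.gaugeDeriv x := fun x => (G.hasFDerivAt_gauge x).fderiv
  have hdφ : Continuous fun x => fderiv ℝ φ x b :=
    (hφ.continuous_fderiv (by simp)).clm_apply continuous_const
  have hcφ : HasCompactSupport fun x => fderiv ℝ φ x b := hc.fderiv_apply ℝ b
  have hM : Continuous fun x => ‖φ x‖ * (‖G.conn x b‖ + G.err x * ‖b‖) :=
    hφ.continuous.norm.mul ((G.continuous_conn.clm_apply continuous_const).norm.add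
      (G.continuous_err.mul continuous_const))
  have hMi : Integrable fun x => ‖φ x‖ * (‖G.conn x b‖ + G.err x * ‖b‖) :=
    hM.integrable_of_hasCompactSupport (hc.norm.mul_right)
  have hm : Measurable fun x => G.gaugeDeriv x b := by
    simp only [← hfd]
    exact measurable_fderiv_apply_const ℝ _ b
  have hint : Integrable fun x => φ x • G.gaugeDeriv x b := by
    refine hMi.mono' (hφ.continuous.measurable.smul hm).aestronglyMeasurable (ae_of_all _ fun x => ?_)
    rw [norm_smul]
    gcongr
    have h1 := G.norm_gaugeDeriv_sub_le x b
    have h2 := norm_sub_norm_le (G.gaugeDeriv x b) (G.conn x b * G.gauge x)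
    rw [norm_mul, G.norm_gauge, mul_one] at h2
    linarith
  refine ⟨hint, ?_⟩
  have h := integral_smul_fderiv_eq_neg_fderiv_smul_of_integrable (μ := volume) (f := φ)
    (g := G.gauge) (v := b)
    ((hdφ.smul G.continuous_gauge).integrable_of_hasCompactSupport hcφ.smul_right)
    (by simpa only [hfd] using hint)
    ((hφ.continuous.smul G.continuous_gauge).integrable_of_hasCompactSupport hc.smul_right)
    (fun x _ => hφ.differentiable (by simp) x)
    (fun x _ => (G.hasFDerivAt_gauge x).differentiableAt)
  simp only [hfd] at h
  rw [h, neg_neg]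

/-- Weak differential equation for the limit. -/
lemma integral_fderiv_smul_eq_of_tendsto {A : E3 → QForm} {U : E3 → ℍ}
    (hA : IntegrableOn A (Metric.ball 0 1))
    (G : ∀ k, ApproxGauge A U (rad k) (2⁻¹ ^ k)) {v : E3 → ℍ}
    (hvm : AEStronglyMeasurable v (volume.restrict (Metric.ball 0 1)))
    (hv1 : ∀ x, ‖v x‖ = 1)
    (hlim : ∀ᵐ x ∂(volume.restrict (Metric.ball (0 : E3) 1)),
      Tendsto (fun k => (G k).gauge x) atTop (𝓝 (v x)))
    {φ : E3 → ℝ} (hφ : IsTestFunction (Metric.ball 0 1) φ) (b : E3) :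
    ∫ x, (fderiv ℝ φ x b) • v x = - ∫ x, φ x • (A x b * v x) := by
  set μ := (volume : Measure E3).restrict (Metric.ball (0 : E3) 1) with hμ
  have hφc : Continuous φ := hφ.smooth.continuous
  have hdφ : Continuous fun x => fderiv ℝ φ x b :=
    (hφ.smooth.continuous_fderiv (by simp)).clm_apply continuous_const
  have hcφ : HasCompactSupport fun x => fderiv ℝ φ x b := hφ.compact.fderiv_apply ℝ b
  have hφ0 : ∀ x, x ∉ Metric.ball (0 : E3) 1 → φ x = 0 := fun x hx =>
    image_eq_zero_of_notMem_tsupport fun h => hx (hφ.support h)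
  have hdφ0 : ∀ x, x ∉ Metric.ball (0 : E3) 1 → fderiv ℝ φ x b = 0 := fun x hx => by
    have : fderiv ℝ φ x = 0 := image_eq_zero_of_notMem_tsupport fun h =>
      hx (hφ.support (tsupport_fderiv_subset ℝ h))
    rw [this]; rfl
  have hR : ∀ f : E3 → ℍ, ∫ x, (fderiv ℝ φ x b) • f x = ∫ x, (fderiv ℝ φ x b) • f x ∂μ := fun f =>
    (setIntegral_eq_integral_of_forall_compl_eq_zero fun x hx => by
      rw [hdφ0 x hx, zero_smul]).symm
  have hR' : ∀ f : E3 → ℍ, ∫ x, φ x • f x = ∫ x, φ x • f x ∂μ := fun f =>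
    (setIntegral_eq_integral_of_forall_compl_eq_zero fun x hx => by
      rw [hφ0 x hx, zero_smul]).symm
  obtain ⟨j, hj⟩ := exists_subset_ball_rad hφ.compact hφ.support
  obtain ⟨C, hC⟩ := hφ.compact.exists_bound_of_continuous hφc
  have h1 : Tendsto (fun k => ∫ x, (fderiv ℝ φ x b) • (G k).gauge x ∂μ) atTop
      (𝓝 (∫ x, (fderiv ℝ φ x b) • v x ∂μ)) := by
    refine tendsto_integral_of_dominated_convergence (fun x => ‖fderiv ℝ φ x b‖)
      (fun k => (hdφ.smul (G k).continuous_gauge).aestronglyMeasurable)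
      (hdφ.norm.integrable_of_hasCompactSupport hcφ.norm).restrict
      (fun k => ae_of_all _ fun x => ?_) ?_
    · rw [norm_smul, (G k).norm_gauge, mul_one]
    · filter_upwards [hlim] with x hx using hx.const_smul _
  have h2 : Tendsto (fun k => ∫ x, φ x • (G k).gaugeDeriv x b ∂μ) atTop
      (𝓝 (∫ x, φ x • (A x b * v x) ∂μ)) := by
    have hAm : AEStronglyMeasurable A μ := hA.aestronglyMeasurable
    refine tendsto_integral_of_L1 _ ?_ (Eventually.of_forall fun k =>
      ((G k).integral_fderiv_smul hφ.smooth hφ.compact b).1.restrict) ?_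
    · refine hφc.aestronglyMeasurable.smul (AEStronglyMeasurable.mul ?_ hvm)
      exact (ContinuousLinearMap.apply ℝ ℍ b).continuous.comp_aestronglyMeasurable hAm
    -- Dominated convergence with majorant 2|A|, both gauges having norm 1.
    have hD : Tendsto (fun k => ∫⁻ x, ‖A x‖ₑ * ‖(G k).gauge x - v x‖ₑ ∂μ) atTop (𝓝 0) := by
      have := tendsto_lintegral_of_dominated_convergence' (μ := μ)
        (F := fun k x => ‖A x‖ₑ * ‖(G k).gauge x - v x‖ₑ) (f := fun _ => 0)
        (fun x => ‖A x‖ₑ * 2) (fun k => hAm.enorm.mul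
          ((G k).continuous_gauge.aestronglyMeasurable.sub hvm).enorm)
        (fun k => ae_of_all _ fun x => ?_) ?_ ?_
      · simpa using this
      · refine mul_le_mul' le_rfl (enorm_sub_le.trans ?_)
        rw [← ofReal_norm, ← ofReal_norm, (G k).norm_gauge, hv1]
        norm_num
      · rw [lintegral_mul_const' _ _ ENNReal.ofNat_ne_top]
        exact ENNReal.mul_ne_top hA.2.ne ENNReal.ofNat_ne_top
      · filter_upwards [hlim] with x hx
        have h3 : Tendsto (fun k => ‖(G k).gauge x - v x‖ₑ) atTop (𝓝 0) := by
          simpa only [edist_eq_enorm_sub] using tendsto_iff_edist_tendsto_0.mp hx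
        simpa using ENNReal.Tendsto.const_mul h3 (Or.inr enorm_ne_top)
    have hup : Tendsto (fun k => ENNReal.ofReal (C * ‖b‖) * (2 * 2⁻¹ ^ k) + ENNReal.ofReal (C * ‖b‖) *
        ∫⁻ x, ‖A x‖ₑ * ‖(G k).gauge x - v x‖ₑ ∂μ) atTop (𝓝 0) := by
      have := (ENNReal.Tendsto.const_mul (a := ENNReal.ofReal (C * ‖b‖))
        (tendsto_const_mul_inv_two_pow (C := 2) ENNReal.ofNat_ne_top)
        (Or.inr ENNReal.ofReal_ne_top)).add (ENNReal.Tendsto.const_mul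
          (a := ENNReal.ofReal (C * ‖b‖)) hD (Or.inr ENNReal.ofReal_ne_top))
      simpa using this
    refine tendsto_of_tendsto_of_tendsto_of_le_of_le' tendsto_const_nhds hup
      (Eventually.of_forall fun _ => zero_le) ?_
    filter_upwards [eventually_ge_atTop j] with k hk
    have hCb : 0 ≤ C * ‖b‖ := mul_nonneg ((norm_nonneg _).trans (hC 0)) (norm_nonneg _)
    have hpt : ∀ x, ‖φ x • (G k).gaugeDeriv x b - φ x • (A x b * v x)‖ₑ ≤
        ENNReal.ofReal (C * ‖b‖) * (Metric.ball 0 (rad k)).indicator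
          (fun x => ENNReal.ofReal ((G k).err x) + ‖(G k).conn x - A x‖ₑ) x +
        ENNReal.ofReal (C * ‖b‖) * (‖A x‖ₑ * ‖(G k).gauge x - v x‖ₑ) := by
      intro x
      by_cases hx : x ∈ Metric.ball 0 (rad k)
      · rw [indicator_of_mem hx, ← mul_add]
        simp only [← ofReal_norm]
        rw [← ENNReal.ofReal_add ((G k).err_nonneg x) (norm_nonneg _),
          ← ENNReal.ofReal_mul (norm_nonneg _), ← ENNReal.ofReal_add (add_nonneg
          ((G k).err_nonneg x) (norm_nonneg _)) (by positivity), ← ENNReal.ofReal_mul hCb]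
        refine ENNReal.ofReal_le_ofReal ?_
        -- Three sources of error: the gauge equation, the connection, and the gauge itself. The
        -- first two are each at most 2^{-k} in L¹ of the ball of radius `rad k`, which contains the
        -- support of φ for large k; the third is `hD`.
        have e1 : φ x • (G k).gaugeDeriv x b - φ x • (A x b * v x) =
            φ x • (((G k).gaugeDeriv x b - (G k).conn x b * (G k).gauge x) +
              ((G k).conn x - A x) b * (G k).gauge x + A x b * ((G k).gauge x - v x)) := by
          rw [← smul_sub, sub_apply]
          congr 1
          noncomm_ring
        rw [e1, norm_smul, mul_assoc C]
        refine mul_le_mul (hC x) ((norm_add₃_le).trans ?_) (norm_nonneg _)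
          ((norm_nonneg _).trans (hC x))
        rw [norm_mul, norm_mul, (G k).norm_gauge, mul_one, mul_add, mul_add]
        refine add_le_add (add_le_add ?_ ?_) ?_
        · rw [mul_comm]; exact (G k).norm_gaugeDeriv_sub_le x b
        · rw [mul_comm]; exact ((G k).conn x - A x).le_opNorm b
        · rw [← mul_assoc, mul_comm ‖b‖]
          gcongr
          exact (A x).le_opNorm b
      · have : φ x = 0 := image_eq_zero_of_notMem_tsupport fun h => hx (hj k hk h)
        simp [this]
    refine (lintegral_mono hpt).trans ?_
    rw [lintegral_add_right', lintegral_const_mul' _ _ ENNReal.ofReal_ne_top,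
      lintegral_const_mul' _ _ ENNReal.ofReal_ne_top]
    · gcongr
      refine (lintegral_mono' Measure.restrict_le_self le_rfl).trans ?_
      rw [lintegral_indicator measurableSet_ball,
        lintegral_add_left (G k).continuous_err.measurable.ennreal_ofReal, two_mul]
      exact add_le_add (G k).lintegral_err_le (G k).lintegral_conn_le
    · exact ((hAm.enorm.mul
        ((G k).continuous_gauge.aestronglyMeasurable.sub hvm).enorm)).const_mul _
  rw [hR, hR']
  refine tendsto_nhds_unique h1 (h2.neg.congr fun k => ?_)
  rw [← hR, ← hR', ((G k).integral_fderiv_smul hφ.smooth hφ.compact b).2]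

/-- Approximate gauges have a subsequential limit. -/
theorem exists_gauge_of_approxGauge {A : E3 → QForm} {U : E3 → ℍ}
    (hA : IntegrableOn A (Metric.ball 0 1))
    (hU : AEStronglyMeasurable U (volume.restrict (Metric.ball 0 1)))
    (h : ∀ k, Nonempty (ApproxGauge A U (rad k) (2⁻¹ ^ k))) :
    ∃ (v : E3 → ℍ) (c : ℍ), AEStronglyMeasurable v (volume.restrict (Metric.ball 0 1)) ∧
      (∀ x, ‖v x‖ = 1) ∧
      (∀ φ, IsTestFunction (Metric.ball 0 1) φ → ∀ b,
        ∫ x, (fderiv ℝ φ x b) • v x = - ∫ x, φ x • (A x b * v x)) ∧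
      ∀ᵐ x ∂(volume.restrict (Metric.ball (0 : E3) 1)), star (v x) * U x * v x = c := by
  -- Each new gauge is normalised against the previous one, so that successive differences are
  -- summable in L¹ of the exhausting balls.
  have hstep : ∀ k (G : ApproxGauge A U (rad k) (2⁻¹ ^ k)),
      ∃ H : ApproxGauge A U (rad (k + 1)) (2⁻¹ ^ (k + 1)),
        ∫⁻ x in Metric.ball (0 : E3) (rad k), ‖H.gauge x - G.gauge x‖ₑ ≤ 64 * 2⁻¹ ^ k := by
    intro k G
    obtain ⟨H⟩ := h (k + 1)
    obtain ⟨H', hH'⟩ := G.exists_close hA.aestronglyMeasurable H (rad_pos k)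
      (rad_mono k.le_succ) (rad_lt_one k).le
    refine ⟨H', hH'.trans ?_⟩
    calc 32 * ((2⁻¹ : ℝ≥0∞) ^ k + 2⁻¹ ^ (k + 1)) ≤ 32 * (2⁻¹ ^ k + 2⁻¹ ^ k) := by
          gcongr 32 * (_ + ?_)
          rw [pow_succ]
          exact mul_le_of_le_one_right' (by simp)
      _ = 64 * 2⁻¹ ^ k := by ring
  choose next hnext using hstep
  let G : ∀ k, ApproxGauge A U (rad k) (2⁻¹ ^ k) := fun k => Nat.rec (h 0).some next k
  have hG : ∀ k, ∫⁻ x in Metric.ball (0 : E3) (rad k), ‖(G (k + 1)).gauge x - (G k).gauge x‖ₑ ≤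
      64 * 2⁻¹ ^ k := fun k => hnext k (G k)
  have hconv : ∀ᵐ x ∂(volume.restrict (Metric.ball (0 : E3) 1)), ∃ l,
      Tendsto (fun k => (G k).gauge x) atTop (𝓝 l) := by
    filter_upwards [ae_exists_tsum_ne_top (fun k => (((G (k + 1)).continuous_gauge.sub
      (G k).continuous_gauge).enorm.measurable.aemeasurable)) ENNReal.ofNat_ne_top hG] with x hx
    obtain ⟨j, hj⟩ := hx
    have hc : CauchySeq fun k => (G (k + j)).gauge x := by
      refine cauchySeq_of_edist_le_of_tsum_ne_top
        (fun k => ‖(G (k + j + 1)).gauge x - (G (k + j)).gauge x‖ₑ) (fun k => ?_) hj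
      rw [edist_comm, edist_eq_enorm_sub, show k.succ + j = k + j + 1 by omega]
    obtain ⟨l, hl⟩ := cauchySeq_tendsto_of_complete hc
    exact ⟨l, (tendsto_add_atTop_iff_nat j).mp hl⟩
  classical
  -- The default value 1 makes v of unit norm at every point, also where the sequence diverges.
  let v : E3 → ℍ := fun x =>
    if hx : ∃ l, Tendsto (fun k => (G k).gauge x) atTop (𝓝 l) then hx.choose else 1
  have hlim : ∀ᵐ x ∂(volume.restrict (Metric.ball (0 : E3) 1)),
      Tendsto (fun k => (G k).gauge x) atTop (𝓝 (v x)) := by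
    filter_upwards [hconv] with x hx
    simp only [v, dif_pos hx]
    exact hx.choose_spec
  have hv1 : ∀ x, ‖v x‖ = 1 := by
    intro x
    by_cases hx : ∃ l, Tendsto (fun k => (G k).gauge x) atTop (𝓝 l)
    · simp only [v, dif_pos hx]
      refine tendsto_nhds_unique hx.choose_spec.norm ?_
      simp only [(G _).norm_gauge]
      exact tendsto_const_nhds
    · simp [v, dif_neg hx]
  have hvm : AEStronglyMeasurable v (volume.restrict (Metric.ball 0 1)) :=
    aestronglyMeasurable_of_tendsto_ae atTop
      (fun k => (G k).continuous_gauge.aestronglyMeasurable) hlim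
  choose c hc using fun k => (G k).exists_conj_close (rad_pos k) (rad_lt_one k).le
  have hUlim : ∀ᵐ x ∂(volume.restrict (Metric.ball (0 : E3) 1)),
      Tendsto (fun k => ‖(G k).sect x - U x‖ₑ) atTop (𝓝 0) := by
    refine ae_tendsto_zero_of_lintegral_le (C := 1) (fun k => ?_) (by simp) fun k => ?_
    · exact ((G k).continuous_sect.aestronglyMeasurable.sub
        (hU.mono_set (Metric.ball_subset_ball (rad_lt_one k).le))).enorm
    · rw [one_mul]; exact (G k).lintegral_sect_le
  have hclim := ae_tendsto_zero_of_lintegral_le (fun k =>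
    (((starQ.continuous.comp (G k).continuous_gauge).mul (G k).continuous_sect).mul
      (G k).continuous_gauge |>.sub continuous_const).enorm.measurable.aemeasurable)
      ENNReal.ofNat_ne_top hc
  simp only [Pi.sub_apply, Pi.mul_apply, Function.comp_apply, starQ_apply] at hclim
  -- The constants c k do not depend on x and converge to v̄Uv at almost every x, so this limit is
  -- the same constant almost everywhere.
  have hcx : ∀ᵐ x ∂(volume.restrict (Metric.ball (0 : E3) 1)),
      Tendsto c atTop (𝓝 (star (v x) * U x * v x)) := by
    filter_upwards [hlim, hUlim, hclim] with x h1 h2 h3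
    have h2' : Tendsto (fun k => (G k).sect x) atTop (𝓝 (U x)) := by
      rw [tendsto_iff_edist_tendsto_0]
      simpa only [edist_eq_enorm_sub] using h2
    have h4 := ((h1.star.mul h2').mul h1)
    have h5 : Tendsto (fun k => star ((G k).gauge x) * (G k).sect x * (G k).gauge x - c k) atTop
        (𝓝 0) := by
      rw [tendsto_iff_edist_tendsto_0]
      simpa only [edist_eq_enorm_sub, sub_zero] using h3
    simpa using h4.sub h5
  have hne : (ae (volume.restrict (Metric.ball (0 : E3) 1))).NeBot := by
    rw [ae_neBot, Ne, Measure.restrict_eq_zero]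
    exact (Metric.measure_ball_pos _ _ one_pos).ne'
  obtain ⟨x₀, hx₀⟩ := hcx.exists
  refine ⟨v, star (v x₀) * U x₀ * v x₀, hvm, hv1, fun φ hφ b =>
    integral_fderiv_smul_eq_of_tendsto hA G hvm hv1 hlim hφ b, ?_⟩
  filter_upwards [hcx] with x hx
  exact tendsto_nhds_unique hx hx₀

/-! ### Mollification. -/

/-- Smooth bump functions concentrating at the origin. -/
noncomputable def shrinkingBump (n : ℕ) : ContDiffBump (0 : E3) where
  rIn := 1 / (n + 1) / 2
  rOut := 1 / (n + 1)
  rIn_pos := by positivity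
  rIn_lt_rOut := half_lt_self (by positivity)

lemma tendsto_shrinkingBump_rOut : Tendsto (fun n => (shrinkingBump n).rOut) atTop (𝓝 0) :=
  tendsto_one_div_add_atTop_nhds_zero_nat

/-- The normalised bump functions. -/
noncomputable def mollifier (n : ℕ) : E3 → ℝ := (shrinkingBump n).normed volume

lemma mollifier_nonneg (n : ℕ) (x : E3) : 0 ≤ mollifier n x := (shrinkingBump n).nonneg_normed x

lemma contDiff_mollifier (n : ℕ) : ContDiff ℝ ∞ (mollifier n) := (shrinkingBump n).contDiff_normed

lemma hasCompactSupport_mollifier (n : ℕ) : HasCompactSupport (mollifier n) :=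
  (shrinkingBump n).hasCompactSupport_normed

lemma integral_mollifier (n : ℕ) : ∫ x, mollifier n x = 1 := (shrinkingBump n).integral_normed

lemma contDiff_mollifier_sub (n : ℕ) (x : E3) : ContDiff ℝ ∞ fun t => mollifier n (x - t) :=
  (contDiff_mollifier n).comp (contDiff_const.sub contDiff_id)

lemma hasCompactSupport_mollifier_sub (n : ℕ) (x : E3) :
    HasCompactSupport fun t => mollifier n (x - t) :=
  (hasCompactSupport_mollifier n).comp_homeomorph (Homeomorph.subLeft x)

lemma tsupport_mollifier_sub_subset (n : ℕ) (x : E3) :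
    tsupport (fun t => mollifier n (x - t)) ⊆ Metric.closedBall x (shrinkingBump n).rOut := by
  refine closure_minimal (fun t ht => ?_) Metric.isClosed_closedBall
  have : x - t ∈ Function.support (mollifier n) := ht
  rw [mollifier, (shrinkingBump n).support_normed_eq, mem_ball_zero_iff, ← dist_eq_norm,
    dist_comm] at this
  exact this.le

lemma integral_mollifier_sub (n : ℕ) (x : E3) : ∫ t, mollifier n (x - t) = 1 := by
  rw [integral_sub_left_eq_self (mollifier n) volume x, integral_mollifier]

/-- The mollification of a function. -/
noncomputable def mollify {F : Type*} [NormedAddCommGroup F] [NormedSpace ℝ F] (n : ℕ)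
    (f : E3 → F) : E3 → F :=
  convolution (mollifier n) f (ContinuousLinearMap.lsmul ℝ ℝ) volume

section Mollify

variable {F F' : Type*} [NormedAddCommGroup F] [NormedSpace ℝ F] [NormedAddCommGroup F']
  [NormedSpace ℝ F']

lemma mollify_apply (n : ℕ) (f : E3 → F) (x : E3) :
    mollify n f x = ∫ t, mollifier n (x - t) • f t := convolution_lsmul_swap

lemma integrable_mollifier_smul {f : E3 → F} (hf : LocallyIntegrable f) (n : ℕ) (x : E3) :
    Integrable fun t => mollifier n (x - t) • f t :=
  hf.integrable_smul_left_of_hasCompactSupport (contDiff_mollifier_sub n x).continuous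
    (hasCompactSupport_mollifier_sub n x)

lemma contDiff_mollify {f : E3 → F} (hf : LocallyIntegrable f) (n : ℕ) :
    ContDiff ℝ ∞ (mollify n f) :=
  (hasCompactSupport_mollifier n).contDiff_convolution_left _ (contDiff_mollifier n) hf

/-- Lebesgue differentiation; it needs the ratio of outer to inner radius of the bumps to be
bounded, and here that ratio is 2. -/
lemma ae_tendsto_mollify [CompleteSpace F] {f : E3 → F} (hf : LocallyIntegrable f) :
    ∀ᵐ x, Tendsto (fun n => mollify n f x) atTop (𝓝 (f x)) :=
  ContDiffBump.ae_convolution_tendsto_right_of_locallyIntegrable (φ := shrinkingBump) (K := 2)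
    tendsto_shrinkingBump_rOut (Eventually.of_forall fun n => by
      simp only [shrinkingBump]; linarith) hf

lemma mollify_clm [CompleteSpace F] [CompleteSpace F'] {f : E3 → F} (hf : LocallyIntegrable f)
    (L : F →L[ℝ] F') (n : ℕ) (x : E3) : mollify n (fun t => L (f t)) x = L (mollify n f x) := by
  rw [mollify_apply, mollify_apply, ← L.integral_comp_comm (integrable_mollifier_smul hf n x)]
  simp

lemma norm_mollify_le {f : E3 → F} (n : ℕ) (x : E3) :
    ‖mollify n f x‖ ≤ mollify n (fun t => ‖f t‖) x := by
  rw [mollify_apply, mollify_apply]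
  refine (norm_integral_le_integral_norm _).trans (le_of_eq ?_)
  congr 1
  ext t
  rw [norm_smul, Real.norm_of_nonneg (mollifier_nonneg _ _), smul_eq_mul]

lemma mollify_mono {f g : E3 → ℝ} (hf : LocallyIntegrable f) (hg : LocallyIntegrable g)
    (h : ∀ᵐ x, f x ≤ g x) (n : ℕ) (x : E3) : mollify n f x ≤ mollify n g x := by
  rw [mollify_apply, mollify_apply]
  refine integral_mono_ae (integrable_mollifier_smul hf n x) (integrable_mollifier_smul hg n x) ?_
  filter_upwards [h] with t ht
  exact mul_le_mul_of_nonneg_left ht (mollifier_nonneg _ _)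

lemma norm_mollify_le_one {f : E3 → F} (hf : LocallyIntegrable f) (h : ∀ᵐ x, ‖f x‖ ≤ 1) (n : ℕ)
    (x : E3) : ‖mollify n f x‖ ≤ 1 := by
  refine (norm_mollify_le n x).trans ((mollify_mono (fun x => (hf x).norm) (locallyIntegrable_const (1 : ℝ)) h n
    x).trans (le_of_eq ?_))
  rw [mollify_apply]
  simpa using integral_mollifier_sub n x

lemma mollify_nonneg {f : E3 → ℝ} (h : ∀ x, 0 ≤ f x) (n : ℕ) (x : E3) : 0 ≤ mollify n f x := by
  rw [mollify_apply]
  exact integral_nonneg fun t => mul_nonneg (mollifier_nonneg _ _) (h t)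

/-- Jensen's inequality for the square, in the form that a variance is nonnegative. -/
lemma sq_mollify_le {g : E3 → ℝ} (hg : LocallyIntegrable g)
    (hg2 : LocallyIntegrable fun x => g x ^ 2) (n : ℕ) (x : E3) :
    mollify n g x ^ 2 ≤ mollify n (fun t => g t ^ 2) x := by
  set m := mollify n g x with hm
  have hm' : ∫ t, mollifier n (x - t) * g t = m := by rw [hm, mollify_apply]; rfl
  have h0 : 0 ≤ ∫ t, mollifier n (x - t) * (g t - m) ^ 2 :=
    integral_nonneg fun t => mul_nonneg (mollifier_nonneg _ _) (sq_nonneg _)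
  have i1 := integrable_mollifier_smul hg n x
  have i2 := integrable_mollifier_smul hg2 n x
  have i3 := integrable_mollifier_smul (locallyIntegrable_const (1 : ℝ)) n x
  simp only [smul_eq_mul, mul_one] at i1 i2 i3
  have h1 : ∫ t, mollifier n (x - t) * (g t - m) ^ 2 =
      (∫ t, mollifier n (x - t) * g t ^ 2) - 2 * m * (∫ t, mollifier n (x - t) * g t) +
        m ^ 2 * ∫ t, mollifier n (x - t) := by
    rw [← integral_const_mul, ← integral_const_mul, ← integral_sub i2 (i1.const_mul _),
      ← integral_add (f := fun t => mollifier n (x - t) * g t ^ 2 - 2 * m * (mollifier n (x - t) * g t))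
        (i2.sub (i1.const_mul _)) (i3.const_mul _)]
    congr 1
    ext t
    ring
  rw [hm', integral_mollifier_sub] at h1
  have h2 : mollify n (fun t => g t ^ 2) x = ∫ t, mollifier n (x - t) * g t ^ 2 := mollify_apply ..
  rw [h2]
  nlinarith

lemma integrable_mollify {f : E3 → F} (hf : Integrable f) (n : ℕ) : Integrable (mollify n f) :=
  Integrable.integrable_convolution _ (shrinkingBump n).integrable_normed hf

lemma integral_mollify [CompleteSpace F] {f : E3 → F} (hf : Integrable f) (n : ℕ) :
    ∫ x, mollify n f x = ∫ x, f x := by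
  have h : Integrable (mollifier n) := (shrinkingBump n).integrable_normed
  rw [mollify, integral_convolution _ h hf, integral_mollifier]
  simp

/-- The derivative is placed on t ↦ mollifier(x − t), the shape in which weak derivatives can be
tested. The sign comes from differentiating in t instead of x. -/
lemma fderiv_mollify_apply [CompleteSpace F] {f : E3 → F} (hf : LocallyIntegrable f) (n : ℕ)
    (x b : E3) :
    fderiv ℝ (mollify n f) x b = - ∫ t, (fderiv ℝ (fun t => mollifier n (x - t)) t b) • f t := by
  have hsm := (contDiff_mollifier n).of_le (m := 1) (by simp)
  rw [mollify, ((hasCompactSupport_mollifier n).hasFDerivAt_convolution_left _ hsm hf x).fderiv,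
    convolution_eq_swap, ContinuousLinearMap.integral_apply, ← integral_neg]
  · congr 1
    ext1 t
    have : HasFDerivAt (fun t => mollifier n (x - t)) (-fderiv ℝ (mollifier n) (x - t)) t := by
      have h1 : HasFDerivAt (fun t => x - t) (-ContinuousLinearMap.id ℝ E3) t :=
        (hasFDerivAt_id t).const_sub x
      have h2 := ((hsm.differentiable one_ne_zero (x - t)).hasFDerivAt).comp t h1
      refine h2.congr_fderiv ?_
      ext c; simp
    rw [this.fderiv]
    simp [ContinuousLinearMap.precompL_apply]
  · exact ((hasCompactSupport_mollifier n).fderiv ℝ).convolutionExists_left _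
      (hsm.continuous_fderiv one_ne_zero) hf x |>.integrable_swap

end Mollify

/-- Scheffé's argument: mollification preserves the integral, so the positive and negative parts of
the difference have equal integrals. The negative part is dominated by g, because the mollification
is nonnegative. -/
lemma tendsto_lintegral_mollify_sub {g : E3 → ℝ} (hg : Integrable g) (h0 : ∀ x, 0 ≤ g x) :
    Tendsto (fun n => ∫⁻ x, ENNReal.ofReal (mollify n g x - g x)) atTop (𝓝 0) := by
  have h1 : ∀ n, ∫⁻ x, ENNReal.ofReal (mollify n g x - g x) =
      ENNReal.ofReal (∫ x, max (g x - mollify n g x) 0) := by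
    intro n
    have hi : Integrable fun x => mollify n g x - g x := (integrable_mollify hg n).sub hg
    have hi' : Integrable fun x => g x - mollify n g x := hg.sub (integrable_mollify hg n)
    have h2 : ∀ x, max (mollify n g x - g x) 0 =
        (mollify n g x - g x) + max (g x - mollify n g x) 0 := fun x => by
      rcases le_total (mollify n g x) (g x) with h | h
      · rw [max_eq_right (by linarith), max_eq_left (by linarith)]; ring
      · rw [max_eq_left (by linarith), max_eq_right (by linarith)]; ring
    have h3 : ∫ x, max (g x - mollify n g x) 0 = ∫ x, max (mollify n g x - g x) 0 := by
      simp_rw [h2]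
      rw [integral_add hi hi'.pos_part,
        integral_sub (integrable_mollify hg n) hg, integral_mollify hg, sub_self, zero_add]
    rw [h3, ofReal_integral_eq_lintegral_ofReal hi.pos_part (ae_of_all _ fun _ => le_max_right _ _)]
    refine lintegral_congr fun x => ?_
    rcases le_total (mollify n g x) (g x) with h | h
    · simp [h]
    · rw [max_eq_left (by linarith)]
  simp_rw [h1]
  have h4 : Tendsto (fun n => ∫ x, max (g x - mollify n g x) 0) atTop (𝓝 (∫ _ : E3, (0 : ℝ))) := by
    refine tendsto_integral_of_dominated_convergence g (fun n =>
      (hg.sub (integrable_mollify hg n)).pos_part.aestronglyMeasurable) hg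
      (fun n => ae_of_all _ fun x => ?_) ?_
    · rw [Real.norm_of_nonneg (le_max_right _ _)]
      exact max_le (by linarith [mollify_nonneg h0 n x]) (h0 x)
    · filter_upwards [ae_tendsto_mollify hg.locallyIntegrable] with x hx
      simpa using (hx.const_sub (g x)).max (tendsto_const_nhds (x := (0 : ℝ)))
  simpa using ENNReal.tendsto_ofReal h4

/-- Dominated convergence with a dominating function containing a mollification. -/
lemma tendsto_lintegral_of_le_mollify {g : E3 → ℝ} (hg : Integrable g)
    (h0 : ∀ x, 0 ≤ g x) {C : ℝ}
    (hC : 0 ≤ C) {r : ℝ} {h : ℕ → E3 → ℝ}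
    (hm : ∀ n, AEStronglyMeasurable (h n) (volume.restrict (Metric.ball 0 r)))
    (hb : ∀ᶠ n in atTop, ∀ᵐ x ∂(volume.restrict (Metric.ball 0 r)),
      h n x ≤ C * (1 + mollify n g x + g x))
    (hlim : ∀ᵐ x ∂(volume.restrict (Metric.ball 0 r)), Tendsto (fun n => h n x) atTop (𝓝 0)) :
    Tendsto (fun n => ∫⁻ x in Metric.ball 0 r, ENNReal.ofReal (h n x)) atTop (𝓝 0) := by
  have hfin : IsFiniteMeasure (volume.restrict (Metric.ball (0 : E3) r)) :=
    ⟨by rw [Measure.restrict_apply_univ]; exact measure_ball_lt_top⟩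
  have hB : Integrable (fun x => C * (1 + 2 * g x)) (volume.restrict (Metric.ball (0 : E3) r)) :=
    ((integrable_const _).add (hg.restrict.const_mul _)).const_mul _
  -- Truncate at the fixed integrable function C(1 + 2g), where dominated convergence applies. The
  -- excess over it is at most C times the positive part of mollify g − g, which tends to zero in
  -- L¹.
  have h1 : Tendsto (fun n => ∫⁻ x in Metric.ball 0 r,
      ENNReal.ofReal (min (h n x) (C * (1 + 2 * g x)))) atTop (𝓝 0) := by
    have := tendsto_lintegral_of_dominated_convergence'
      (μ := volume.restrict (Metric.ball (0 : E3) r))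
      (F := fun n x => ENNReal.ofReal (min (h n x) (C * (1 + 2 * g x)))) (f := fun _ => 0)
      (fun x => ENNReal.ofReal (C * (1 + 2 * g x)))
      (fun n => ((hm n).inf hB.aestronglyMeasurable).aemeasurable.ennreal_ofReal)
      (fun n => ae_of_all _ fun x => ENNReal.ofReal_le_ofReal (min_le_right _ _)) ?_ ?_
    · simpa using this
    · exact (hB.lintegral_lt_top).ne
    · filter_upwards [hlim] with x hx
      refine tendsto_of_tendsto_of_tendsto_of_le_of_le tendsto_const_nhds
        (h := fun n => ENNReal.ofReal (h n x)) ?_ (fun _ => zero_le)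
        (fun n => ENNReal.ofReal_le_ofReal (min_le_left _ _))
      simpa using ENNReal.tendsto_ofReal hx
  have h2 : Tendsto (fun n => ENNReal.ofReal C * ∫⁻ x, ENNReal.ofReal (mollify n g x - g x))
      atTop (𝓝 0) := by
    simpa using ENNReal.Tendsto.const_mul (tendsto_lintegral_mollify_sub hg h0)
      (Or.inr ENNReal.ofReal_ne_top)
  have h3 := h1.add h2
  rw [add_zero] at h3
  refine tendsto_of_tendsto_of_tendsto_of_le_of_le' tendsto_const_nhds h3
    (Eventually.of_forall fun _ => zero_le) ?_
  filter_upwards [hb] with n hn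
  calc ∫⁻ x in Metric.ball 0 r, ENNReal.ofReal (h n x)
      ≤ ∫⁻ x in Metric.ball 0 r, (ENNReal.ofReal (min (h n x) (C * (1 + 2 * g x))) +
          ENNReal.ofReal C * ENNReal.ofReal (mollify n g x - g x)) := by
        refine lintegral_mono_ae ?_
        filter_upwards [hn] with x hx
        rw [← ENNReal.ofReal_mul hC]
        rcases le_total (h n x) (C * (1 + 2 * g x)) with e | e
        · rw [min_eq_left e]; exact le_self_add
        · rw [min_eq_right e]
          exact (ENNReal.ofReal_le_ofReal (by linarith)).trans ENNReal.ofReal_add_le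
    _ ≤ _ := by
        rw [lintegral_add_left' (f := fun x => ENNReal.ofReal (min (h n x) (C * (1 + 2 * g x))))
            (((hm n).inf hB.aestronglyMeasurable).aemeasurable.ennreal_ofReal),
          lintegral_const_mul' _ _ ENNReal.ofReal_ne_top]
        gcongr
        exact Measure.restrict_le_self

/-! ### Mollified weak derivatives in the interior of the ball. -/

lemma isTestFunction_mollifier_sub {n : ℕ} {x : E3} (hx : ‖x‖ + (shrinkingBump n).rOut < 1) :
    IsTestFunction (Metric.ball 0 1) fun t => mollifier n (x - t) where
  smooth := contDiff_mollifier_sub n x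
  compact := hasCompactSupport_mollifier_sub n x
  support := (tsupport_mollifier_sub_subset n x).trans fun t ht => by
    rw [mem_ball_zero_iff]
    have h1 : ‖t - x‖ ≤ (shrinkingBump n).rOut := by simpa [dist_eq_norm] using ht
    have h2 := norm_add_le (t - x) x
    rw [sub_add_cancel] at h2
    linarith

lemma eventually_add_shrinkingBump_lt {r : ℝ} (hr : r < 1) :
    ∀ᶠ n in atTop, ∀ x ∈ Metric.ball (0 : E3) r, ‖x‖ + (shrinkingBump n).rOut < 1 := by
  filter_upwards [tendsto_shrinkingBump_rOut.eventually (gt_mem_nhds (sub_pos.mpr hr))] with n hn x hx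
  have := mem_ball_zero_iff.mp hx
  linarith

section

variable {F : Type*} [NormedAddCommGroup F] [NormedSpace ℝ F] [CompleteSpace F]

omit [CompleteSpace F] in
lemma IsTestFunction.integral_fderiv_smul_indicator {Ω : Set E3} {φ : E3 → ℝ}
    (hφ : IsTestFunction Ω φ) (f : E3 → F) (b : E3) :
    ∫ t, (fderiv ℝ φ t b) • Ω.indicator f t = ∫ t, (fderiv ℝ φ t b) • f t := by
  congr 1
  ext1 t
  by_cases ht : t ∈ Ω
  · rw [indicator_of_mem ht]
  · have : fderiv ℝ φ t = 0 := image_eq_zero_of_notMem_tsupport fun h =>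
      ht (hφ.support (tsupport_fderiv_subset ℝ h))
    rw [this]; simp

omit [CompleteSpace F] in
lemma IsTestFunction.integral_smul_indicator {Ω : Set E3} {φ : E3 → ℝ}
    (hφ : IsTestFunction Ω φ) (f : E3 → F) :
    ∫ t, φ t • Ω.indicator f t = ∫ t, φ t • f t := by
  congr 1
  ext1 t
  by_cases ht : t ∈ Ω
  · rw [indicator_of_mem ht]
  · have : φ t = 0 := image_eq_zero_of_notMem_tsupport fun h => ht (hφ.support h)
    rw [this]; simp

omit [NormedSpace ℝ F] [CompleteSpace F] in
lemma locallyIntegrable_indicator_ball {f : E3 → F} (hi : IntegrableOn f (Metric.ball 0 1)) :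
    LocallyIntegrable ((Metric.ball 0 1).indicator f) :=
  (hi.integrable_indicator measurableSet_ball).locallyIntegrable

/-- Extension by zero destroys the weak derivative only across the boundary sphere; at points
farther from it than the mollification radius the kernel is a test function of the ball. -/
lemma fderiv_mollify_indicator {f : E3 → F} {Df : E3 → E3 →L[ℝ] F}
    (hf : HasWeakDifferential (Metric.ball 0 1) f Df) (hi : IntegrableOn f (Metric.ball 0 1))
    {n : ℕ} {x : E3} (hx : ‖x‖ + (shrinkingBump n).rOut < 1) (b : E3) :
    fderiv ℝ (mollify n ((Metric.ball 0 1).indicator f)) x b =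
      mollify n ((Metric.ball 0 1).indicator fun t => Df t b) x := by
  have hφ := isTestFunction_mollifier_sub hx
  rw [fderiv_mollify_apply (locallyIntegrable_indicator_ball hi),
    hφ.integral_fderiv_smul_indicator, hf.integral_eq _ hφ, neg_neg, mollify_apply,
    hφ.integral_smul_indicator]

end

/-- Only the antisymmetric part of the differential of η is assumed to exist weakly, so the two
partial terms must be combined before the hypothesis can be used. -/
lemma fderiv_mollify_extDeriv {η : E3 → NormedCLM E3 ℝ} {β : E3 → E3 → E3 → ℝ}
    (hη : HasWeakExtDeriv (Metric.ball 0 1) η β) (hi : IntegrableOn η (Metric.ball 0 1))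
    {n : ℕ} {x : E3} (hx : ‖x‖ + (shrinkingBump n).rOut < 1) (a b : E3) :
    fderiv ℝ (mollify n ((Metric.ball 0 1).indicator η)) x a b -
      fderiv ℝ (mollify n ((Metric.ball 0 1).indicator η)) x b a =
      mollify n ((Metric.ball 0 1).indicator fun t => β t a b) x := by
  have hφ := isTestFunction_mollifier_sub hx
  have hl := locallyIntegrable_indicator_ball (F := NormedCLM E3 ℝ) hi
  have key : ∀ c d : E3, Integrable (fun t => fderiv ℝ (fun t => mollifier n (x - t)) t c *
      (Metric.ball 0 1).indicator η t d) ∧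
      fderiv ℝ (mollify n ((Metric.ball 0 1).indicator η)) x c d =
      - ∫ t, fderiv ℝ (fun t => mollifier n (x - t)) t c * (Metric.ball 0 1).indicator η t d := by
    intro c d
    have hint : Integrable fun t => (fderiv ℝ (fun t => mollifier n (x - t)) t c) •
        (Metric.ball 0 1).indicator η t :=
      hl.integrable_smul_left_of_hasCompactSupport
        ((hφ.smooth.continuous_fderiv (by simp)).clm_apply continuous_const)
        (hφ.compact.fderiv_apply ℝ c)
    refine ⟨hint.apply_continuousLinearMap d, ?_⟩
    rw [fderiv_mollify_apply hl, neg_apply, ContinuousLinearMap.integral_apply hint]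
    rfl
  rw [(key a b).2, (key b a).2, mollify_apply, hφ.integral_smul_indicator]
  have h2 := hη.integral_eq _ hφ a b
  simp only [smul_eq_mul]
  have h3 := (integral_sub (key a b).1 (key b a).1)
  have h4 : ∀ t, fderiv ℝ (fun t => mollifier n (x - t)) t a * (Metric.ball 0 1).indicator η t b -
      fderiv ℝ (fun t => mollifier n (x - t)) t b * (Metric.ball 0 1).indicator η t a =
      fderiv ℝ (fun t => mollifier n (x - t)) t a * η t b -
      fderiv ℝ (fun t => mollifier n (x - t)) t b * η t a := by
    intro t
    by_cases ht : t ∈ Metric.ball (0 : E3) 1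
    · rw [indicator_of_mem ht]
    · have : fderiv ℝ (fun t => mollifier n (x - t)) t = 0 := image_eq_zero_of_notMem_tsupport
        fun h => ht (hφ.support (tsupport_fderiv_subset ℝ h))
      rw [this]; simp
  simp_rw [h4] at h3
  rw [h2] at h3
  linarith

/-! ### Pointwise algebra of the connection. -/

/-- The value of the connection form on a vector. -/
noncomputable def connVal (U p : ℍ) (s : ℝ) : ℍ :=
  (1 / 4 : ℝ) • (U * p - p * U) - (1 / 2 : ℝ) • (s • U)

/-- The defect of the section being parallel. -/
noncomputable def sectVal (U p : ℍ) (s : ℝ) : ℍ := p - (connVal U p s * U - U * connVal U p s)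

/-- The value of the curvature on two vectors. -/
noncomputable def curvVal (U p q : ℍ) (s t β : ℝ) : ℍ :=
  (1 / 2 : ℝ) • (p * q - q * p) - (1 / 2 : ℝ) • (β • U + t • p - s • q) -
    (connVal U p s * connVal U q t - connVal U q t * connVal U p s)

/-- The commutator is imaginary for any p, with no anticommutation. This matters for mollified data,
which lose the unit norm and the orthogonality but keep U imaginary. -/
lemma connVal_re {U : ℍ} (hU : U.re = 0) (p : ℍ) (s : ℝ) : (connVal U p s).re = 0 := by
  simp [connVal, hU]
  ring_nf

lemma connVal_eq {U p : ℍ} (hp : p * U = -(U * p)) (s : ℝ) :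
    connVal U p s = (1 / 2 : ℝ) • (U * (p - (s : ℍ))) := by
  rw [connVal, hp, mul_sub, ← Quaternion.coe_commutes, Quaternion.coe_mul_eq_smul]
  module

/-- The term along U commutes with U, and [½Up, U] = p because UpU = p and U² = −1. -/
lemma sectVal_eq_zero {U p : ℍ} (hU : U * U = -1) (hp : p * U = -(U * p)) (s : ℝ) :
    sectVal U p s = 0 := by
  have h1 : U * p * U = p := by rw [mul_assoc, hp, mul_neg, ← mul_assoc, hU]; simp
  have h2 : U * (U * p) = -p := by rw [← mul_assoc, hU]; simp
  simp only [sectVal, connVal, hp, sub_mul, mul_sub, smul_mul_assoc, mul_smul_comm, h1, h2, hU,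
    neg_mul, mul_neg]
  module

/-- For anticommuting p and q, the product of two connection values is ¼(pq − tp + sq − st). Its
antisymmetrisation cancels the terms linear in p and q, leaving ¼[p, q] − ½βU. -/
lemma curvVal_eq_zero {U p q : ℍ} (hU : U * U = -1) (hp : p * U = -(U * p))
    (hq : q * U = -(U * q)) {β : ℝ} (hpq : p * q - q * p = (2 * β) • U) (s t : ℝ) :
    curvVal U p q s t β = 0 := by
  have e : ∀ a b : ℍ, a * U = -(U * a) → b * U = -(U * b) → ∀ s t : ℝ,
      connVal U a s * connVal U b t = (1 / 4 : ℝ) • (a * b - t • a + s • b - (s * t) • 1) := by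
    intro a b ha hb s t
    have h0 : ∀ (c : ℍ) (r : ℝ), c * U = -(U * c) →
        connVal U c r = (1 / 2 : ℝ) • (U * c) - (1 / 2 : ℝ) • (r • U) := fun c r hc => by
      rw [connVal, hc]; module
    have h1 : U * a * (U * b) = a * b := by
      rw [← mul_assoc, mul_assoc U a U, ha, mul_neg, ← mul_assoc U U, hU]; simp
    have h2 : U * a * U = a := by rw [mul_assoc, ha, mul_neg, ← mul_assoc, hU]; simp
    have h3 : U * (U * b) = -b := by rw [← mul_assoc, hU]; simp
    rw [h0 a s ha, h0 b t hb]
    simp only [sub_mul, mul_sub, smul_mul_assoc, mul_smul_comm, h1, h2, h3, hU]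
    module
  rw [curvVal, e p q hp hq, e q p hq hp]
  have h4 : p * q = q * p + (2 * β) • U := by rw [← hpq]; abel
  rw [h4]
  module

lemma norm_connVal_le {U : ℍ} (hU : ‖U‖ ≤ 1) (p : ℍ) (s : ℝ) :
    ‖connVal U p s‖ ≤ 1 / 2 * (‖p‖ + |s|) := by
  have h1 : ‖U * p‖ ≤ ‖p‖ := by
    rw [norm_mul]; exact mul_le_of_le_one_left (norm_nonneg _) hU
  have h2 : ‖p * U‖ ≤ ‖p‖ := by
    rw [norm_mul]; exact mul_le_of_le_one_right (norm_nonneg _) hU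
  have h3 : ‖s • U‖ ≤ |s| := by
    rw [norm_smul]; exact mul_le_of_le_one_right (abs_nonneg _) hU
  rw [connVal]
  refine (norm_sub_le _ _).trans ?_
  rw [norm_smul, norm_smul, Real.norm_of_nonneg (by norm_num), Real.norm_of_nonneg (by norm_num)]
  have := norm_sub_le (U * p) (p * U)
  linarith

lemma norm_sectVal_le {U : ℍ} (hU : ‖U‖ ≤ 1) (p : ℍ) (s : ℝ) :
    ‖sectVal U p s‖ ≤ 2 * ‖p‖ + |s| := by
  have h := norm_connVal_le hU p s
  have h1 : ‖connVal U p s * U‖ ≤ ‖connVal U p s‖ := by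
    rw [norm_mul]; exact mul_le_of_le_one_right (norm_nonneg _) hU
  have h2 : ‖U * connVal U p s‖ ≤ ‖connVal U p s‖ := by
    rw [norm_mul]; exact mul_le_of_le_one_left (norm_nonneg _) hU
  have h3 := norm_sub_le p (connVal U p s * U - U * connVal U p s)
  have h4 := norm_sub_le (connVal U p s * U) (U * connVal U p s)
  rw [sectVal]
  linarith

/-- Quadratic growth in the first-order data and linear growth in β is what makes square integrable
differentials sufficient. The constant 3 is not optimised. -/
lemma norm_curvVal_le {U : ℍ} (hU : ‖U‖ ≤ 1) (p q : ℍ) (s t β : ℝ) :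
    ‖curvVal U p q s t β‖ ≤ 3 * (‖p‖ ^ 2 + ‖q‖ ^ 2 + s ^ 2 + t ^ 2 + |β|) := by
  have hp := norm_connVal_le hU p s
  have hq := norm_connVal_le hU q t
  have h1 : ‖connVal U p s‖ * ‖connVal U q t‖ ≤ 1 / 2 * (‖p‖ + |s|) * (1 / 2 * (‖q‖ + |t|)) := by
    gcongr
  have h2 : ‖β • U + t • p - s • q‖ ≤ |β| + |t| * ‖p‖ + |s| * ‖q‖ := by
    refine (norm_sub_le _ _).trans ?_
    refine add_le_add ((norm_add_le _ _).trans (add_le_add ?_ (norm_smul _ _).le))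
      (norm_smul _ _).le
    rw [norm_smul]; exact mul_le_of_le_one_right (abs_nonneg _) hU
  have h3 : ‖p * q - q * p‖ ≤ 2 * (‖p‖ * ‖q‖) := by
    refine (norm_sub_le _ _).trans (le_of_eq ?_)
    rw [norm_mul, norm_mul]; ring
  have h4 : ‖connVal U p s * connVal U q t - connVal U q t * connVal U p s‖ ≤
      2 * (‖connVal U p s‖ * ‖connVal U q t‖) := by
    refine (norm_sub_le _ _).trans (le_of_eq ?_)
    rw [norm_mul, norm_mul]; ring
  rw [curvVal]
  refine (norm_sub_le _ _).trans ((add_le_add_left (norm_sub_le _ _) _).trans ?_)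
  rw [norm_smul, norm_smul, Real.norm_of_nonneg (by norm_num)]
  rw [← sq_abs s, ← sq_abs t]
  have := abs_nonneg β
  nlinarith [sq_nonneg (‖p‖ - ‖q‖), sq_nonneg (‖p‖ - |t|), sq_nonneg (‖q‖ - |s|),
    sq_nonneg (|s| - |t|), sq_nonneg (‖p‖ - |s|), sq_nonneg (‖q‖ - |t|), norm_nonneg p,
    norm_nonneg q, abs_nonneg s, abs_nonneg t, sq_nonneg ‖p‖, sq_nonneg ‖q‖, sq_nonneg |s|,
    sq_nonneg |t|]

/-! ### The connection form of smooth data and its curvature. -/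

/-- The connection form determined by a map, its differential and a one-form. -/
noncomputable def connForm (U : ℍ) (L : QForm) (l : NormedCLM E3 ℝ) : QForm :=
  (1 / 4 : ℝ) • ((ContinuousLinearMap.mul ℝ ℍ U) ∘L L -
    ((ContinuousLinearMap.mul ℝ ℍ).flip U) ∘L L) - (1 / 2 : ℝ) • l.smulRight U

@[simp] lemma connForm_apply (U : ℍ) (L : QForm) (l : NormedCLM E3 ℝ) (b : E3) :
    connForm U L l b = connVal U (L b) (l b) := by
  simp [connForm, connVal]

lemma continuous_connForm :
    Continuous fun z : ℍ × QForm × NormedCLM E3 ℝ => connForm z.1 z.2.1 z.2.2 := by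
  have : ContDiff ℝ 1 fun z : ℍ × QForm × NormedCLM E3 ℝ => connForm z.1 z.2.1 z.2.2 := by
    unfold connForm
    fun_prop
  exact this.continuous

lemma ContDiff.connForm {n : ℕ∞ω} {U : E3 → ℍ} {L : E3 → QForm} {l : E3 → NormedCLM E3 ℝ}
    (hU : ContDiff ℝ n U) (hL : ContDiff ℝ n L) (hl : ContDiff ℝ n l) :
    ContDiff ℝ n fun x => connForm (U x) (L x) (l x) := by
  unfold _root_.connForm
  fun_prop

lemma norm_connForm_le {U : ℍ} (hU : ‖U‖ ≤ 1) (L : QForm) (l : NormedCLM E3 ℝ) :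
    ‖connForm U L l‖ ≤ ‖L‖ + ‖l‖ := by
  refine ContinuousLinearMap.opNorm_le_bound _ (by positivity) fun b => ?_
  rw [connForm_apply]
  refine (norm_connVal_le hU _ _).trans ?_
  have h1 := L.le_opNorm b
  have h2 := l.le_opNorm b
  rw [Real.norm_eq_abs] at h2
  have := norm_nonneg (L b)
  have := abs_nonneg (l b)
  linarith

/-- The second derivatives of U cancel by symmetry, and the first derivatives of η enter only
through its exterior derivative. The curvature is therefore a continuous function of quantities that
converge under mollification. -/
lemma curvature_connForm {U : E3 → ℍ} (hU : ContDiff ℝ ∞ U) {η : E3 → NormedCLM E3 ℝ}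
    (hη : ContDiff ℝ ∞ η) (x c b : E3) :
    curvature (fun y => connForm (U y) (fderiv ℝ U y) (η y)) x c b =
      curvVal (U x) (fderiv ℝ U x c) (fderiv ℝ U x b) (η x c) (η x b)
        (fderiv ℝ η x c b - fderiv ℝ η x b c) := by
  have hdU : ContDiff ℝ ∞ (fderiv ℝ U) := hU.fderiv_right (by simp)
  have hA : ContDiff ℝ ∞ (fun y => connForm (U y) (fderiv ℝ U y) (η y)) := hU.connForm hdU hη
  have hsymm : fderiv ℝ (fderiv ℝ U) x c b = fderiv ℝ (fderiv ℝ U) x b c :=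
    (hU.contDiffAt.isSymmSndFDerivAt (by
      rw [minSmoothness_of_isRCLikeNormedField]; exact WithTop.coe_le_coe.mpr le_top)).eq c b
  have key : ∀ c b : E3, fderiv ℝ (fun y => connForm (U y) (fderiv ℝ U y) (η y)) x c b =
      (1 / 4 : ℝ) • (fderiv ℝ U x c * fderiv ℝ U x b + U x * fderiv ℝ (fderiv ℝ U) x c b -
        (fderiv ℝ (fderiv ℝ U) x c b * U x + fderiv ℝ U x b * fderiv ℝ U x c)) -
      (1 / 2 : ℝ) • (fderiv ℝ η x c b • U x + η x b • fderiv ℝ U x c) := by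
    intro c b
    have h1 : HasFDerivAt U (fderiv ℝ U x) x := (hU.differentiable (by simp) x).hasFDerivAt
    have h2 := ((hdU.differentiable (by simp) x).hasFDerivAt).clm_apply (hasFDerivAt_const b x)
    have h3 := ((hη.differentiable (by simp) x).hasFDerivAt).clm_apply (hasFDerivAt_const b x)
    have h4 := ((hA.differentiable (by simp) x).hasFDerivAt).clm_apply (hasFDerivAt_const b x)
    have h5 := (((h1.mul' h2).sub (h2.mul' h1)).const_smul (1 / 4 : ℝ)).sub
      ((h3.smul h1).const_smul (1 / 2 : ℝ))
    have h6 := congrArg (fun L : E3 →L[ℝ] ℍ => L c) (h4.unique (h5.congr_of_eventuallyEq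
      (Eventually.of_forall fun y => by simp [connVal])))
    simp at h6
    rw [h6]
    simp only [smul_sub, smul_add, one_div]
    abel
  rw [curvature, key, key, connForm_apply, connForm_apply, hsymm, curvVal]
  module

lemma continuous_connVal : Continuous fun z : ℍ × ℍ × ℝ => connVal z.1 z.2.1 z.2.2 := by
  unfold connVal; fun_prop

lemma continuous_sectVal : Continuous fun z : ℍ × ℍ × ℝ => sectVal z.1 z.2.1 z.2.2 := by
  have := continuous_connVal
  unfold sectVal; fun_prop

lemma continuous_curvVal : Continuous fun z : ℍ × ℍ × ℍ × ℝ × ℝ × ℝ =>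
    curvVal z.1 z.2.1 z.2.2.1 z.2.2.2.1 z.2.2.2.2.1 z.2.2.2.2.2 := by
  unfold curvVal connVal; fun_prop

/-- The standard basis of three-space. -/
noncomputable def stdVec (i : Fin 3) : E3 := EuclideanSpace.single i 1

lemma norm_stdVec (i : Fin 3) : ‖stdVec i‖ = 1 := by simp [stdVec]

lemma sum_smul_stdVec (b : E3) : ∑ i, b i • stdVec i = b := by
  ext j
  fin_cases j <;> simp [stdVec, Fin.sum_univ_three]

/-- Reduces estimates to basis vectors, so that only finitely many scalar functions need to be
mollified and shown to converge. -/
lemma norm_apply_le_sum {F : Type*} [NormedAddCommGroup F] [NormedSpace ℝ F] (L : E3 →ₗ[ℝ] F)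
    (b : E3) : ‖L b‖ ≤ (∑ i, ‖L (stdVec i)‖) * ‖b‖ := by
  conv_lhs => rw [← sum_smul_stdVec b]
  rw [map_sum, Finset.sum_mul]
  refine (norm_sum_le _ _).trans (Finset.sum_le_sum fun i _ => ?_)
  rw [map_smul, norm_smul, mul_comm]
  gcongr
  exact PiLp.norm_apply_le b i

/-- The linear map `b ↦ curvature A x c b`. -/
noncomputable def curvatureRight (A : E3 → QForm) (x c : E3) : E3 →ₗ[ℝ] ℍ where
  toFun := curvature A x c
  map_add' a b := by simp only [curvature, map_add, add_apply]; noncomm_ring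
  map_smul' r b := by
    simp only [curvature, map_smul, smul_apply, mul_smul_comm,
      smul_mul_assoc, RingHom.id_apply, smul_sub]

/-- The linear map `c ↦ curvature A x c b`. -/
noncomputable def curvatureLeft (A : E3 → QForm) (x b : E3) : E3 →ₗ[ℝ] ℍ where
  toFun c := curvature A x c b
  map_add' a c := by simp only [curvature, map_add, add_apply]; noncomm_ring
  map_smul' r c := by
    simp only [curvature, map_smul, smul_apply, mul_smul_comm,
      smul_mul_assoc, RingHom.id_apply, smul_sub]

lemma norm_curvature_le (A : E3 → QForm) (x c b : E3) :
    ‖curvature A x c b‖ ≤ (∑ i, ∑ j, ‖curvature A x (stdVec i) (stdVec j)‖) * ‖c‖ * ‖b‖ := by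
  calc ‖curvature A x c b‖ ≤ (∑ j, ‖curvature A x c (stdVec j)‖) * ‖b‖ :=
        norm_apply_le_sum (curvatureRight A x c) b
    _ ≤ (∑ j, (∑ i, ‖curvature A x (stdVec i) (stdVec j)‖) * ‖c‖) * ‖b‖ := by
        gcongr with j
        exact norm_apply_le_sum (curvatureLeft A x (stdVec j)) c
    _ = _ := by rw [← Finset.sum_mul, Finset.sum_comm]

/-- The linear map `b ↦ sectVal U (L b) (l b)`. -/
noncomputable def sectLin (U : ℍ) (L : QForm) (l : NormedCLM E3 ℝ) : E3 →ₗ[ℝ] ℍ where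
  toFun b := sectVal U (L b) (l b)
  map_add' a b := by
    have h := map_add (connForm U L l) a b
    simp only [connForm_apply] at h
    simp only [sectVal, h]
    simp only [map_add]
    noncomm_ring
  map_smul' r b := by
    have h := map_smul (connForm U L l) r b
    simp only [connForm_apply] at h
    simp only [sectVal, h]
    simp only [map_smul, mul_smul_comm, smul_mul_assoc, smul_sub, RingHom.id_apply]

lemma norm_sectVal_le_sum (U : ℍ) (L : QForm) (l : NormedCLM E3 ℝ) (b : E3) :
    ‖sectVal U (L b) (l b)‖ ≤ (∑ i, ‖sectVal U (L (stdVec i)) (l (stdVec i))‖) * ‖b‖ :=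
  norm_apply_le_sum (sectLin U L l) b

lemma sq_norm_mollify_indicator_le {F : Type*} [NormedAddCommGroup F] [NormedSpace ℝ F]
    {f : E3 → F} (hf : IntegrableOn f (Metric.ball 0 1)) {g : E3 → ℝ}
    (hg : IntegrableOn g (Metric.ball 0 1)) (h : ∀ x, ‖f x‖ ^ 2 ≤ g x) (n : ℕ) (x : E3) :
    ‖mollify n ((Metric.ball 0 1).indicator f) x‖ ^ 2 ≤
      mollify n ((Metric.ball 0 1).indicator g) x := by
  have hl := locallyIntegrable_indicator_ball hf
  have hl2 := locallyIntegrable_indicator_ball hg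
  have hle : ∀ x, ‖(Metric.ball 0 1).indicator f x‖ ^ 2 ≤ (Metric.ball 0 1).indicator g x := by
    intro x
    by_cases hx : x ∈ Metric.ball (0 : E3) 1
    · simpa [indicator_of_mem hx] using h x
    · simp [indicator_of_notMem hx]
  have hsq : LocallyIntegrable fun x => ‖(Metric.ball 0 1).indicator f x‖ ^ 2 :=
    hl2.mono (hl.aestronglyMeasurable.norm.pow 2) (ae_of_all _ fun x => by
      rw [Real.norm_of_nonneg (by positivity)]
      exact (hle x).trans (le_abs_self _))
  calc _ ≤ mollify n (fun t => ‖(Metric.ball 0 1).indicator f t‖) x ^ 2 := by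
        gcongr; exact norm_mollify_le n x
    _ ≤ mollify n (fun t => ‖(Metric.ball 0 1).indicator f t‖ ^ 2) x :=
        sq_mollify_le (fun x => (hl x).norm) hsq n x
    _ ≤ _ := mollify_mono hsq hl2 (ae_of_all _ hle) n x

lemma mollify_indicator_clm {F F' : Type*} [NormedAddCommGroup F] [NormedSpace ℝ F]
    [NormedAddCommGroup F'] [NormedSpace ℝ F'] [CompleteSpace F] [CompleteSpace F']
    {f : E3 → F} (hf : IntegrableOn f (Metric.ball 0 1)) (L : F →L[ℝ] F') (n : ℕ) (x : E3) :
    mollify n ((Metric.ball 0 1).indicator fun t => L (f t)) x =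
      L (mollify n ((Metric.ball 0 1).indicator f) x) := by
  rw [← mollify_clm (locallyIntegrable_indicator_ball hf)]
  congr 1
  ext1 t
  by_cases ht : t ∈ Metric.ball (0 : E3) 1 <;> simp [ht]

lemma fderiv_mollify_indicator_eq {F : Type*} [NormedAddCommGroup F] [NormedSpace ℝ F]
    [CompleteSpace F] {f : E3 → F} {Df : E3 → NormedCLM E3 F}
    (hf : HasWeakDifferential (Metric.ball 0 1) f Df) (hi : IntegrableOn f (Metric.ball 0 1))
    (hDi : IntegrableOn Df (Metric.ball 0 1)) {n : ℕ} {x : E3}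
    (hx : ‖x‖ + (shrinkingBump n).rOut < 1) :
    fderiv ℝ (mollify n ((Metric.ball 0 1).indicator f)) x =
      mollify n ((Metric.ball 0 1).indicator Df) x := by
  ext1 b
  rw [fderiv_mollify_indicator hf hi hx]
  exact mollify_indicator_clm (F := NormedCLM E3 F) hDi (ContinuousLinearMap.apply ℝ F b) n x

lemma ae_tendsto_mollify_indicator {F : Type*} [NormedAddCommGroup F] [NormedSpace ℝ F]
    [CompleteSpace F] {f : E3 → F} (hf : IntegrableOn f (Metric.ball 0 1)) {r : ℝ} (hr : r ≤ 1) :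
    ∀ᵐ x ∂(volume.restrict (Metric.ball (0 : E3) r)),
      Tendsto (fun n => mollify n ((Metric.ball 0 1).indicator f) x) atTop (𝓝 (f x)) := by
  filter_upwards [ae_restrict_of_ae (ae_tendsto_mollify (locallyIntegrable_indicator_ball hf)),
    ae_restrict_mem measurableSet_ball] with x hx hxr
  rwa [indicator_of_mem (Metric.ball_subset_ball hr hxr)] at hx

/-! ### Approximate gauges from small curvature. -/

/-- A bound for the curvature of the connection form of a smooth map and a smooth one-form. -/
noncomputable def curvBound (U : E3 → ℍ) (η : E3 → NormedCLM E3 ℝ) (x : E3) : ℝ :=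
  ∑ i, ∑ j, ‖curvVal (U x) (fderiv ℝ U x (stdVec i)) (fderiv ℝ U x (stdVec j)) (η x (stdVec i))
    (η x (stdVec j)) (fderiv ℝ η x (stdVec i) (stdVec j) - fderiv ℝ η x (stdVec j) (stdVec i))‖

/-- A bound for the covariant derivative of a smooth map with respect to its connection form. -/
noncomputable def sectBound (U : E3 → ℍ) (η : E3 → NormedCLM E3 ℝ) (x : E3) : ℝ :=
  ∑ i, ‖sectVal (U x) (fderiv ℝ U x (stdVec i)) (η x (stdVec i))‖

lemma continuous_curvBound {U : E3 → ℍ} {η : E3 → NormedCLM E3 ℝ} (hU : ContDiff ℝ ∞ U)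
    (hη : ContDiff ℝ ∞ η) : Continuous (curvBound U η) := by
  have h1 := hU.continuous_fderiv (by simp)
  have h2 := hη.continuous_fderiv (by simp)
  have h3 := hU.continuous
  have h4 := hη.continuous
  have h5 : ∀ i j, Continuous fun x => fderiv ℝ η x (stdVec i) (stdVec j) := fun i j =>
    (h2.clm_apply continuous_const).clm_apply continuous_const
  refine continuous_finsetSum _ fun i _ => continuous_finsetSum _ fun j _ =>
    (continuous_curvVal.comp (h3.prodMk ((h1.clm_apply continuous_const).prodMk
      ((h1.clm_apply continuous_const).prodMk ((h4.clm_apply continuous_const).prodMk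
      ((h4.clm_apply continuous_const).prodMk ((h5 i j).sub (h5 j i)))))))).norm

lemma continuous_sectBound {U : E3 → ℍ} {η : E3 → NormedCLM E3 ℝ} (hU : ContDiff ℝ ∞ U)
    (hη : ContDiff ℝ ∞ η) : Continuous (sectBound U η) := by
  have h1 := hU.continuous_fderiv (by simp)
  exact continuous_finsetSum _ fun i _ => (continuous_sectVal.comp (hU.continuous.prodMk
    ((h1.clm_apply continuous_const).prodMk (hη.continuous.clm_apply continuous_const)))).norm

lemma curvBound_nonneg (U : E3 → ℍ) (η : E3 → NormedCLM E3 ℝ) (x : E3) : 0 ≤ curvBound U η x :=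
  Finset.sum_nonneg fun _ _ => Finset.sum_nonneg fun _ _ => norm_nonneg _

lemma sectBound_nonneg (U : E3 → ℍ) (η : E3 → NormedCLM E3 ℝ) (x : E3) : 0 ≤ sectBound U η x :=
  Finset.sum_nonneg fun _ _ => norm_nonneg _

/-- Radial gauge from a well chosen base point. The 17 is 16 for the averaged segment integrals of
the curvature plus 1 for the defect of the section. -/
lemma nonempty_approxGauge_of_curvature_le {A : E3 → QForm} {U : E3 → ℍ} {DU : E3 → QForm}
    (hA : ContDiff ℝ 1 A) (him : ∀ x b, (A x b).re = 0) (hn : ∀ x, ‖U x‖ ≤ 1)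
    (hU : ∀ x, HasFDerivAt U (DU x) x) {K S : E3 → ℝ} (hK : Continuous K) (hS : Continuous S)
    (hK0 : ∀ x, 0 ≤ K x) (hS0 : ∀ x, 0 ≤ S x)
    (hAK : ∀ x c b, ‖curvature A x c b‖ ≤ K x * ‖c‖ * ‖b‖)
    (hAS : ∀ x b, ‖DU x b - (A x b * U x - U x * A x b)‖ ≤ S x * ‖b‖)
    {A₀ : E3 → QForm} {U₀ : E3 → ℍ} {r : ℝ} (hr0 : 0 < r) (hr1 : r ≤ 1) {δ ε : ℝ≥0∞}
    (hε : 17 * ε ≤ δ)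
    (h1 : ∫⁻ x in Metric.ball 0 r, ENNReal.ofReal (K x) ≤ ε)
    (h2 : ∫⁻ x in Metric.ball 0 r, ENNReal.ofReal (S x) ≤ ε)
    (h3 : ∫⁻ x in Metric.ball 0 r, ‖A x - A₀ x‖ₑ ≤ δ)
    (h4 : ∫⁻ x in Metric.ball 0 r, ‖U x - U₀ x‖ₑ ≤ δ) : Nonempty (ApproxGauge A₀ U₀ r δ) := by
  obtain ⟨y, -, hy⟩ := exists_lintegral_segmentIntegral_le hK hK0 hr0 hr1
  obtain ⟨V, DV, hV1, hV, hDV⟩ := exists_radial_gauge hA him hK hAK y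
  have hI : Continuous (segmentIntegral K y) :=
    (continuous_segmentIntegral hK).comp (continuous_const.prodMk continuous_id)
  have hI0 := segmentIntegral_nonneg hK0 y
  refine ⟨{ conn := A
            sect := U
            sectDeriv := DU
            gauge := V
            gaugeDeriv := DV
            err := fun x => segmentIntegral K y x + S x
            continuous_conn := hA.continuous
            conn_re := him
            norm_sect_le := hn
            hasFDerivAt_sect := hU
            norm_gauge := hV1
            hasFDerivAt_gauge := hV
            continuous_err := hI.add hS
            err_nonneg := fun x => add_nonneg (hI0 x) (hS0 x)
            norm_gaugeDeriv_sub_le := fun x b => (hDV x b).trans ?_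
            norm_sectDeriv_sub_le := fun x b => (hAS x b).trans ?_
            lintegral_err_le := ?_
            lintegral_conn_le := h3
            lintegral_sect_le := h4 }⟩
  · gcongr
    exact le_add_of_nonneg_right (hS0 x)
  · gcongr
    exact le_add_of_nonneg_left (hI0 x)
  · simp_rw [fun x => ENNReal.ofReal_add (hI0 x) (hS0 x)]
    rw [lintegral_add_left hI.measurable.ennreal_ofReal]
    calc _ ≤ 16 * ε + ε := add_le_add (hy.trans (by gcongr)) h2
      _ = 17 * ε := by ring
      _ ≤ δ := hε

lemma nonempty_approxGauge_of_smooth {U : E3 → ℍ} {η : E3 → NormedCLM E3 ℝ}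
    (hU : ContDiff ℝ ∞ U) (hη : ContDiff ℝ ∞ η) (hre : ∀ x, (U x).re = 0) (hn : ∀ x, ‖U x‖ ≤ 1)
    {A₀ : E3 → QForm} {U₀ : E3 → ℍ} {r : ℝ} (hr0 : 0 < r) (hr1 : r ≤ 1) {δ ε : ℝ≥0∞}
    (hε : 17 * ε ≤ δ)
    (h1 : ∫⁻ x in Metric.ball 0 r, ENNReal.ofReal (curvBound U η x) ≤ ε)
    (h2 : ∫⁻ x in Metric.ball 0 r, ENNReal.ofReal (sectBound U η x) ≤ ε)
    (h3 : ∫⁻ x in Metric.ball 0 r, ‖connForm (U x) (fderiv ℝ U x) (η x) - A₀ x‖ₑ ≤ δ)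
    (h4 : ∫⁻ x in Metric.ball 0 r, ‖U x - U₀ x‖ₑ ≤ δ) : Nonempty (ApproxGauge A₀ U₀ r δ) := by
  have hA : ContDiff ℝ ∞ (fun y => connForm (U y) (fderiv ℝ U y) (η y)) :=
    hU.connForm (hU.fderiv_right (by simp)) hη
  refine nonempty_approxGauge_of_curvature_le (hA.of_le (by simp))
    (fun x b => by rw [connForm_apply, connVal_re (hre x)]) hn
    (fun x => (hU.differentiable (by simp) x).hasFDerivAt)
    (continuous_curvBound hU hη) (continuous_sectBound hU hη) (curvBound_nonneg U η)
    (sectBound_nonneg U η) (fun x c b => ?_) (fun x b => ?_) hr0 hr1 hε h1 h2 h3 h4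
  · refine (norm_curvature_le _ x c b).trans (le_of_eq ?_)
    simp only [curvature_connForm hU hη]
    rfl
  · have := norm_sectVal_le_sum (U x) (fderiv ℝ U x) (η x) b
    rw [sectVal] at this
    rw [connForm_apply]
    exact this

/-! ### Weakly flat data and their mollifications. -/

/-- A map into the imaginary unit quaternions and a one-form whose weak exterior derivative is the
pullback of the area form. -/
structure FlatData (U : E3 → ℍ) (DU : E3 → QForm) (η : E3 → NormedCLM E3 ℝ)
    (β : E3 → E3 → E3 → ℝ) : Prop where
  weakDiff : HasWeakDifferential (Metric.ball 0 1) U DU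
  weakExtDeriv : HasWeakExtDeriv (Metric.ball 0 1) η β
  integrableOn : IntegrableOn U (Metric.ball 0 1)
  integrableOn_diff : IntegrableOn DU (Metric.ball 0 1)
  integrableOn_form : IntegrableOn η (Metric.ball 0 1)
  integrableOn_sq_diff : IntegrableOn (fun x => ‖DU x‖ ^ 2) (Metric.ball 0 1)
  integrableOn_sq_form : IntegrableOn (fun x => ‖η x‖ ^ 2) (Metric.ball 0 1)
  re_eq_zero : ∀ x, (U x).re = 0
  norm_eq_one : ∀ᵐ x ∂(volume.restrict (Metric.ball 0 1)), ‖U x‖ = 1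
  anticomm : ∀ᵐ x ∂(volume.restrict (Metric.ball 0 1)), ∀ b, DU x b * U x = -(U x * DU x b)
  comm : ∀ᵐ x ∂(volume.restrict (Metric.ball 0 1)), ∀ c b,
    DU x c * DU x b - DU x b * DU x c = (2 * β x c b) • U x

namespace FlatData

variable {U : E3 → ℍ} {DU : E3 → QForm} {η : E3 → NormedCLM E3 ℝ} {β : E3 → E3 → E3 → ℝ}

/-- The energy density. -/
noncomputable def density (DU : E3 → QForm) (η : E3 → NormedCLM E3 ℝ) : E3 → ℝ :=
  (Metric.ball 0 1).indicator fun x => ‖DU x‖ ^ 2 + ‖η x‖ ^ 2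

lemma integrableOn_density (h : FlatData U DU η β) :
    IntegrableOn (fun x => ‖DU x‖ ^ 2 + ‖η x‖ ^ 2) (Metric.ball 0 1) :=
  h.integrableOn_sq_diff.add h.integrableOn_sq_form

lemma density_nonneg (x : E3) : 0 ≤ density DU η x :=
  indicator_nonneg (fun _ _ => by positivity) x

/-- Norms in the commutator identity, with |U| = 1, give 2|β(c, b)| ≤ 2|∂_cU||∂_bU|; hence β is
integrable and controlled by the energy density. -/
lemma abs_form_le (h : FlatData U DU η β) : ∀ᵐ x ∂(volume.restrict (Metric.ball 0 1)), ∀ c b,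
    |β x c b| ≤ ‖DU x‖ ^ 2 * (‖c‖ * ‖b‖) := by
  filter_upwards [h.norm_eq_one, h.comm] with x h1 h2 c b
  have h3 := congrArg norm (h2 c b)
  rw [norm_smul, h1, mul_one, norm_mul, Real.norm_eq_abs, Real.norm_eq_abs, abs_two] at h3
  have h4 := norm_sub_le (DU x c * DU x b) (DU x b * DU x c)
  rw [norm_mul, norm_mul] at h4
  have h5 : ‖DU x c‖ * ‖DU x b‖ ≤ (‖DU x‖ * ‖c‖) * (‖DU x‖ * ‖b‖) := by
    gcongr <;> exact (DU x).le_opNorm _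
  nlinarith

lemma integrableOn_deriv_form (h : FlatData U DU η β) (c b : E3) :
    IntegrableOn (fun x => β x c b) (Metric.ball 0 1) := by
  refine Integrable.mono' (h.integrableOn_sq_diff.mul_const (‖c‖ * ‖b‖))
    (h.weakExtDeriv.locInt_deriv c b).aestronglyMeasurable ?_
  filter_upwards [h.abs_form_le] with x hx
  exact hx c b

lemma abs_mollify_form_le (h : FlatData U DU η β) (i j : Fin 3) (n : ℕ) (x : E3) :
    |mollify n ((Metric.ball 0 1).indicator fun t => β t (stdVec i) (stdVec j)) x| ≤
      mollify n (density DU η) x := by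
  refine (norm_mollify_le n x).trans (mollify_mono (fun x =>
    (locallyIntegrable_indicator_ball (h.integrableOn_deriv_form _ _) x).norm)
    (locallyIntegrable_indicator_ball h.integrableOn_density) ?_ n x)
  have := (ae_restrict_iff' measurableSet_ball).mp h.abs_form_le
  filter_upwards [this] with x hx
  by_cases hxb : x ∈ Metric.ball (0 : E3) 1
  · have h3 := hx hxb (stdVec i) (stdVec j)
    rw [norm_stdVec, norm_stdVec, mul_one, mul_one] at h3
    rw [indicator_of_mem hxb, indicator_of_mem hxb, Real.norm_eq_abs]
    nlinarith [sq_nonneg ‖η x‖]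
  · rw [indicator_of_notMem hxb, indicator_of_notMem hxb, norm_zero]

end FlatData

lemma Filter.Tendsto.connForm {ι : Type*} {f : Filter ι} {U : ι → ℍ} {L : ι → QForm}
    {l : ι → NormedCLM E3 ℝ} {U₀ : ℍ} {L₀ : QForm} {l₀ : NormedCLM E3 ℝ}
    (hU : Tendsto U f (𝓝 U₀)) (hL : Tendsto L f (𝓝 L₀)) (hl : Tendsto l f (𝓝 l₀)) :
    Tendsto (fun t => connForm (U t) (L t) (l t)) f (𝓝 (connForm U₀ L₀ l₀)) := by
  have h := (continuous_connForm.tendsto (U₀, L₀, l₀)).comp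
    (hU.prodMk_nhds (hL.prodMk_nhds hl))
  simp only [Function.comp_def] at h
  exact h

lemma MeasureTheory.AEStronglyMeasurable.connForm {μ : Measure E3} {U : E3 → ℍ} {L : E3 → QForm}
    {l : E3 → NormedCLM E3 ℝ} (hU : AEStronglyMeasurable U μ) (hL : AEStronglyMeasurable L μ)
    (hl : AEStronglyMeasurable l μ) :
    AEStronglyMeasurable (fun t => connForm (U t) (L t) (l t)) μ := by
  have h := continuous_connForm.comp_aestronglyMeasurable (hU.prodMk (hL.prodMk hl))
  simp only at h
  exact h

namespace FlatData

variable {U : E3 → ℍ} {DU : E3 → QForm} {η : E3 → NormedCLM E3 ℝ} {β : E3 → E3 → E3 → ℝ}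

/-- The mollification of the restriction to the unit ball. -/
noncomputable def mollifyBall {F : Type*} [NormedAddCommGroup F] [NormedSpace ℝ F] (n : ℕ)
    (f : E3 → F) : E3 → F := mollify n ((Metric.ball 0 1).indicator f)

lemma contDiff_mollifyBall {F : Type*} [NormedAddCommGroup F] [NormedSpace ℝ F] {f : E3 → F}
    (hf : IntegrableOn f (Metric.ball 0 1)) (n : ℕ) : ContDiff ℝ ∞ (mollifyBall n f) :=
  contDiff_mollify (locallyIntegrable_indicator_ball hf) n

lemma integrable_density (h : FlatData U DU η β) : Integrable (density DU η) :=
  h.integrableOn_density.integrable_indicator measurableSet_ball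

lemma mollifyBall_re (h : FlatData U DU η β) (n : ℕ) (x : E3) : (mollifyBall n U x).re = 0 := by
  have h1 := mollify_indicator_clm h.integrableOn (innerSL ℝ (1 : ℍ)) n x
  have h2 : ∀ q : ℍ, innerSL ℝ (1 : ℍ) q = q.re := fun q => by
    simp [Quaternion.inner_def]
  simp only [h2, h.re_eq_zero] at h1
  rw [mollifyBall, ← h1, mollify_apply]
  simp

lemma norm_mollifyBall_le (h : FlatData U DU η β) (n : ℕ) (x : E3) : ‖mollifyBall n U x‖ ≤ 1 := by
  refine norm_mollify_le_one (locallyIntegrable_indicator_ball h.integrableOn) ?_ n x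
  filter_upwards [(ae_restrict_iff' measurableSet_ball).mp h.norm_eq_one] with x hx
  by_cases hxb : x ∈ Metric.ball (0 : E3) 1
  · rw [indicator_of_mem hxb, hx hxb]
  · rw [indicator_of_notMem hxb, norm_zero]; exact zero_le_one

lemma sq_norm_mollify_diff_le (h : FlatData U DU η β) (n : ℕ) (x : E3) :
    ‖mollifyBall n DU x‖ ^ 2 ≤ mollify n (density DU η) x :=
  sq_norm_mollify_indicator_le (F := QForm) h.integrableOn_diff h.integrableOn_density
    (fun _ => le_add_of_nonneg_right (sq_nonneg _)) n x

lemma sq_norm_mollify_form_le (h : FlatData U DU η β) (n : ℕ) (x : E3) :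
    ‖mollifyBall n η x‖ ^ 2 ≤ mollify n (density DU η) x :=
  sq_norm_mollify_indicator_le (F := NormedCLM E3 ℝ) h.integrableOn_form h.integrableOn_density
    (fun _ => le_add_of_nonneg_left (sq_nonneg _)) n x

/-- The derivatives of the mollifications are the mollifications of the weak derivatives. -/
lemma eventually_fderiv_eq (h : FlatData U DU η β) {r : ℝ} (hr : r < 1) :
    ∀ᶠ n in atTop, ∀ x ∈ Metric.ball (0 : E3) r,
      fderiv ℝ (mollifyBall n U) x = mollifyBall n DU x ∧
      ∀ c b, fderiv ℝ (mollifyBall n η) x c b - fderiv ℝ (mollifyBall n η) x b c =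
        mollifyBall n (fun t => β t c b) x := by
  filter_upwards [eventually_add_shrinkingBump_lt hr] with n hn x hx
  exact ⟨fderiv_mollify_indicator_eq h.weakDiff h.integrableOn h.integrableOn_diff (hn x hx),
    fderiv_mollify_extDeriv h.weakExtDeriv h.integrableOn_form (hn x hx)⟩

/-- Each of the five terms in `norm_curvVal_le` is at most the mollified density, by Jensen or by
the bound on β, so 135 = 9 · 3 · 5. -/
lemma eventually_curvBound_le (h : FlatData U DU η β) {r : ℝ} (hr : r < 1) :
    ∀ᶠ n in atTop, ∀ x ∈ Metric.ball (0 : E3) r,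
      curvBound (mollifyBall n U) (mollifyBall n η) x ≤ 135 * mollify n (density DU η) x := by
  filter_upwards [h.eventually_fderiv_eq hr] with n hn x hx
  obtain ⟨h1, h2⟩ := hn x hx
  have e1 := h.sq_norm_mollify_diff_le n x
  have e2 := h.sq_norm_mollify_form_le n x
  have e3 : ∀ i, ‖mollifyBall n DU x (stdVec i)‖ ^ 2 ≤ mollify n (density DU η) x := fun i =>
    (pow_le_pow_left₀ (norm_nonneg _) (ContinuousLinearMap.unit_le_opNorm _ _ (norm_stdVec i).le)
      2).trans e1
  have e4 : ∀ i, (mollifyBall n η x (stdVec i)) ^ 2 ≤ mollify n (density DU η) x := fun i => by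
    rw [← sq_abs, ← Real.norm_eq_abs]
    exact (pow_le_pow_left₀ (norm_nonneg _)
      (ContinuousLinearMap.unit_le_opNorm _ _ (norm_stdVec i).le) 2).trans e2
  have e5 : ∀ i j, ‖curvVal (mollifyBall n U x) (mollifyBall n DU x (stdVec i))
      (mollifyBall n DU x (stdVec j)) (mollifyBall n η x (stdVec i)) (mollifyBall n η x (stdVec j))
      (mollifyBall n (fun t => β t (stdVec i) (stdVec j)) x)‖ ≤
      15 * mollify n (density DU η) x := by
    intro i j
    have h5 : |mollifyBall n (fun t => β t (stdVec i) (stdVec j)) x| ≤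
      mollify n (density DU η) x := h.abs_mollify_form_le i j n x
    refine (norm_curvVal_le (h.norm_mollifyBall_le n x) _ _ _ _ _).trans ?_
    linarith [e3 i, e3 j, e4 i, e4 j]
  calc curvBound (mollifyBall n U) (mollifyBall n η) x
      ≤ ∑ _i : Fin 3, ∑ _j : Fin 3, 15 * mollify n (density DU η) x := by
        rw [curvBound, h1]
        simp only [h2]
        exact Finset.sum_le_sum fun i _ => Finset.sum_le_sum fun j _ => e5 i j
    _ = _ := by simp; ring

lemma eventually_sectBound_le (h : FlatData U DU η β) {r : ℝ} (hr : r < 1) :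
    ∀ᶠ n in atTop, ∀ x ∈ Metric.ball (0 : E3) r,
      sectBound (mollifyBall n U) (mollifyBall n η) x ≤
        9 * (1 + mollify n (density DU η) x) := by
  filter_upwards [h.eventually_fderiv_eq hr] with n hn x hx
  have e1 := h.sq_norm_mollify_diff_le n x
  have e2 := h.sq_norm_mollify_form_le n x
  have e5 : ∀ i, ‖sectVal (mollifyBall n U x) (mollifyBall n DU x (stdVec i))
      (mollifyBall n η x (stdVec i))‖ ≤ 3 * (1 + mollify n (density DU η) x) := by
    intro i
    have e3 : ‖mollifyBall n DU x (stdVec i)‖ ≤ ‖mollifyBall n DU x‖ :=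
      ContinuousLinearMap.unit_le_opNorm _ _ (norm_stdVec i).le
    have e4 : ‖mollifyBall n η x (stdVec i)‖ ≤ ‖mollifyBall n η x‖ :=
      ContinuousLinearMap.unit_le_opNorm _ _ (norm_stdVec i).le
    rw [Real.norm_eq_abs] at e4
    refine (norm_sectVal_le (h.norm_mollifyBall_le n x) _ _).trans ?_
    nlinarith [sq_nonneg (‖mollifyBall n DU x‖ - 1), sq_nonneg (‖mollifyBall n η x‖ - 1)]
  calc sectBound (mollifyBall n U) (mollifyBall n η) x
      ≤ ∑ _i : Fin 3, 3 * (1 + mollify n (density DU η) x) := by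
        rw [sectBound, (hn x hx).1]
        exact Finset.sum_le_sum fun i _ => e5 i
    _ = _ := by simp; ring

lemma ae_tendsto (h : FlatData U DU η β) {r : ℝ} (hr : r ≤ 1) :
    ∀ᵐ x ∂(volume.restrict (Metric.ball (0 : E3) r)),
      Tendsto (fun n => mollifyBall n U x) atTop (𝓝 (U x)) ∧
      Tendsto (fun n => mollifyBall n DU x) atTop (𝓝 (DU x)) ∧
      Tendsto (fun n => mollifyBall n η x) atTop (𝓝 (η x)) ∧
      ∀ i j, Tendsto (fun n => mollifyBall n (fun t => β t (stdVec i) (stdVec j)) x) atTop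
        (𝓝 (β x (stdVec i) (stdVec j))) := by
  have h4 : ∀ᵐ x ∂(volume.restrict (Metric.ball (0 : E3) r)), ∀ i j,
      Tendsto (fun n => mollifyBall n (fun t => β t (stdVec i) (stdVec j)) x) atTop
        (𝓝 (β x (stdVec i) (stdVec j))) := by
    rw [ae_all_iff]; intro i; rw [ae_all_iff]; intro j
    exact ae_tendsto_mollify_indicator (h.integrableOn_deriv_form _ _) hr
  filter_upwards [ae_tendsto_mollify_indicator h.integrableOn hr,
    ae_tendsto_mollify_indicator (F := QForm) h.integrableOn_diff hr,
    ae_tendsto_mollify_indicator (F := NormedCLM E3 ℝ) h.integrableOn_form hr, h4]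
    with x h1 h2 h3 h4
  exact ⟨h1, h2, h3, h4⟩

lemma ae_algebra (h : FlatData U DU η β) {r : ℝ} (hr : r ≤ 1) :
    ∀ᵐ x ∂(volume.restrict (Metric.ball (0 : E3) r)), U x * U x = -1 ∧
      (∀ b, DU x b * U x = -(U x * DU x b)) ∧
      ∀ c b, DU x c * DU x b - DU x b * DU x c = (2 * β x c b) • U x := by
  have hle := Metric.ball_subset_ball (x := (0 : E3)) hr
  filter_upwards [ae_restrict_of_ae_restrict_of_subset hle h.norm_eq_one,
    ae_restrict_of_ae_restrict_of_subset hle h.anticomm,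
    ae_restrict_of_ae_restrict_of_subset hle h.comm] with x h1 h2 h3
  refine ⟨?_, h2, h3⟩
  have h4 := star_mul_self_of_norm_one h1
  rw [star_eq_neg_of_re_eq_zero (h.re_eq_zero x), neg_mul] at h4
  rw [← h4, neg_neg]

/-- Almost everywhere the mollified data converge to the original ones, where the algebraic
curvature vanishes. -/
lemma ae_tendsto_curvBound (h : FlatData U DU η β) {r : ℝ} (hr : r < 1) :
    ∀ᵐ x ∂(volume.restrict (Metric.ball (0 : E3) r)),
      Tendsto (fun n => curvBound (mollifyBall n U) (mollifyBall n η) x) atTop (𝓝 0) := by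
  filter_upwards [h.ae_tendsto hr.le, h.ae_algebra hr.le, ae_restrict_mem measurableSet_ball]
    with x ⟨t1, t2, t3, t4⟩ ⟨a1, a2, a3⟩ hx
  have key : Tendsto (fun n => ∑ i, ∑ j, ‖curvVal (mollifyBall n U x)
      (mollifyBall n DU x (stdVec i)) (mollifyBall n DU x (stdVec j))
      (mollifyBall n η x (stdVec i)) (mollifyBall n η x (stdVec j))
      (mollifyBall n (fun t => β t (stdVec i) (stdVec j)) x)‖) atTop
      (𝓝 (∑ i, ∑ j, ‖curvVal (U x) (DU x (stdVec i)) (DU x (stdVec j)) (η x (stdVec i))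
        (η x (stdVec j)) (β x (stdVec i) (stdVec j))‖)) := by
    have t5 : ∀ i, Tendsto (fun n => mollifyBall n DU x (stdVec i)) atTop
      (𝓝 (DU x (stdVec i))) := fun i =>
      ((ContinuousLinearMap.apply ℝ ℍ (stdVec i)).continuous.tendsto _).comp t2
    have t6 : ∀ i, Tendsto (fun n => mollifyBall n η x (stdVec i)) atTop
      (𝓝 (η x (stdVec i))) := fun i =>
      ((ContinuousLinearMap.apply ℝ ℝ (stdVec i)).continuous.tendsto _).comp t3
    refine tendsto_finsetSum _ fun i _ => tendsto_finsetSum _ fun j _ => ?_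
    exact ((continuous_curvVal.tendsto (U x, DU x (stdVec i), DU x (stdVec j), η x (stdVec i),
      η x (stdVec j), β x (stdVec i) (stdVec j))).comp (t1.prodMk_nhds ((t5 i).prodMk_nhds
      ((t5 j).prodMk_nhds ((t6 i).prodMk_nhds ((t6 j).prodMk_nhds (t4 i j))))))).norm
  have hz : ∑ i, ∑ j, ‖curvVal (U x) (DU x (stdVec i)) (DU x (stdVec j)) (η x (stdVec i))
        (η x (stdVec j)) (β x (stdVec i) (stdVec j))‖ = 0 :=
    Finset.sum_eq_zero fun i _ => Finset.sum_eq_zero fun j _ => by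
      rw [curvVal_eq_zero a1 (a2 _) (a2 _) (a3 _ _), norm_zero]
  rw [hz] at key
  refine key.congr' ?_
  filter_upwards [h.eventually_fderiv_eq hr] with n hn
  rw [curvBound, (hn x hx).1]
  simp only [(hn x hx).2]

lemma ae_tendsto_sectBound (h : FlatData U DU η β) {r : ℝ} (hr : r < 1) :
    ∀ᵐ x ∂(volume.restrict (Metric.ball (0 : E3) r)),
      Tendsto (fun n => sectBound (mollifyBall n U) (mollifyBall n η) x) atTop (𝓝 0) := by
  filter_upwards [h.ae_tendsto hr.le, h.ae_algebra hr.le, ae_restrict_mem measurableSet_ball]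
    with x ⟨t1, t2, t3, t4⟩ ⟨a1, a2, a3⟩ hx
  have key : Tendsto (fun n => ∑ i, ‖sectVal (mollifyBall n U x)
      (mollifyBall n DU x (stdVec i)) (mollifyBall n η x (stdVec i))‖) atTop
      (𝓝 (∑ i, ‖sectVal (U x) (DU x (stdVec i)) (η x (stdVec i))‖)) := by
    have t5 : ∀ i, Tendsto (fun n => mollifyBall n DU x (stdVec i)) atTop
      (𝓝 (DU x (stdVec i))) := fun i =>
      ((ContinuousLinearMap.apply ℝ ℍ (stdVec i)).continuous.tendsto _).comp t2
    have t6 : ∀ i, Tendsto (fun n => mollifyBall n η x (stdVec i)) atTop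
      (𝓝 (η x (stdVec i))) := fun i =>
      ((ContinuousLinearMap.apply ℝ ℝ (stdVec i)).continuous.tendsto _).comp t3
    refine tendsto_finsetSum _ fun i _ => ?_
    exact ((continuous_sectVal.tendsto (U x, DU x (stdVec i), η x (stdVec i))).comp
      (t1.prodMk_nhds ((t5 i).prodMk_nhds (t6 i)))).norm
  have hz : ∑ i, ‖sectVal (U x) (DU x (stdVec i)) (η x (stdVec i))‖ = 0 :=
    Finset.sum_eq_zero fun i _ => by rw [sectVal_eq_zero a1 (a2 _), norm_zero]
  rw [hz] at key
  refine key.congr' ?_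
  filter_upwards [h.eventually_fderiv_eq hr] with n hn
  rw [sectBound, (hn x hx).1]

lemma ae_tendsto_connForm (h : FlatData U DU η β) {r : ℝ} (hr : r < 1) :
    ∀ᵐ x ∂(volume.restrict (Metric.ball (0 : E3) r)),
      Tendsto (fun n => ‖connForm (mollifyBall n U x) (fderiv ℝ (mollifyBall n U) x)
        (mollifyBall n η x) - connForm (U x) (DU x) (η x)‖) atTop (𝓝 0) := by
  filter_upwards [h.ae_tendsto hr.le, ae_restrict_mem measurableSet_ball]
    with x ⟨t1, t2, t3, t4⟩ hx
  have key := ((t1.connForm t2 t3).sub_const (connForm (U x) (DU x) (η x))).norm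
  rw [sub_self, norm_zero] at key
  refine key.congr' ?_
  filter_upwards [h.eventually_fderiv_eq hr] with n hn
  rw [(hn x hx).1]

lemma integrableOn_connForm (h : FlatData U DU η β) :
    IntegrableOn (fun x => connForm (U x) (DU x) (η x)) (Metric.ball 0 1) := by
  have h1 : Integrable (fun x => ‖DU x‖ + ‖η x‖) (volume.restrict (Metric.ball 0 1)) :=
    h.integrableOn_diff.norm.add h.integrableOn_form.norm
  refine Integrable.mono' h1 (h.integrableOn.aestronglyMeasurable.connForm
    h.integrableOn_diff.aestronglyMeasurable h.integrableOn_form.aestronglyMeasurable) ?_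
  filter_upwards [h.norm_eq_one] with x hx
  exact norm_connForm_le hx.le _ _

lemma eventually_connForm_sub_le (h : FlatData U DU η β) {r : ℝ} (hr : r < 1) :
    ∀ᶠ n in atTop, ∀ᵐ x ∂(volume.restrict (Metric.ball (0 : E3) r)),
      ‖connForm (mollifyBall n U x) (fderiv ℝ (mollifyBall n U) x)
        (mollifyBall n η x) - connForm (U x) (DU x) (η x)‖ ≤
      4 * (1 + mollify n (density DU η) x + density DU η x) := by
  filter_upwards [h.eventually_fderiv_eq hr] with n hn
  filter_upwards [ae_restrict_of_ae_restrict_of_subset (Metric.ball_subset_ball hr.le)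
    h.norm_eq_one, ae_restrict_mem measurableSet_ball] with x h1 hx
  have e1 := h.sq_norm_mollify_diff_le n x
  have e2 := h.sq_norm_mollify_form_le n x
  have e3 : density DU η x = ‖DU x‖ ^ 2 + ‖η x‖ ^ 2 :=
    indicator_of_mem (Metric.ball_subset_ball hr.le hx) _
  have e4 := norm_connForm_le (h.norm_mollifyBall_le n x) (mollifyBall n DU x) (mollifyBall n η x)
  have e5 := norm_connForm_le h1.le (DU x) (η x)
  rw [(hn x hx).1]
  refine (norm_sub_le _ _).trans ?_
  nlinarith [sq_nonneg (‖mollifyBall n DU x‖ - 1), sq_nonneg (‖mollifyBall n η x‖ - 1),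
    sq_nonneg (‖DU x‖ - 1), sq_nonneg (‖η x‖ - 1)]

lemma tendsto_lintegral_curvBound (h : FlatData U DU η β) {r : ℝ} (hr : r < 1) :
    Tendsto (fun n => ∫⁻ x in Metric.ball 0 r,
      ENNReal.ofReal (curvBound (mollifyBall n U) (mollifyBall n η) x)) atTop (𝓝 0) := by
  refine tendsto_lintegral_of_le_mollify h.integrable_density density_nonneg (C := 135)
    (by norm_num) (fun n => (continuous_curvBound (contDiff_mollifyBall h.integrableOn n)
      (contDiff_mollifyBall (F := NormedCLM E3 ℝ) h.integrableOn_form n)).aestronglyMeasurable) ?_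
      (h.ae_tendsto_curvBound hr)
  filter_upwards [h.eventually_curvBound_le hr] with n hn
  filter_upwards [ae_restrict_mem measurableSet_ball] with x hx
  have := density_nonneg (DU := DU) (η := η) x
  linarith [hn x hx]

lemma tendsto_lintegral_sectBound (h : FlatData U DU η β) {r : ℝ} (hr : r < 1) :
    Tendsto (fun n => ∫⁻ x in Metric.ball 0 r,
      ENNReal.ofReal (sectBound (mollifyBall n U) (mollifyBall n η) x)) atTop (𝓝 0) := by
  refine tendsto_lintegral_of_le_mollify h.integrable_density density_nonneg (C := 9)
    (by norm_num) (fun n => (continuous_sectBound (contDiff_mollifyBall h.integrableOn n)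
      (contDiff_mollifyBall (F := NormedCLM E3 ℝ) h.integrableOn_form n)).aestronglyMeasurable) ?_
      (h.ae_tendsto_sectBound hr)
  filter_upwards [h.eventually_sectBound_le hr] with n hn
  filter_upwards [ae_restrict_mem measurableSet_ball] with x hx
  have := density_nonneg (DU := DU) (η := η) x
  linarith [hn x hx]

lemma tendsto_lintegral_connForm (h : FlatData U DU η β) {r : ℝ} (hr : r < 1) :
    Tendsto (fun n => ∫⁻ x in Metric.ball 0 r,
      ‖connForm (mollifyBall n U x) (fderiv ℝ (mollifyBall n U) x)
        (mollifyBall n η x) - connForm (U x) (DU x) (η x)‖ₑ) atTop (𝓝 0) := by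
  simp_rw [← ofReal_norm]
  refine tendsto_lintegral_of_le_mollify h.integrable_density density_nonneg (C := 4)
    (by norm_num) (fun n => ?_) (h.eventually_connForm_sub_le hr) (h.ae_tendsto_connForm hr)
  have hU := contDiff_mollifyBall h.integrableOn n
  have hη := contDiff_mollifyBall (F := NormedCLM E3 ℝ) h.integrableOn_form n
  exact ((hU.connForm (hU.fderiv_right (m := ∞) (by simp)) hη).continuous.aestronglyMeasurable.sub
    (h.integrableOn_connForm.mono_set (Metric.ball_subset_ball hr.le)).aestronglyMeasurable).norm

lemma tendsto_lintegral_sect (h : FlatData U DU η β) {r : ℝ} (hr : r < 1) :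
    Tendsto (fun n => ∫⁻ x in Metric.ball 0 r, ‖mollifyBall n U x - U x‖ₑ) atTop (𝓝 0) := by
  simp_rw [← ofReal_norm]
  refine tendsto_lintegral_of_le_mollify h.integrable_density density_nonneg (C := 2)
    (by norm_num) (fun n => ?_) (Eventually.of_forall fun n => ?_) ?_
  · exact ((contDiff_mollifyBall h.integrableOn n).continuous.aestronglyMeasurable.sub
      (h.integrableOn.mono_set (Metric.ball_subset_ball hr.le)).aestronglyMeasurable).norm
  · filter_upwards [ae_restrict_of_ae_restrict_of_subset (Metric.ball_subset_ball hr.le)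
      h.norm_eq_one] with x hx
    have h1 := norm_sub_le (mollifyBall n U x) (U x)
    have h2 := h.norm_mollifyBall_le n x
    have h3 := density_nonneg (DU := DU) (η := η) x
    have h4 := mollify_nonneg (density_nonneg (DU := DU) (η := η)) n x
    linarith
  · filter_upwards [h.ae_tendsto hr.le] with x hx
    simpa using (hx.1.sub_const (U x)).norm

/-- A sufficiently fine mollification is used; the curvature and section defects are made smaller
than δ/17 to absorb the constant of the smooth construction. -/
theorem nonempty_approxGauge (h : FlatData U DU η β) {r : ℝ} (hr0 : 0 < r) (hr : r < 1)
    {δ : ℝ≥0∞} (hδ : 0 < δ) :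
    Nonempty (ApproxGauge (fun x => connForm (U x) (DU x) (η x)) U r δ) := by
  have hε : 0 < δ / 17 := ENNReal.div_pos hδ.ne' (by simp)
  obtain ⟨n, h1, h2, h3, h4⟩ := ((ENNReal.tendsto_nhds_zero.mp (h.tendsto_lintegral_curvBound hr) _
    hε).and ((ENNReal.tendsto_nhds_zero.mp (h.tendsto_lintegral_sectBound hr) _ hε).and
    ((ENNReal.tendsto_nhds_zero.mp (h.tendsto_lintegral_connForm hr) _ hδ).and
    (ENNReal.tendsto_nhds_zero.mp (h.tendsto_lintegral_sect hr) _ hδ)))).exists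
  exact nonempty_approxGauge_of_smooth (contDiff_mollifyBall h.integrableOn n)
    (contDiff_mollifyBall (F := NormedCLM E3 ℝ) h.integrableOn_form n) (h.mollifyBall_re n)
    (h.norm_mollifyBall_le n) hr0 hr.le ENNReal.mul_div_le h1 h2 h3 h4

end FlatData

/-! ### Orthogonality of a unit field to its weak derivatives. -/

open FlatData in
/-- The weak derivatives of a map of constant norm are orthogonal to the map. -/
theorem HasWeakDifferential.ae_inner_eq_zero {F : Type*} [NormedAddCommGroup F]
    [InnerProductSpace ℝ F] [CompleteSpace F] {U : E3 → F} {DU : E3 → NormedCLM E3 F}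
    (h : HasWeakDifferential (Metric.ball 0 1) U DU) (hi : IntegrableOn U (Metric.ball 0 1))
    (hDi : IntegrableOn DU (Metric.ball 0 1))
    (h1 : ∀ᵐ x ∂(volume.restrict (Metric.ball 0 1)), ‖U x‖ = 1) (b : E3) :
    ∀ᵐ x ∂(volume.restrict (Metric.ball 0 1)), inner ℝ (U x) (DU x b) = 0 := by
  have hDb : IntegrableOn (fun x => DU x b) (Metric.ball 0 1) :=
    hDi.apply_continuousLinearMap b
  have hib : IntegrableOn (fun x => inner ℝ (U x) (DU x b)) (Metric.ball 0 1) := by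
    refine Integrable.mono' hDb.norm
      (hi.aestronglyMeasurable.inner hDb.aestronglyMeasurable) ?_
    filter_upwards [h1] with x hx
    simpa [hx] using norm_inner_le_norm (𝕜 := ℝ) (U x) (DU x b)
  have hl := locallyIntegrable_indicator_ball hi
  have hU1 : ∀ n x, ‖mollifyBall n U x‖ ≤ 1 := by
    refine norm_mollify_le_one hl ?_
    filter_upwards [(ae_restrict_iff' measurableSet_ball).mp h1] with x hx
    by_cases hxb : x ∈ Metric.ball (0 : E3) 1
    · rw [indicator_of_mem hxb, hx hxb]
    · rw [indicator_of_notMem hxb, norm_zero]; exact zero_le_one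
  have hsm : ∀ n, ContDiff ℝ ∞ (mollifyBall n U) := contDiff_mollifyBall hi
  rw [ae_restrict_iff' measurableSet_ball]
  -- Formally 2⟨U, ∂U⟩ = ∂|U|² = 0. The product rule is applied to the mollifications and tested
  -- against φ before passing to the limit on both sides.
  refine Metric.isOpen_ball.ae_eq_zero_of_integral_contDiff_smul_eq_zero hib.locallyIntegrableOn
    fun φ hφs hφc hφB => ?_
  have hφ : IsTestFunction (Metric.ball 0 1) φ := ⟨hφs, hφc, hφB⟩
  have hdφ : Continuous fun x => fderiv ℝ φ x b :=
    (hφs.continuous_fderiv (by simp)).clm_apply continuous_const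
  have hdφi : Integrable fun x => fderiv ℝ φ x b :=
    hdφ.integrable_of_hasCompactSupport (hφc.fderiv_apply ℝ b)
  obtain ⟨j, hj⟩ := exists_subset_ball_rad hφc hφB
  obtain ⟨M, hM⟩ := hφc.exists_bound_of_continuous hφs.continuous
  have hM0 : 0 ≤ M := (norm_nonneg _).trans (hM 0)
  set r := rad j with hr
  have hr1 : r < 1 := rad_lt_one j
  have hφ0 : ∀ x, x ∉ Metric.ball (0 : E3) r → φ x = 0 := fun x hx =>
    image_eq_zero_of_notMem_tsupport fun hx' => hx (hj j le_rfl hx')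
  -- the left-hand side
  have t1 : Tendsto (fun n => ∫ x, ‖mollifyBall n U x‖ ^ 2 * fderiv ℝ φ x b) atTop (𝓝 0) := by
    have h0 : ∫ x, ‖(Metric.ball 0 1).indicator U x‖ ^ 2 * fderiv ℝ φ x b = 0 := by
      have e1 : ∫ x, ‖(Metric.ball 0 1).indicator U x‖ ^ 2 * fderiv ℝ φ x b =
          ∫ x, (1 : ℝ) * fderiv ℝ φ x b := by
        refine integral_congr_ae ?_
        filter_upwards [(ae_restrict_iff' measurableSet_ball).mp h1] with x hx
        by_cases hxb : x ∈ Metric.ball (0 : E3) 1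
        · simp only [indicator_of_mem hxb, hx hxb, one_pow]
        · have : fderiv ℝ φ x = 0 := image_eq_zero_of_notMem_tsupport fun h =>
            hxb (hφB (tsupport_fderiv_subset ℝ h))
          simp [this]
      rw [e1, integral_mul_fderiv_eq_neg_fderiv_mul_of_integrable (f := fun _ : E3 => (1 : ℝ))
        (g := φ)]
      · simp
      · simp
      · simpa using hdφi
      · simpa using hφs.continuous.integrable_of_hasCompactSupport hφc
      · exact fun x _ => differentiableAt_const _
      · exact fun x _ => hφs.differentiable (by simp) x
    rw [← h0]
    refine tendsto_integral_of_dominated_convergence (fun x => ‖fderiv ℝ φ x b‖)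
      (fun n => (((hsm n).continuous.norm.pow 2).mul hdφ).aestronglyMeasurable) hdφi.norm
      (fun n => ae_of_all _ fun x => ?_) ?_
    · rw [norm_mul, norm_pow, norm_norm]
      exact mul_le_of_le_one_left (norm_nonneg _) (pow_le_one₀ (norm_nonneg _) (hU1 n x))
    · filter_upwards [ae_tendsto_mollify hl] with x hx
      exact (hx.norm.pow 2).mul_const _
  -- integration by parts
  have hdn : ∀ n, Continuous fun x => fderiv ℝ (mollifyBall n U) x b := fun n =>
    ((hsm n).continuous_fderiv (by simp)).clm_apply continuous_const
  have hin : ∀ n, Integrable fun x =>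
      inner ℝ (mollifyBall n U x) (fderiv ℝ (mollifyBall n U) x b) * φ x := fun n =>
    (((hsm n).continuous.inner (hdn n)).mul hφs.continuous).integrable_of_hasCompactSupport
      hφc.mul_left
  have e2 : ∀ n, ∫ x, ‖mollifyBall n U x‖ ^ 2 * fderiv ℝ φ x b =
      - (2 * ∫ x, inner ℝ (mollifyBall n U x) (fderiv ℝ (mollifyBall n U) x b) * φ x) := by
    intro n
    have hd : ∀ x, fderiv ℝ (fun x => ‖mollifyBall n U x‖ ^ 2) x b =
        2 * inner ℝ (mollifyBall n U x) (fderiv ℝ (mollifyBall n U) x b) := fun x => by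
      rw [((hsm n).differentiable (by simp) x).hasFDerivAt.norm_sq.fderiv]
      simp
    rw [integral_mul_fderiv_eq_neg_fderiv_mul_of_integrable
      (f := fun x => ‖mollifyBall n U x‖ ^ 2) (g := φ)]
    · simp_rw [hd, mul_assoc]
      rw [integral_const_mul]
    · simp_rw [hd, mul_assoc]
      exact (hin n).const_mul 2
    · exact (((hsm n).continuous.norm.pow 2).mul hdφ).integrable_of_hasCompactSupport
        (hφc.fderiv_apply ℝ b).mul_left
    · exact (((hsm n).continuous.norm.pow 2).mul hφs.continuous).integrable_of_hasCompactSupport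
        hφc.mul_left
    · exact fun x _ => ((hsm n).norm_sq ℝ).differentiable (by simp) x
    · exact fun x _ => hφs.differentiable (by simp) x
  -- the right-hand side
  have hset : ∀ f : E3 → ℝ, ∫ x in Metric.ball 0 r, f x * φ x = ∫ x, f x * φ x := fun f =>
    setIntegral_eq_integral_of_forall_compl_eq_zero fun x hx => by rw [hφ0 x hx, mul_zero]
  have hD0 : ∀ x, 0 ≤ (Metric.ball 0 1).indicator (fun x => ‖DU x‖) x := fun x =>
    indicator_nonneg (fun _ _ => norm_nonneg _) x
  have hDn : IntegrableOn (fun x => ‖DU x‖) (Metric.ball 0 1) := hDi.norm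
  have hle := Metric.ball_subset_ball (x := (0 : E3)) hr1.le
  have hibr : Integrable (fun x => inner ℝ (U x) (DU x b) * φ x)
      (volume.restrict (Metric.ball 0 r)) :=
    (hib.mono_set hle).mul_bdd hφs.continuous.aestronglyMeasurable (ae_of_all _ hM)
  have t2 : Tendsto (fun n => ∫ x in Metric.ball 0 r,
      inner ℝ (mollifyBall n U x) (fderiv ℝ (mollifyBall n U) x b) * φ x) atTop
      (𝓝 (∫ x in Metric.ball 0 r, inner ℝ (U x) (DU x b) * φ x)) := by
    -- The mollified U is bounded by 1 and its derivative by the mollification of |DU|, so the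
    -- dominated convergence with a mollified majorant applies.
    refine tendsto_integral_of_L1 _ hibr.aestronglyMeasurable
      (Eventually.of_forall fun n => (hin n).restrict) ?_
    simp_rw [← ofReal_norm]
    have hev := eventually_add_shrinkingBump_lt hr1
    refine tendsto_lintegral_of_le_mollify (hDn.integrable_indicator measurableSet_ball) hD0
      (C := M * ‖b‖) (by positivity)
      (fun n => ((hin n).restrict.sub hibr).aestronglyMeasurable.norm) ?_ ?_
    · filter_upwards [hev] with n hn
      filter_upwards [ae_restrict_of_ae_restrict_of_subset hle h1,
        ae_restrict_mem measurableSet_ball] with x hx hxr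
      rw [← sub_mul, norm_mul, indicator_of_mem (hle hxr), mul_comm, mul_assoc]
      refine mul_le_mul (hM x) ?_ (norm_nonneg _) hM0
      have e3 := norm_inner_le_norm (𝕜 := ℝ) (mollifyBall n U x) (fderiv ℝ (mollifyBall n U) x b)
      have e4 := norm_inner_le_norm (𝕜 := ℝ) (U x) (DU x b)
      have e5 : fderiv ℝ (mollifyBall n U) x = mollifyBall n DU x :=
        fderiv_mollify_indicator_eq h hi hDi (hn x hxr)
      have e6 : ‖mollifyBall n DU x‖ ≤
          mollify n ((Metric.ball 0 1).indicator fun x => ‖DU x‖) x := by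
        refine (norm_mollify_le n x).trans (le_of_eq ?_)
        simp_rw [norm_indicator_eq_indicator_norm]
      have e7 := (mollifyBall n DU x).le_opNorm b
      have e8 := (DU x).le_opNorm b
      rw [e5] at e3 ⊢
      rw [hx, one_mul] at e4
      have e9 : ‖mollifyBall n U x‖ * ‖mollifyBall n DU x b‖ ≤ ‖mollifyBall n DU x b‖ :=
        mul_le_of_le_one_left (norm_nonneg _) (hU1 n x)
      refine (norm_sub_le _ _).trans ?_
      have e10 := mul_le_mul_of_nonneg_right e6 (norm_nonneg b)
      nlinarith [norm_nonneg b]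
    · filter_upwards [ae_tendsto_mollify_indicator hi hr1.le,
        ae_tendsto_mollify_indicator (F := NormedCLM E3 F) hDi hr1.le,
        ae_restrict_mem measurableSet_ball] with x hx hDx hxr
      have e3 : Tendsto (fun n => mollifyBall n DU x b) atTop (𝓝 (DU x b)) :=
        ((ContinuousLinearMap.apply ℝ F b).continuous.tendsto _).comp hDx
      have e4 := (((hx.inner e3).mul_const (φ x)).sub_const
        (inner ℝ (U x) (DU x b) * φ x)).norm
      rw [sub_self, norm_zero] at e4
      refine e4.congr' ?_
      filter_upwards [hev] with n hn
      rw [show fderiv ℝ (mollifyBall n U) x = mollifyBall n DU x from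
        fderiv_mollify_indicator_eq h hi hDi (hn x hxr)]
      rfl
  simp_rw [hset] at t2
  simp_rw [e2] at t1
  have e11 := tendsto_nhds_unique t1 ((t2.const_mul 2).neg)
  simp_rw [smul_eq_mul, mul_comm (φ _)]
  linarith

/-! ### The Hopf map in quaternionic coordinates. -/

/-- The quaternion with given components. -/
def quat (a b c d : ℝ) : ℍ := ⟨a, b, c, d⟩

@[simp] lemma quat_re (a b c d : ℝ) : (quat a b c d).re = a := rfl
@[simp] lemma quat_imI (a b c d : ℝ) : (quat a b c d).imI = b := rfl
@[simp] lemma quat_imJ (a b c d : ℝ) : (quat a b c d).imJ = c := rfl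
@[simp] lemma quat_imK (a b c d : ℝ) : (quat a b c d).imK = d := rfl

/-- Three-space as the space of imaginary quaternions. -/
noncomputable def imQ : E3 →ₗᵢ[ℝ] ℍ where
  toFun v := quat 0 (v 0) (v 1) (v 2)
  map_add' a b := by ext <;> simp
  map_smul' r a := by ext <;> simp
  norm_map' v := by
    rw [← sq_eq_sq₀ (norm_nonneg _) (norm_nonneg _), EuclideanSpace.norm_sq_eq, sq,
      ← Quaternion.normSq_eq_norm_mul_self, Quaternion.normSq_def']
    simp [Fin.sum_univ_three, LinearMap.coe_mk]

lemma imQ_re (v : E3) : (imQ v).re = 0 := rfl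
lemma imQ_imI (v : E3) : (imQ v).imI = v 0 := rfl
lemma imQ_imJ (v : E3) : (imQ v).imJ = v 1 := rfl
lemma imQ_imK (v : E3) : (imQ v).imK = v 2 := rfl

lemma imQ_anticomm {y a : E3} (h : inner ℝ y a = 0) : imQ a * imQ y = -(imQ y * imQ a) := by
  simp only [PiLp.inner_apply, Fin.sum_univ_three, RCLike.inner_apply, conj_trivial] at h
  ext <;> simp [imQ_re, imQ_imI, imQ_imJ, imQ_imK]
  · linarith
  all_goals ring

/-- The commutator of imaginary quaternions is twice the cross product, and a × b is y times det(y,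
a, b) when a and b are orthogonal to the unit vector y. -/
lemma imQ_comm {y a b : E3} (hy : ‖y‖ = 1) (ha : inner ℝ y a = 0) (hb : inner ℝ y b = 0) :
    imQ a * imQ b - imQ b * imQ a = (2 * sphereVolumeForm y a b) • imQ y := by
  have hy2 : y 0 ^ 2 + y 1 ^ 2 + y 2 ^ 2 = 1 := by
    have := EuclideanSpace.norm_sq_eq y
    simpa [Fin.sum_univ_three, hy] using this.symm
  simp only [PiLp.inner_apply, Fin.sum_univ_three, RCLike.inner_apply, conj_trivial] at ha hb
  have hdet : sphereVolumeForm y a b = y 0 * (a 1 * b 2 - a 2 * b 1) +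
      y 1 * (a 2 * b 0 - a 0 * b 2) + y 2 * (a 0 * b 1 - a 1 * b 0) := by
    simp [sphereVolumeForm, Matrix.det_fin_three]
    ring
  rw [hdet]
  ext
  · simp [imQ_re, imQ_imI, imQ_imJ, imQ_imK]; ring
  · simp [imQ_re, imQ_imI, imQ_imJ, imQ_imK]
    -- Coordinates of the identity |y|²(a × b) = (y · (a × b))y + (y · a)(y × b) − (y · b)(y × a).
    linear_combination (-2 * (a 1 * b 2 - a 2 * b 1)) * hy2 +
      2 * (y 1 * b 2 - y 2 * b 1) * ha - 2 * (y 1 * a 2 - y 2 * a 1) * hb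
  · simp [imQ_re, imQ_imI, imQ_imJ, imQ_imK]
    linear_combination (-2 * (a 2 * b 0 - a 0 * b 2)) * hy2 +
      2 * (y 2 * b 0 - y 0 * b 2) * ha - 2 * (y 2 * a 0 - y 0 * a 2) * hb
  · simp [imQ_re, imQ_imI, imQ_imJ, imQ_imK]
    linear_combination (-2 * (a 0 * b 1 - a 1 * b 0)) * hy2 +
      2 * (y 0 * b 1 - y 1 * b 0) * ha - 2 * (y 0 * a 1 - y 1 * a 0) * hb

/-- The quaternions as two-dimensional complex space. -/
noncomputable def toC2 : ℍ →ₗᵢ[ℝ] C2 where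
  -- This pairing of the components makes the given formula for the Hopf map equal to q ↦ q k q̄,
  -- with k at the north pole.
  toFun q := !₂[⟨q.re, q.imK⟩, ⟨q.imJ, q.imI⟩]
  map_add' a b := by ext i; fin_cases i <;> simp [Complex.ext_iff]
  map_smul' r a := by ext i; fin_cases i <;> simp [Complex.ext_iff]
  norm_map' q := by
    rw [← sq_eq_sq₀ (norm_nonneg _) (norm_nonneg _), EuclideanSpace.norm_sq_eq, sq ‖q‖,
      ← Quaternion.normSq_eq_norm_mul_self, Quaternion.normSq_def']
    simp [Complex.sq_norm, Complex.normSq_apply]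
    ring

lemma toC2_zero (q : ℍ) : toC2 q 0 = ⟨q.re, q.imK⟩ := rfl
lemma toC2_one (q : ℍ) : toC2 q 1 = ⟨q.imJ, q.imI⟩ := rfl

/-- The imaginary unit over the north pole. -/
def unitK : ℍ := quat 0 0 0 1

lemma hopfMap_toC2 {q : ℍ} {y : E3} (h : imQ y = q * unitK * star q) : hopfMap (toC2 q) = y := by
  have h1 := congrArg (fun z : ℍ => z.imI) h
  have h2 := congrArg (fun z : ℍ => z.imJ) h
  have h3 := congrArg (fun z : ℍ => z.imK) h
  simp [imQ_imI, imQ_imJ, imQ_imK, unitK] at h1 h2 h3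
  ext i
  fin_cases i
  · simp [hopfMap, toC2_zero, toC2_one, h1]; ring
  · simp [hopfMap, toC2_zero, toC2_one, h2]; ring
  · simp [hopfMap, toC2_zero, toC2_one, h3, Complex.sq_norm, Complex.normSq_apply]; ring

/-- All imaginary unit quaternions are conjugate. -/
lemma exists_conj_unitK {c : ℍ} (hc : ‖c‖ = 1) (hre : c.re = 0) :
    ∃ p : ℍ, ‖p‖ = 1 ∧ c * p = p * unitK := by
  have hk : unitK * unitK = -1 := by ext <;> simp [unitK]
  have hcc : c * c = -1 := by
    have h4 := star_mul_self_of_norm_one hc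
    rw [star_eq_neg_of_re_eq_zero hre, neg_mul] at h4
    rw [← h4, neg_neg]
  suffices h : ∃ p : ℍ, p ≠ 0 ∧ c * p = p * unitK by
    obtain ⟨p, hp, h⟩ := h
    refine ⟨‖p‖⁻¹ • p, ?_, by rw [mul_smul_comm, smul_mul_assoc, h]⟩
    rw [norm_smul, norm_inv, norm_norm, inv_mul_cancel₀ (norm_ne_zero_iff.mpr hp)]
  by_cases h : c = -unitK
  · refine ⟨quat 0 1 0 0, fun h0 => ?_, ?_⟩
    · simpa using congrArg (fun z : ℍ => z.imI) h0
    · rw [h]; ext <;> simp [unitK]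
  -- Since c² = k² = −1, both c(1 − ck) and (1 − ck)k equal c + k. The intertwiner vanishes only for
  -- c = −k, where i serves instead.
  · refine ⟨1 - c * unitK, fun h0 => h ?_, ?_⟩
    · have h1 : c * unitK * unitK = unitK := by rw [← sub_eq_zero.mp h0, one_mul]
      rw [mul_assoc, hk, mul_neg, mul_one] at h1
      rw [← h1, neg_neg]
    · rw [mul_sub, sub_mul, ← mul_assoc, hcc, mul_assoc c, hk]
      simp [add_comm]

/-- In ½U(p − s) the factor U is a unit, and the imaginary p is orthogonal to the real s. -/
lemma sq_norm_connVal {U p : ℍ} (hU : ‖U‖ = 1) (hp : p * U = -(U * p)) (hre : p.re = 0) (s : ℝ) :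
    4 * ‖connVal U p s‖ ^ 2 = ‖p‖ ^ 2 + s ^ 2 := by
  rw [connVal_eq hp, norm_smul, norm_mul, hU, one_mul, mul_pow, Real.norm_of_nonneg (by norm_num),
    sq ‖_‖, sq ‖p‖, ← Quaternion.normSq_eq_norm_mul_self, ← Quaternion.normSq_eq_norm_mul_self,
    Quaternion.normSq_def', Quaternion.normSq_def']
  simp [hre]
  ring

/-- By Riesz, the operator norm of a covector is its Euclidean norm, so ‖η‖² is the sum of squares
of the components. -/
lemma sq_norm_eq_sum (l : NormedCLM E3 ℝ) : ‖l‖ ^ 2 = ∑ i, l (stdVec i) ^ 2 := by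
  obtain ⟨y, rfl⟩ := (InnerProductSpace.toDual ℝ E3).surjective l
  rw [LinearIsometryEquiv.norm_map, EuclideanSpace.norm_sq_eq]
  simp [stdVec, Fin.sum_univ_three, sq_abs, EuclideanSpace.inner_single_right]

lemma HasWeakDifferential.isometry_comp {F G : Type*} [NormedAddCommGroup F] [NormedSpace ℝ F]
    [CompleteSpace F] [NormedAddCommGroup G] [NormedSpace ℝ G] [CompleteSpace G] {Ω : Set E3}
    {f : E3 → F} {Df : E3 → NormedCLM E3 F} (h : HasWeakDifferential Ω f Df) (L : F →ₗᵢ[ℝ] G)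
    (h1 : LocallyIntegrableOn (fun x => L (f x)) Ω volume)
    (h2 : LocallyIntegrableOn (fun x => L.toContinuousLinearMap ∘L Df x) Ω volume) :
    HasWeakDifferential Ω (fun x => L (f x)) (fun x => L.toContinuousLinearMap ∘L Df x) where
  locInt := h1
  locInt_diff := h2
  integral_eq φ hφ b := by
    have e1 : ∀ x, (fderiv ℝ φ x b) • L (f x) = L ((fderiv ℝ φ x b) • f x) := fun x => by simp
    have e2 : ∀ x, φ x • (L.toContinuousLinearMap ∘L Df x) b = L (φ x • Df x b) := fun x => by
      simp
    simp_rw [e1, e2]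
    rw [L.integral_comp_comm, L.integral_comp_comm, h.integral_eq φ hφ b, map_neg]

/-! ### From the Sobolev map to the lift. -/

lemma integrableOn_sq_norm {F : Type*} [NormedAddCommGroup F] {f : E3 → F}
    (h : MemLp f 3 (volume.restrict (Metric.ball 0 1))) :
    IntegrableOn (fun x => ‖f x‖ ^ 2) (Metric.ball 0 1) := by
  have : IsFiniteMeasure (volume.restrict (Metric.ball (0 : E3) 1)) :=
    ⟨by rw [Measure.restrict_apply_univ]; exact measure_ball_lt_top⟩
  exact (h.mono_exponent (p := 2) (by norm_num)).norm.integrable_sq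

lemma integrableOn_of_memLp {F : Type*} [NormedAddCommGroup F] {f : E3 → F}
    (h : MemLp f 3 (volume.restrict (Metric.ball 0 1))) : IntegrableOn f (Metric.ball 0 1) := by
  have : IsFiniteMeasure (volume.restrict (Metric.ball (0 : E3) 1)) :=
    ⟨by rw [Measure.restrict_apply_univ]; exact measure_ball_lt_top⟩
  exact h.integrable (by norm_num)

/-- The quaternionic form of a differential with values in three-space. -/
noncomputable def imQForm (L : NormedCLM E3 E3) : QForm := imQ.toContinuousLinearMap ∘L L

@[simp] lemma imQForm_apply (L : NormedCLM E3 E3) (b : E3) : imQForm L b = imQ (L b) := rfl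

lemma norm_imQForm_le (L : NormedCLM E3 E3) : ‖imQForm L‖ ≤ ‖L‖ :=
  ContinuousLinearMap.opNorm_le_bound _ (norm_nonneg _) fun b => by
    rw [imQForm_apply, imQ.norm_map]; exact L.le_opNorm b

lemma MeasureTheory.MemLp.imQForm {Du : E3 → NormedCLM E3 E3} {p : ℝ≥0∞} {μ : Measure E3}
    (h : MemLp Du p μ) : MemLp (fun x => imQForm (Du x)) p μ :=
  h.of_le ((ContinuousLinearMap.compL ℝ E3 E3 ℍ
      imQ.toContinuousLinearMap).continuous.comp_aestronglyMeasurable h.aestronglyMeasurable)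
    (ae_of_all _ fun x => norm_imQForm_le (Du x))

/-- Orthogonality of u to its derivatives turns into anticommutation, and the pullback of the area
form into the commutator identity. Testing the three basis vectors gives one null set valid for all
directions. -/
lemma flatData_of_isSobolevMap {u : E3 → E3} {Du : E3 → NormedCLM E3 E3}
    (hu : IsSobolevMap (Metric.ball 0 1) 3 sphere2 u Du) {η : E3 → NormedCLM E3 ℝ}
    (hη : MemLp η 3 (volume.restrict (Metric.ball 0 1)))
    (hdη : HasWeakExtDeriv (Metric.ball 0 1) η (pullbackSphereVolumeForm u Du)) :
    FlatData (fun x => imQ (u x)) (fun x => imQForm (Du x)) η (pullbackSphereVolumeForm u Du) := by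
  have hU : MemLp (fun x => imQ (u x)) 3 (volume.restrict (Metric.ball 0 1)) :=
    hu.memLp.of_le (imQ.continuous.comp_aestronglyMeasurable hu.memLp.aestronglyMeasurable)
      (ae_of_all _ fun x => (imQ.norm_map _).le)
  have hDU := MemLp.imQForm (Du := Du) hu.memLp_diff
  have h1 : ∀ᵐ x ∂(volume.restrict (Metric.ball 0 1)), ‖u x‖ = 1 := by
    filter_upwards [hu.mem_target] with x hx
    simpa [sphere2] using hx
  have horth : ∀ᵐ x ∂(volume.restrict (Metric.ball 0 1)), ∀ b, inner ℝ (u x) (Du x b) = 0 := by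
    have h2 : ∀ᵐ x ∂(volume.restrict (Metric.ball 0 1)), ∀ i,
        inner ℝ (u x) (Du x (stdVec i)) = 0 := ae_all_iff.mpr fun i =>
      hu.weakDiff.ae_inner_eq_zero (integrableOn_of_memLp hu.memLp)
        (integrableOn_of_memLp (F := NormedCLM E3 E3) hu.memLp_diff) h1 _
    filter_upwards [h2] with x hx b
    rw [← sum_smul_stdVec b, map_sum, inner_sum]
    exact Finset.sum_eq_zero fun i _ => by rw [map_smul, inner_smul_right, hx, mul_zero]
  exact
  { weakDiff := hu.weakDiff.isometry_comp imQ (integrableOn_of_memLp hU).locallyIntegrableOn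
      (integrableOn_of_memLp (F := QForm) hDU).locallyIntegrableOn
    weakExtDeriv := hdη
    integrableOn := integrableOn_of_memLp hU
    integrableOn_diff := integrableOn_of_memLp (F := QForm) hDU
    integrableOn_form := integrableOn_of_memLp (F := NormedCLM E3 ℝ) hη
    integrableOn_sq_diff := integrableOn_sq_norm (F := QForm) hDU
    integrableOn_sq_form := integrableOn_sq_norm (F := NormedCLM E3 ℝ) hη
    re_eq_zero := fun x => imQ_re _
    norm_eq_one := by
      filter_upwards [h1] with x hx
      rw [imQ.norm_map, hx]
    anticomm := by
      filter_upwards [horth] with x hx b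
      exact imQ_anticomm (hx b)
    comm := by
      filter_upwards [h1, horth] with x hx hx2 c b
      exact imQ_comm hx (hx2 c) (hx2 b) }

/-- Right multiplication by a unit quaternion followed by the identification with `ℂ²`. -/
noncomputable def mulToC2 (p : ℍ) (hp : ‖p‖ = 1) : ℍ →ₗᵢ[ℝ] C2 :=
  toC2.comp
    { toLinearMap := LinearMap.mulRight ℝ p
      norm_map' := fun q => by simp [norm_mul, hp] }

lemma mulToC2_apply (p : ℍ) (hp : ‖p‖ = 1) (q : ℍ) : mulToC2 p hp q = toC2 (q * p) := rfl

/-- The product of a quaternionic form with a quaternion from the right. -/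
noncomputable def mulForm (w : ℍ) (A : QForm) : QForm :=
  ((ContinuousLinearMap.mul ℝ ℍ).flip w) ∘L A

@[simp] lemma mulForm_apply (w : ℍ) (A : QForm) (b : E3) : mulForm w A b = A b * w := rfl

lemma MeasureTheory.AEStronglyMeasurable.mulForm {μ : Measure E3} {w : E3 → ℍ} {A : E3 → QForm}
    (hw : AEStronglyMeasurable w μ) (hA : AEStronglyMeasurable A μ) :
    AEStronglyMeasurable (fun x => mulForm (w x) (A x)) μ :=
  ((ContinuousLinearMap.compL ℝ E3 ℍ ℍ) ∘L
    (ContinuousLinearMap.mul ℝ ℍ).flip).aestronglyMeasurable_comp₂ hw hA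

/-- The differential of the lift. -/
noncomputable def liftDiff (p : ℍ) (hp : ‖p‖ = 1) (w : ℍ) (A : QForm) : NormedCLM E3 C2 :=
  (mulToC2 p hp).toContinuousLinearMap ∘L mulForm w A

lemma liftDiff_apply (p : ℍ) (hp : ‖p‖ = 1) (w : ℍ) (A : QForm) (b : E3) :
    liftDiff p hp w A b = mulToC2 p hp (A b * w) := rfl

lemma norm_liftDiff_apply {p : ℍ} (hp : ‖p‖ = 1) {w : ℍ} (hw : ‖w‖ = 1) (A : QForm) (b : E3) :
    ‖liftDiff p hp w A b‖ = ‖A b‖ := by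
  rw [liftDiff_apply, LinearIsometry.norm_map, norm_mul, hw, mul_one]

/-- The energy identity for the lift. -/
lemma hsNormSq_add_sq_norm_eq {u : E3} (hu : ‖u‖ = 1) {L : NormedCLM E3 E3}
    (h : ∀ b, imQ (L b) * imQ u = -(imQ u * imQ (L b))) (l : NormedCLM E3 ℝ) {p : ℍ}
    (hp : ‖p‖ = 1) {w : ℍ} (hw : ‖w‖ = 1) :
    hsNormSq L + ‖l‖ ^ 2 = 4 * hsNormSq (liftDiff p hp w (connForm (imQ u) (imQForm L) l)) := by
  rw [sq_norm_eq_sum, hsNormSq, hsNormSq, ← Finset.sum_add_distrib, Finset.mul_sum]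
  refine Finset.sum_congr rfl fun i _ => ?_
  rw [norm_liftDiff_apply hp hw, connForm_apply, imQForm_apply,
    sq_norm_connVal (by rw [imQ.norm_map, hu]) (h _) (imQ_re _), imQ.norm_map]
  rfl

lemma memLp_connForm {u : E3 → E3} {Du : E3 → NormedCLM E3 E3}
    (hu : IsSobolevMap (Metric.ball 0 1) 3 sphere2 u Du) {η : E3 → NormedCLM E3 ℝ}
    (hη : MemLp η 3 (volume.restrict (Metric.ball 0 1))) :
    MemLp (fun x => connForm (imQ (u x)) (imQForm (Du x)) (η x)) 3
      (volume.restrict (Metric.ball 0 1)) := by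
  have hDU := MemLp.imQForm (Du := Du) hu.memLp_diff
  have hm : AEStronglyMeasurable (fun x => connForm (imQ (u x)) (imQForm (Du x)) (η x))
      (volume.restrict (Metric.ball 0 1)) :=
    (imQ.continuous.comp_aestronglyMeasurable hu.memLp.aestronglyMeasurable).connForm
      hDU.aestronglyMeasurable hη.aestronglyMeasurable
  have hb : MemLp (fun x => ‖imQForm (Du x)‖ + ‖η x‖) 3 (volume.restrict (Metric.ball 0 1)) :=
    MemLp.add (MemLp.norm hDU) (MemLp.norm hη)
  refine MemLp.of_le hb hm ?_
  filter_upwards [hu.mem_target] with x hx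
  rw [Real.norm_of_nonneg (by positivity)]
  exact norm_connForm_le (by rw [imQ.norm_map]; simpa [sphere2] using hx.le) _ _

theorem mainTheorem10
    (u : E3 → E3) (Du : E3 → E3 →L[ℝ] E3)
    (hu : IsSobolevMap unitBall3 3 sphere2 u Du)
    (η : E3 → E3 →L[ℝ] ℝ)
    (hη : MemLp η 3 (volume.restrict unitBall3))
    (hdη : HasWeakExtDeriv unitBall3 η (pullbackSphereVolumeForm u Du)) :
    ∃ (v : E3 → C2) (Dv : E3 → E3 →L[ℝ] C2),
      IsSobolevMap unitBall3 3 sphere3 v Dv ∧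
      (∀ᵐ x ∂(volume.restrict unitBall3), hopfMap (v x) = u x) ∧
      (∀ᵐ x ∂(volume.restrict unitBall3),
        hsNormSq (Du x) + ‖η x‖ ^ 2 = 4 * hsNormSq (Dv x)) := by
  simp only [unitBall3] at *
  have hfin : IsFiniteMeasure (volume.restrict (Metric.ball (0 : E3) 1)) :=
    ⟨by rw [Measure.restrict_apply_univ]; exact measure_ball_lt_top⟩
  have hF := flatData_of_isSobolevMap hu hη hdη
  have hA := memLp_connForm hu hη
  obtain ⟨w, c, hwm, hw1, hwd, hwc⟩ := exists_gauge_of_approxGauge hF.integrableOn_connForm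
    hF.integrableOn.aestronglyMeasurable fun k =>
      hF.nonempty_approxGauge (rad_pos k) (rad_lt_one k) (ENNReal.pow_pos (by simp) k)
  have hne : NeBot (ae (volume.restrict (Metric.ball (0 : E3) 1))) := by
    rw [ae_neBot, Ne, Measure.restrict_eq_zero]
    exact (Metric.measure_ball_pos _ _ one_pos).ne'
  -- The constant c is conjugate to the value of U at a good point, hence is itself an imaginary
  -- unit.
  obtain ⟨x₀, hx₀, hx₀'⟩ := (hwc.and hF.norm_eq_one).exists
  have hc1 : ‖c‖ = 1 := by
    rw [← hx₀, norm_mul, norm_mul, Quaternion.norm_star, hw1, hx₀', mul_one, mul_one]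
  have hcre : c.re = 0 := by
    have h1 : star c = -c := by
      rw [← hx₀, star_mul, star_mul, star_star, star_eq_neg_of_re_eq_zero (imQ_re _)]
      noncomm_ring
    exact Quaternion.star_eq_neg.mp h1
  obtain ⟨p, hp, hcp⟩ := exists_conj_unitK hc1 hcre
  have hvm : AEStronglyMeasurable (fun x => mulToC2 p hp (w x))
      (volume.restrict (Metric.ball 0 1)) :=
    (mulToC2 p hp).continuous.comp_aestronglyMeasurable hwm
  have hv1 : ∀ x, ‖mulToC2 p hp (w x)‖ = 1 := fun x => by rw [LinearIsometry.norm_map, hw1]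
  have hv : MemLp (fun x => mulToC2 p hp (w x)) 3 (volume.restrict (Metric.ball 0 1)) :=
    MemLp.of_bound hvm 1 (ae_of_all _ fun x => (hv1 x).le)
  have hDw : MemLp (fun x => mulForm (w x) (connForm (imQ (u x)) (imQForm (Du x)) (η x))) 3
      (volume.restrict (Metric.ball 0 1)) :=
    MemLp.of_le hA (hwm.mulForm hA.aestronglyMeasurable) (ae_of_all _ fun x =>
      ContinuousLinearMap.opNorm_le_bound _ (norm_nonneg _) fun b => by
        rw [mulForm_apply, norm_mul, hw1, mul_one]
        exact ContinuousLinearMap.le_opNorm _ b)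
  have hDv : MemLp (fun x => liftDiff p hp (w x)
      (connForm (imQ (u x)) (imQForm (Du x)) (η x))) 3 (volume.restrict (Metric.ball 0 1)) :=
    MemLp.of_le hA ((ContinuousLinearMap.compL ℝ E3 ℍ C2
      (mulToC2 p hp).toContinuousLinearMap).continuous.comp_aestronglyMeasurable
        hDw.aestronglyMeasurable) (ae_of_all _ fun x =>
      ContinuousLinearMap.opNorm_le_bound _ (norm_nonneg _) fun b => by
        rw [norm_liftDiff_apply hp (hw1 x)]
        exact ContinuousLinearMap.le_opNorm _ b)
  have hwi : MemLp w 3 (volume.restrict (Metric.ball 0 1)) :=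
    MemLp.of_bound hwm 1 (ae_of_all _ fun x => (hw1 x).le)
  have hwD : HasWeakDifferential (Metric.ball 0 1) w
      (fun x => mulForm (w x) (connForm (imQ (u x)) (imQForm (Du x)) (η x))) :=
    ⟨(integrableOn_of_memLp hwi).locallyIntegrableOn,
      (integrableOn_of_memLp (F := QForm) hDw).locallyIntegrableOn, hwd⟩
  refine ⟨fun x => mulToC2 p hp (w x), fun x => liftDiff p hp (w x)
      (connForm (imQ (u x)) (imQForm (Du x)) (η x)), ⟨hv, hDv, ?_, ?_⟩, ?_, ?_⟩
  · exact hwD.isometry_comp (mulToC2 p hp) (integrableOn_of_memLp hv).locallyIntegrableOn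
      (integrableOn_of_memLp (F := NormedCLM E3 C2) hDv).locallyIntegrableOn
  · exact ae_of_all _ fun x => by simpa [sphere3] using hv1 x
  · filter_upwards [hwc] with x hx
    rw [mulToC2_apply]
    refine hopfMap_toC2 ?_
    -- From w̄Uw = c and cp = pk one gets U = w c w̄ = (wp) k (wp)‾, the Hopf relation for the lift
    -- wp.
    have h1 : imQ (u x) = w x * c * star (w x) := by
      rw [← hx, ← mul_assoc, ← mul_assoc, self_mul_star_of_norm_one (hw1 x), one_mul, mul_assoc,
        self_mul_star_of_norm_one (hw1 x), mul_one]
    rw [h1, star_mul, ← mul_assoc, mul_assoc (w x) p, ← hcp, mul_assoc (w x) (c * p), mul_assoc c,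
      self_mul_star_of_norm_one hp, mul_one]
  · filter_upwards [hF.norm_eq_one, hF.anticomm] with x hx hx2
    rw [imQ.norm_map] at hx
    exact hsNormSq_add_sq_norm_eq hx hx2 (η x) hp (hw1 x)
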